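/- Fix $d>1$ and $\delta\in(0,1/\sqrt d)$, and set $u=1/\sqrt d-\delta$. For each integer $n\ge d$, let $G\sim\mathsf G(n,d/n)$ be the Erdős–Rényi random graph, that is, the random simple graph on $n$ vertices in which each pair of distinct vertices is joined by an edge independently with probability $d/n$. Let $A\in\mathbb R^{n\times n}$ be its adjacency matrix, $D=\operatorname{diag}(A\mathbf 1)$ its diagonal degree matrix, $I$ the identity matrix and $\mathbf 1\in\mathbb R^n$ the all-ones vector. Then \[ \mathbb P\left[\frac{1+\delta-u^2}{u}\,I+u\,D-A+\frac{(1-u^2)\,d}{n}\,\mathbf 1\mathbf 1^{\mathsf T}\succ 0\right]\longrightarrow 1\qquad\text{as } n\to\infty, \] where $M\succ 0$ means that the symmetric matrix $M$ is positive definite. -/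

import Mathlib

open Filter Topology

noncomputable section

/-- The Erdős–Rényi random graph `G(n, d/n)`: the law on simple graphs with vertex set `Fin n` under
which each unordered pair of distinct vertices is an edge independently with probability `d/n`.
The projection onto `[0, 1]` changes nothing as soon as `0 ≤ d ≤ n`; for `n < d` the quotient `d/n`
is not a probability. -/
def erdosRenyi (n : ℕ) (d : ℝ) : MeasureTheory.Measure (SimpleGraph (Fin n)) :=
  SimpleGraph.binomialRandom (Fin n) (Set.projIcc (0 : ℝ) 1 zero_le_one (d / n))

open Classical in
/-- The real adjacency matrix `A` of a graph. -/
def adjacency {n : ℕ} (G : SimpleGraph (Fin n)) : Matrix (Fin n) (Fin n) ℝ :=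
  G.adjMatrix ℝ

/-- The diagonal degree matrix `D = diag(A 1)` of a graph. -/
def degreeMatrix {n : ℕ} (G : SimpleGraph (Fin n)) : Matrix (Fin n) (Fin n) ℝ :=
  Matrix.diagonal (Matrix.mulVec (adjacency G) 1)

/-- The all-ones matrix `1 1ᵀ`. -/
def onesMatrix (n : ℕ) : Matrix (Fin n) (Fin n) ℝ :=
  Matrix.vecMulVec 1 1

end

/-!
The matrix in question is `u⁻¹ • (N u + δ • 1)`, where, with `A` the adjacency matrix, `D` the
degree matrix, `p = d / n` and `J` the all-ones matrix,
`N t = (1 - t ^ 2) • 1 + t ^ 2 • D - t • A + (t * (1 - t ^ 2) * p) • J`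
is the deformed Laplacian with a rank-one correction. As `N 0 = 1`,
it suffices that `N t` is invertible for `0 ≤ t ≤ u` (`posDef_of_det_ne_zero`).

Without the correction, the generating function of the non-backtracking walks inverts the deformed
Laplacian. With it, the same holds for typed words, in which a step either runs along an edge,
with weight `A`, or jumps anywhere, with weight `-p`, and in which only pairs of consecutive edge
steps are forbidden to backtrack: if `Y k` is the matrix of such words of `k` steps (`nbSum`),
then `N t * ∑ l < k + 2, t ^ l • Y l` is `(1 - t ^ 2) • 1` up to terms in the `t ^ l • Y l` with
`k ≤ l ≤ k + 2` (`deformedLaplacian_mul_sum`). So it suffices that these three matrices are small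
compared to the inverse of the maximal degree (`posDef_deformedLaplacian`). Since `u * √d < 1`, it
is enough that `‖Y l‖` is at most about `d ^ (l / 2)`.

Split `Y k` into the self-avoiding words, `Z`, and the other ones, `R`.

* In `Z` the types may be summed over, which gives a sum over self-avoiding words weighted by the
  entries of the centred matrix `A - p J`. Its norm is bounded by the trace method: in the
  expectation of the trace of `Z ^ (2 * m)` only those words of `2 * m` self-avoiding blocks
  survive which cover each of their edges at least twice. Each independent cycle of such a word
  costs a factor `1 / n`, and words with `g` cycles have at most `Q ^ (g + 1)` patterns, with
  `Q ≤ n / 2`, because between excess steps a block climbs, descends and discovers in this order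
  (`card_changes_le`, `sum_pow_card_edges_le_of_blocks`).
* For `R` the Frobenius norm suffices. A pair of non-backtracking walks which are not
  self-avoiding has at least as many edges as vertices. In the case of equality the pair winds
  around a single cycle, every edge is covered at least twice, and the number of patterns is
  polynomial in `k`; otherwise there is a factor `1 / n` which beats the number of all patterns
  (`sum_pow_labelCount_le`).

The maximal degree is bounded by exponential moments. With `s` the integer part of the fourth root
of `log n`, words of about `s ^ 3` steps and the exponent `m = s ^ 2` make all error terms vanish:
`log n ≤ (s + 1) ^ 4` is negligible against `m * k ≥ s ^ 5`, the logarithm of `Q`, of order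
`s ^ 2 * log s`, is negligible against `log n`, and so is `k * log k`, while `(u * √d) ^ k` decays faster
than any power of `log n`.
-/

open scoped Matrix.Norms.L2Operator

/-! ### Exploration patterns of words -/

section Pattern

variable {V : Type*}

open Classical in
/-- The first time at which the word `ω` is at the vertex `ω t`. The function `firstVisit ω` records
which entries of `ω` coincide, and renames each vertex by the time of its discovery. -/
noncomputable def firstVisit (ω : ℕ → V) (t : ℕ) : ℕ :=
  Nat.find (⟨t, rfl⟩ : ∃ s, ω s = ω t)

lemma firstVisit_le (ω : ℕ → V) (t : ℕ) : firstVisit ω t ≤ t := by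
  classical exact Nat.find_min' _ rfl

lemma apply_firstVisit (ω : ℕ → V) (t : ℕ) : ω (firstVisit ω t) = ω t := by
  classical exact Nat.find_spec (⟨t, rfl⟩ : ∃ s, ω s = ω t)

lemma firstVisit_le_of_eq {ω : ℕ → V} {s t : ℕ} (h : ω s = ω t) : firstVisit ω t ≤ s := by
  classical exact Nat.find_min' _ h

lemma firstVisit_eq_iff {ω : ℕ → V} {s t : ℕ} : firstVisit ω s = firstVisit ω t ↔ ω s = ω t := by
  constructor
  · intro h
    rw [← apply_firstVisit ω s, h, apply_firstVisit ω t]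
  · intro h
    apply le_antisymm
    · exact firstVisit_le_of_eq (by rw [apply_firstVisit ω t, h])
    · exact firstVisit_le_of_eq (by rw [apply_firstVisit ω s, h])

/-- A pattern is a word in `ℕ` which is its own first-visit function. -/
structure IsPattern (π : ℕ → ℕ) : Prop where
  le : ∀ t, π t ≤ t
  idem : ∀ t, π (π t) = π t

lemma isPattern_firstVisit (ω : ℕ → V) : IsPattern (firstVisit ω) where
  le := firstVisit_le ω
  idem t := firstVisit_eq_iff.2 (apply_firstVisit ω t)

/-- The parent of the vertex discovered at time `x`. For `s = 0`, `r = 1` it is the vertex from which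
`x` was discovered, and the edges `{x, parent x}` form the first-visit tree. In general the
first `r` vertices are assumed distinct, with the walk returning at time `r` to the vertex `s`;
then the cycle `s, s + 1, …, r - 1` is oriented cyclically and everything else points towards it. -/
def parent (r s : ℕ) (π : ℕ → ℕ) (x : ℕ) : ℕ :=
  if x < s then x + 1 else if x = s then r - 1 else π (x - 1)

/-- The step from time `t` to time `t + 1` discovers a vertex. -/
def IsNew (π : ℕ → ℕ) (t : ℕ) : Prop := π (t + 1) = t + 1

/-- The step from time `t` to time `t + 1` goes from a vertex to its parent. -/
def IsUp (r s : ℕ) (π : ℕ → ℕ) (t : ℕ) : Prop :=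
  ¬ IsNew π t ∧ π (t + 1) = parent r s π (π t)

/-- The step from time `t < N` to time `t + 1` goes from a vertex to a known child of it. -/
def IsDown (N r s : ℕ) (π : ℕ → ℕ) (t : ℕ) : Prop :=
  t < N ∧ ¬ IsNew π t ∧ ¬ IsUp r s π t ∧ π t = parent r s π (π (t + 1))

/-- The step from time `t` to time `t + 1` joins two known vertices, neither of which is the parent
of the other. -/
def IsExcess (r s : ℕ) (π : ℕ → ℕ) (t : ℕ) : Prop :=
  ¬ IsNew π t ∧ ¬ IsUp r s π t ∧ π t ≠ parent r s π (π (t + 1))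

lemma exists_not_isDown (N r s : ℕ) (π : ℕ → ℕ) (t : ℕ) :
    ∃ q, t < q ∧ ¬ IsDown N r s π q :=
  ⟨max (t + 1) N, by omega, fun h => by have := h.1; omega⟩

open Classical in
/-- The time at which a run of downward steps that is under way at time `t` comes to its end. -/
noncomputable def downEnd (N r s : ℕ) (π : ℕ → ℕ) (t : ℕ) : ℕ :=
  Nat.find (exists_not_isDown N r s π t)

lemma lt_downEnd (N r s : ℕ) (π : ℕ → ℕ) (t : ℕ) : t < downEnd N r s π t := by
  classical exact (Nat.find_spec (exists_not_isDown N r s π t)).1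

lemma isDown_of_lt_downEnd {N r s : ℕ} {π : ℕ → ℕ} {t q : ℕ} (h : t < q)
    (hq : q < downEnd N r s π t) : IsDown N r s π q := by
  classical
  by_contra hn
  exact Nat.find_min (exists_not_isDown N r s π t) hq ⟨h, hn⟩

lemma downEnd_le {N r s : ℕ} {π : ℕ → ℕ} {t : ℕ} (h : t < N) : downEnd N r s π t ≤ N := by
  classical exact Nat.find_min' _ ⟨h, fun h' => lt_irrefl _ h'.1⟩

lemma downEnd_succ {N r s : ℕ} {π : ℕ → ℕ} {t : ℕ} (h : IsDown N r s π (t + 1)) :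
    downEnd N r s π (t + 1) = downEnd N r s π t := by
  classical
  apply le_antisymm
  · refine Nat.find_min' _ ⟨?_, ?_⟩
    · have h1 := lt_downEnd N r s π t
      rcases Nat.lt_or_ge (t + 1) (downEnd N r s π t) with h2 | h2
      · exact h2
      · have h3 : downEnd N r s π t = t + 1 := by omega
        exact absurd h (h3 ▸ (Nat.find_spec (exists_not_isDown N r s π t)).2)
    · exact (Nat.find_spec (exists_not_isDown N r s π t)).2
  · refine Nat.find_min' _ ⟨?_, ?_⟩
    · have := lt_downEnd N r s π (t + 1); omega
    · exact (Nat.find_spec (exists_not_isDown N r s π (t + 1))).2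

open Classical in
/-- What has to be known in order to make the step from time `t` to time `t + 1`. It does not
change along a run of steps of the same kind, unless they are excess steps. -/
noncomputable def stepInfo (N r s : ℕ) (π : ℕ → ℕ) (t : ℕ) : ℕ × ℕ × ℕ :=
  if IsNew π t then (0, 0, 0)
  else if IsUp r s π t then (1, 0, 0)
  else if IsDown N r s π t then (2, π (downEnd N r s π t), downEnd N r s π t)
  else (3, π (t + 1), 0)

lemma parent_le {r s : ℕ} {π : ℕ → ℕ} (hπ : IsPattern π) (hsr : s < r) {t x : ℕ} (ht : r ≤ t + 1)
    (hx : x ≤ t) : parent r s π x ≤ t := by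
  unfold parent
  split_ifs
  · omega
  · omega
  · exact (hπ.le _).trans (by omega)

lemma parent_congr {r s : ℕ} {π π' : ℕ → ℕ} {t x : ℕ} (h : ∀ y ≤ t, π y = π' y) (hx : x ≤ t + 1) :
    parent r s π x = parent r s π' x := by
  unfold parent
  rw [h (x - 1) (by omega)]

lemma parent_iterate_congr {r s : ℕ} {π π' : ℕ → ℕ} (hπ : IsPattern π)
    (hsr : s < r) {t x : ℕ} (ht : r ≤ t + 1) (h : ∀ y ≤ t, π y = π' y) (hx : x ≤ t) (j : ℕ) :
    (parent r s π)^[j] x = (parent r s π')^[j] x ∧ (parent r s π)^[j] x ≤ t := by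
  induction j with
  | zero => exact ⟨rfl, hx⟩
  | succ j ih =>
    rw [Function.iterate_succ_apply', Function.iterate_succ_apply', ← ih.1]
    exact ⟨parent_congr h (by omega), parent_le hπ hsr ht ih.2⟩

/-- A run of downward steps is determined by its end: its vertices are the ancestors of the last. -/
lemma eq_iterate_of_isDown {N r s : ℕ} {π : ℕ → ℕ} {t q : ℕ} (htq : t ≤ q)
    (h : ∀ a, t ≤ a → a < q → IsDown N r s π a) : π t = (parent r s π)^[q - t] (π q) := by
  induction htq using Nat.decreasingInduction with
  | self => simp
  | of_succ k hk ih =>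
    rw [(h k le_rfl hk).2.2.2, ih (fun a ha => h a (by omega)),
      ← Function.iterate_succ_apply' (parent r s π)]
    congr 2
    omega

lemma le_of_forall_not_isNew {π : ℕ → ℕ} (hπ : IsPattern π) {t q : ℕ}
    (h : ∀ a, t ≤ a → a < q → ¬ IsNew π a) : π q ≤ t := by
  by_contra hlt
  push Not at hlt
  have h1 := hπ.le q
  apply h (π q - 1) (by omega) (by omega)
  unfold IsNew
  rw [Nat.sub_add_cancel (by omega), hπ.idem]

lemma isDown_run {N r s : ℕ} {π : ℕ → ℕ} {t : ℕ} (h : IsDown N r s π t) (a : ℕ) (h1 : t ≤ a)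
    (h2 : a < downEnd N r s π t) : IsDown N r s π a := by
  rcases h1.eq_or_lt with rfl | h3
  · exact h
  · exact isDown_of_lt_downEnd h3 h2

/-- A pattern is determined by its step data: at each time the next vertex can be computed from
the earlier ones. -/
theorem eq_of_stepInfo_eq {N r s : ℕ} {π π' : ℕ → ℕ} (hπ : IsPattern π) (hπ' : IsPattern π')
    (hsr : s < r) (h0 : ∀ t < r, π t = t) (h0' : ∀ t < r, π' t = t)
    (h : ∀ t < N, stepInfo N r s π t = stepInfo N r s π' t) : ∀ t ≤ N, π t = π' t := by
  suffices H : ∀ t ≤ N, ∀ y ≤ t, π y = π' y from fun t ht => H t ht t le_rfl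
  intro t
  induction t with
  | zero =>
    intro _ y hy
    rw [h0 y (by omega), h0' y (by omega)]
  | succ t ih =>
    intro ht y hy
    have ih' := ih (by omega)
    rcases Nat.lt_or_ge y (t + 1) with h1 | h1
    · exact ih' y (by omega)
    obtain rfl : y = t + 1 := by omega
    rcases Nat.lt_or_ge (t + 1) r with h2 | h2
    · rw [h0 _ h2, h0' _ h2]
    have ht' := h t (by omega)
    unfold stepInfo at ht'
    split_ifs at ht' with a1 a2 a3 a4 a5 a6 a7 a8 a9 a10 a11 a12 a13 a14 <;>
      simp only [Prod.mk.injEq, OfNat.ofNat_ne_zero, OfNat.zero_ne_ofNat, OfNat.one_ne_ofNat,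
        OfNat.ofNat_ne_one, zero_ne_one, one_ne_zero, false_and, true_and, and_true,
        Nat.reduceEqDiff] at ht'
    · rw [a1, a2]
    · rw [a5.2, a7.2, ih' t le_rfl]
      exact parent_congr ih' ((hπ'.le t).trans (by omega))
    · -- a downward run ends at a vertex discovered before it, whose ancestors are known
      obtain ⟨e1, e2⟩ := ht'
      have c1 := lt_downEnd N r s π t
      have c2 := lt_downEnd N r s π' t
      have i1 := eq_iterate_of_isDown (q := downEnd N r s π t) (N := N) (t := t + 1) c1
        (fun a ha hb => isDown_run a9 a (by omega) hb)
      have i2 := eq_iterate_of_isDown (q := downEnd N r s π' t) (N := N) (t := t + 1) c2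
        (fun a ha hb => isDown_run a12 a (by omega) hb)
      rw [i1, i2, ← e2, e2, ← e1, ← e2]
      refine (parent_iterate_congr hπ hsr h2 ih' ?_ _).1
      exact le_of_forall_not_isNew hπ (fun a ha hb => (isDown_run a9 a ha hb).2.1)
    · exact ht'

/-- Position of a kind of step in the order upward, downward, new in which the kinds occur between
two excess steps of a non-backtracking walk. -/
def stepRank : ℕ × ℕ × ℕ → ℕ
  | (0, _) => 2
  | (2, _) => 1
  | _ => 0

lemma stepRank_le (a : ℕ × ℕ × ℕ) : stepRank a ≤ 2 := by
  unfold stepRank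
  split <;> omega

/-- Without backtracking a downward step is not followed by an upward one and a new step is
followed by a new step only. -/
lemma stepRank_lt_of_ne {N r s : ℕ} {π : ℕ → ℕ} (hπ : IsPattern π) (hsr : s < r) {t : ℕ}
    (htr : r ≤ t + 1) (htN : t + 1 < N) (h1 : ¬ IsExcess r s π t) (h2 : ¬ IsExcess r s π (t + 1))
    (h3 : π (t + 2) ≠ π t) (hne : stepInfo N r s π (t + 1) ≠ stepInfo N r s π t) :
    stepRank (stepInfo N r s π t) < stepRank (stepInfo N r s π (t + 1)) := by
  by_cases n1 : IsNew π t
  · -- after a discovery, an upward step would backtrack, and the new vertex has no child yet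
    exfalso
    have hn : π (t + 1) = t + 1 := n1
    have hpar : parent r s π (t + 1) = π t := by
      unfold parent
      rw [if_neg (by omega), if_neg (by omega), Nat.add_sub_cancel]
    by_cases n2 : IsNew π (t + 1)
    · apply hne
      simp [stepInfo, n1, n2]
    by_cases u2 : IsUp r s π (t + 1)
    · apply h3
      have := u2.2
      rwa [hn, hpar] at this
    apply h2
    refine ⟨n2, u2, ?_⟩
    rw [hn]
    intro hx
    have hx2 : π (t + 2) ≤ t + 1 := by
      have := hπ.le (t + 2)
      rcases this.eq_or_lt with h | h
      · exact absurd h n2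
      · omega
    unfold parent at hx
    simp only [show t + 1 + 1 = t + 2 from rfl] at hx
    split_ifs at hx with g1 g2
    · omega
    · omega
    · have := hπ.le (π (t + 2) - 1); omega
  by_cases u1 : IsUp r s π t
  · by_cases n2 : IsNew π (t + 1)
    · simp [stepInfo, n1, n2, u1, stepRank]
    by_cases u2 : IsUp r s π (t + 1)
    · exact absurd (by simp [stepInfo, n1, n2, u1, u2]) hne
    by_cases d2 : IsDown N r s π (t + 1)
    · simp [stepInfo, n1, n2, u1, u2, d2, stepRank]
    · exact absurd ⟨n2, u2, fun h => d2 ⟨htN, n2, u2, h⟩⟩ h2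
  have d1 : IsDown N r s π t := by
    refine ⟨by omega, n1, u1, ?_⟩
    by_contra hn
    exact h1 ⟨n1, u1, hn⟩
  by_cases n2 : IsNew π (t + 1)
  · simp [stepInfo, n1, n2, u1, d1, stepRank]
  by_cases u2 : IsUp r s π (t + 1)
  · exact absurd (u2.2.trans d1.2.2.2.symm) h3
  by_cases d2 : IsDown N r s π (t + 1)
  · exact absurd (by simp [stepInfo, n1, n2, u1, u2, d1, d2, downEnd_succ d2]) hne
  · exact absurd ⟨n2, u2, fun h => d2 ⟨htN, n2, u2, h⟩⟩ h2

/-- The step data change at most twice between two bad times. -/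
theorem card_changes_le {N r s : ℕ} {π : ℕ → ℕ} (hπ : IsPattern π) (hsr : s < r)
    (h0 : ∀ t < r, π t = t) (bad : Finset ℕ)
    (hbad : ∀ t, t + 1 < N → t + 1 ∉ bad → t + 2 < r ∨
      (r ≤ t + 1 ∧ ¬ IsExcess r s π t ∧ ¬ IsExcess r s π (t + 1) ∧ π (t + 2) ≠ π t)) :
    ((Finset.range (N - 1)).filter
      (fun t => stepInfo N r s π (t + 1) ≠ stepInfo N r s π t)).card ≤ 2 + 3 * bad.card := by
  classical
  have key : ∀ T, T ≤ N - 1 →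
      ((Finset.range T).filter
        (fun t => stepInfo N r s π (t + 1) ≠ stepInfo N r s π t)).card
      ≤ stepRank (stepInfo N r s π T) + 3 * (bad.filter (fun t => t ≤ T)).card := by
    intro T
    induction T with
    | zero => simp
    | succ T ih =>
      intro hT
      have ih' := ih (by omega)
      rw [Finset.range_add_one, Finset.filter_insert]
      by_cases hb : T + 1 ∈ bad
      · -- at a bad time the rank may drop, from at most two, which the weight three pays for
        have h1 : (bad.filter (fun t => t ≤ T)).card + 1 ≤
            (bad.filter (fun t => t ≤ T + 1)).card := by
          rw [← Finset.card_insert_of_notMem (a := T + 1) (by simp)]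
          apply Finset.card_le_card
          intro x hx
          simp only [Finset.mem_insert, Finset.mem_filter] at hx ⊢
          rcases hx with rfl | hx
          · exact ⟨hb, le_rfl⟩
          · exact ⟨hx.1, by omega⟩
        have h2 := stepRank_le (stepInfo N r s π T)
        split_ifs
        · refine (Finset.card_insert_le _ _).trans ?_
          omega
        · omega
      · have h1 : (bad.filter (fun t => t ≤ T)).card ≤ (bad.filter (fun t => t ≤ T + 1)).card := by
          apply Finset.card_le_card
          intro x hx
          simp only [Finset.mem_filter] at hx ⊢
          exact ⟨hx.1, by omega⟩
        by_cases hne : stepInfo N r s π (T + 1) = stepInfo N r s π T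
        · rw [if_neg (by simpa using hne), hne]
          omega
        · rw [if_pos hne]
          refine (Finset.card_insert_le _ _).trans ?_
          rcases hbad T (by omega) hb with h2 | ⟨h2, h3, h4, h5⟩
          · exfalso
            apply hne
            have n1 : IsNew π T := h0 _ (by omega)
            have n2 : IsNew π (T + 1) := h0 _ (by omega)
            simp [stepInfo, n1, n2]
          · have := stepRank_lt_of_ne hπ hsr h2 (by omega) h3 h4 h5 hne
            omega
  have h1 := key (N - 1) le_rfl
  have h2 := stepRank_le (stepInfo N r s π (N - 1))
  have h3 := Finset.card_filter_le bad (fun t => t ≤ N - 1)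
  omega

end Pattern

/-! ### Counting words by their patterns -/

section Counting

lemma card_powerset_filter_card_le {α : Type*} [DecidableEq α] (U : Finset α) (b : ℕ) :
    (U.powerset.filter (fun S => S.card ≤ b)).card ≤ (U.card + 1) ^ b := by
  have h1 : U.powerset.filter (fun S => S.card ≤ b) ⊆
      (Finset.range (b + 1)).biUnion (fun i => U.powersetCard i) := by
    intro S hS
    simp only [Finset.mem_filter, Finset.mem_powerset] at hS
    simp only [Finset.mem_biUnion, Finset.mem_range, Finset.mem_powersetCard]
    exact ⟨S.card, by omega, hS.1, rfl⟩
  refine (Finset.card_le_card h1).trans (Finset.card_biUnion_le.trans ?_)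
  rw [add_pow]
  apply Finset.sum_le_sum
  intro i hi
  rw [Finset.card_powersetCard, one_pow, mul_one]
  calc U.card.choose i ≤ U.card ^ i := Nat.choose_le_pow _ _
    _ ≤ U.card ^ i * (b.choose i) :=
      Nat.le_mul_of_pos_right _ (Nat.choose_pos (by simp at hi; omega))

/-- The times at which `f` changes, together with its new values. -/
def jumpSet {α : Type*} [DecidableEq α] (N : ℕ) (f : ℕ → α) : Finset (ℕ × α) :=
  ((Finset.range N).filter (fun t => t = 0 ∨ f t ≠ f (t - 1))).image (fun t => (t, f t))

lemma eq_of_jumpSet_eq {α : Type*} [DecidableEq α] {N : ℕ} {f g : ℕ → α}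
    (h : jumpSet N f = jumpSet N g) : ∀ t < N, f t = g t := by
  have key : ∀ t < N, ((t = 0 ∨ f t ≠ f (t - 1)) → g t = f t) ∧
      ((t = 0 ∨ g t ≠ g (t - 1)) → g t = f t) := by
    intro t ht
    constructor
    · intro hf
      have : (t, f t) ∈ jumpSet N g := by
        rw [← h]
        exact Finset.mem_image.2 ⟨t, by simp [ht, hf], rfl⟩
      simp only [jumpSet, Finset.mem_image, Finset.mem_filter, Prod.mk.injEq] at this
      obtain ⟨x, -, rfl, hx⟩ := this
      exact hx
    · intro hf
      have : (t, g t) ∈ jumpSet N f := by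
        rw [h]
        exact Finset.mem_image.2 ⟨t, by simp [ht, hf], rfl⟩
      simp only [jumpSet, Finset.mem_image, Finset.mem_filter, Prod.mk.injEq] at this
      obtain ⟨x, -, rfl, hx⟩ := this
      exact hx.symm
  intro t
  induction t with
  | zero => intro ht; exact ((key 0 ht).1 (Or.inl rfl)).symm
  | succ t ih =>
    intro ht
    have ih' := ih (by omega)
    have k := key (t + 1) ht
    simp only [Nat.add_sub_cancel] at k
    by_cases h1 : f (t + 1) = f t
    · by_cases h2 : g (t + 1) = g t
      · rw [h1, h2, ih']
      · exact (k.2 (Or.inr h2)).symm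
    · exact (k.1 (Or.inr h1)).symm

lemma card_jumpSet_le {α : Type*} [DecidableEq α] (N : ℕ) (f : ℕ → α) :
    (jumpSet N f).card ≤
      1 + ((Finset.range (N - 1)).filter (fun t => f (t + 1) ≠ f t)).card := by
  refine Finset.card_image_le.trans ?_
  have : (Finset.range N).filter (fun t => t = 0 ∨ f t ≠ f (t - 1)) ⊆
      insert 0 (((Finset.range (N - 1)).filter (fun t => f (t + 1) ≠ f t)).image Nat.succ) := by
    intro t ht
    simp only [Finset.mem_filter, Finset.mem_range] at ht
    simp only [Finset.mem_insert, Finset.mem_image, Finset.mem_filter, Finset.mem_range]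
    rcases t with _ | t
    · exact Or.inl rfl
    · right
      refine ⟨t, ⟨by omega, ?_⟩, rfl⟩
      simpa using ht.2
  refine (Finset.card_le_card this).trans ((Finset.card_insert_le _ _).trans ?_)
  have := Finset.card_image_le (s := (Finset.range (N - 1)).filter (fun t => f (t + 1) ≠ f t))
    (f := Nat.succ)
  omega

/-- A word of `N` steps, continued as a constant. -/
def extend {V : Type*} {N : ℕ} (ω : Fin (N + 1) → V) (t : ℕ) : V :=
  ω ⟨min t N, by omega⟩

lemma extend_of_le {V : Type*} {N : ℕ} (ω : Fin (N + 1) → V) {t : ℕ} (h : t ≤ N) :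
    extend ω t = ω ⟨t, by omega⟩ := by
  simp [extend, h]

/-- The number of distinct vertices of a word. -/
def vertexCount {V : Type*} [DecidableEq V] {N : ℕ} (ω : Fin (N + 1) → V) : ℕ :=
  (Finset.univ.image ω).card

lemma vertexCount_eq_card {V : Type*} [DecidableEq V] {N : ℕ} (ω : Fin (N + 1) → V) :
    vertexCount ω = Fintype.card {t : Fin (N + 1) // firstVisit (extend ω) t = t} := by
  classical
  rw [Fintype.card_subtype, vertexCount]
  symm
  have hext : ∀ t : Fin (N + 1), extend ω t = ω t := fun t =>
    extend_of_le ω (by have := t.2; omega)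
  apply Finset.card_bij (fun t _ => ω t)
  · intro t _
    exact Finset.mem_image_of_mem _ (Finset.mem_univ _)
  · intro a ha b hb hab
    simp only [Finset.mem_filter, Finset.mem_univ, true_and] at ha hb
    rw [← hext a, ← hext b, ← firstVisit_eq_iff, ha, hb] at hab
    exact Fin.ext hab
  · intro v hv
    obtain ⟨t, -, rfl⟩ := Finset.mem_image.1 hv
    have h1 := firstVisit_le (extend ω) t
    have h2 := t.2
    refine ⟨⟨firstVisit (extend ω) t, by omega⟩, ?_, ?_⟩
    · simp only [Finset.mem_filter, Finset.mem_univ, true_and]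
      exact (isPattern_firstVisit _).idem t
    · rw [← hext, ← hext]
      exact apply_firstVisit _ _

lemma vertexCount_pos {V : Type*} [DecidableEq V] {N : ℕ} (ω : Fin (N + 1) → V) :
    0 < vertexCount ω :=
  Finset.card_pos.2 ⟨ω 0, Finset.mem_image_of_mem _ (Finset.mem_univ _)⟩

/-- There are at most `n ^ v` words with a given pattern on `v` vertices, so the sum of the
weights `n ^ (-v)` over a class of words is at most the number of its patterns. -/
theorem sum_inv_pow_vertexCount_le {V C : Type*} [Fintype V] [DecidableEq V] [DecidableEq C]
    {N : ℕ} (W : Finset (Fin (N + 1) → V)) (code : (Fin (N + 1) → V) → C) (S : Finset C)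
    (hS : ∀ ω ∈ W, code ω ∈ S)
    (hcode : ∀ ω ∈ W, ∀ ω' ∈ W, code ω = code ω' →
      ∀ t ≤ N, firstVisit (extend ω) t = firstVisit (extend ω') t) (hV : 0 < Fintype.card V) :
    ∑ ω ∈ W, ((Fintype.card V : ℝ) ^ vertexCount ω)⁻¹ ≤ S.card := by
  classical
  rw [← Finset.sum_fiberwise_of_maps_to hS]
  have hn : (0 : ℝ) < Fintype.card V := by exact_mod_cast hV
  calc _ ≤ ∑ c ∈ S, (1 : ℝ) := ?_
    _ = S.card := by simp
  apply Finset.sum_le_sum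
  intro c _
  rcases (W.filter (fun ω => code ω = c)).eq_empty_or_nonempty with h | ⟨ω₀, h₀⟩
  · rw [h]; simp
  rw [Finset.mem_filter] at h₀
  have hpat : ∀ ω ∈ W.filter (fun ω => code ω = c), ∀ t : Fin (N + 1),
      firstVisit (extend ω) t = firstVisit (extend ω₀) t := by
    intro ω hω t
    rw [Finset.mem_filter] at hω
    exact hcode ω hω.1 ω₀ h₀.1 (hω.2.trans h₀.2.symm) t (by have := t.2; omega)
  have hv : ∀ ω ∈ W.filter (fun ω => code ω = c), vertexCount ω = vertexCount ω₀ := by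
    intro ω hω
    rw [vertexCount_eq_card, vertexCount_eq_card]
    apply Fintype.card_congr
    exact Equiv.subtypeEquivRight (fun t => by rw [hpat ω hω t])
  rw [Finset.sum_congr rfl (fun ω hω => by rw [hv ω hω]), Finset.sum_const, nsmul_eq_mul,
    ← div_eq_mul_inv, div_le_one (by positivity)]
  have : (W.filter (fun ω => code ω = c)).card ≤
      Fintype.card ({t : Fin (N + 1) // firstVisit (extend ω₀) t = t} → V) := by
    rw [← Finset.card_univ]
    apply Finset.card_le_card_of_injOn (fun ω t => ω t.1) (fun _ _ => Finset.mem_univ _)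
    intro a ha b hb hab
    have ha' := hpat a ha
    have hb' := hpat b hb
    funext t
    have hlt : firstVisit (extend ω₀) t < N + 1 :=
      (firstVisit_le _ _).trans_lt t.2
    have e1 : ∀ ω : Fin (N + 1) → V, (∀ t : Fin (N + 1), firstVisit (extend ω) t =
        firstVisit (extend ω₀) t) → ω t = ω ⟨firstVisit (extend ω₀) t, hlt⟩ := by
      intro ω h
      rw [← extend_of_le ω (t := firstVisit (extend ω₀) t) (by omega), ← h t,
        apply_firstVisit (extend ω),
        extend_of_le ω (by have := t.2; omega)]
    rw [e1 a ha', e1 b hb']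
    exact congrFun hab ⟨⟨_, hlt⟩, (isPattern_firstVisit _).idem t⟩
  rw [Fintype.card_fun, ← vertexCount_eq_card] at this
  exact_mod_cast this

lemma stepInfo_mem {N r s : ℕ} {π : ℕ → ℕ} (hπ : IsPattern π) {t : ℕ} (ht : t < N) :
    stepInfo N r s π t ∈
      Finset.range 4 ×ˢ Finset.range (N + 1) ×ˢ Finset.range (N + 1) := by
  have h1 := downEnd_le (r := r) (s := s) (π := π) ht
  have h2 := hπ.le (downEnd N r s π t)
  have h3 := hπ.le (t + 1)
  unfold stepInfo
  split_ifs <;> simp <;> omega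

/-- The weight of a class of words whose step data change at most `B` times. -/
theorem sum_inv_pow_vertexCount_le_of_changes {V : Type*} [Fintype V] [DecidableEq V] {N B : ℕ}
    (W : Finset (Fin (N + 1) → V)) (hV : 0 < Fintype.card V)
    (hW : ∀ ω ∈ W, ∃ r ≤ N, ∃ s < r, (∀ t < r, firstVisit (extend ω) t = t) ∧
      ((Finset.range (N - 1)).filter (fun t => stepInfo N r s (firstVisit (extend ω)) (t + 1) ≠
        stepInfo N r s (firstVisit (extend ω)) t)).card ≤ B) :
    ∑ ω ∈ W, ((Fintype.card V : ℝ) ^ vertexCount ω)⁻¹ ≤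
      (((N + 1) ^ 2 * (4 * N * (N + 1) ^ 2 + 1) ^ (B + 1) : ℕ) : ℝ) := by
  classical
  choose! r hr s hs h0 hB using hW
  let U : Finset (ℕ × ℕ × ℕ × ℕ) := Finset.range N ×ˢ
    Finset.range 4 ×ˢ Finset.range (N + 1) ×ˢ Finset.range (N + 1)
  let S := (Finset.range (N + 1) ×ˢ Finset.range (N + 1)) ×ˢ
    U.powerset.filter (fun S => S.card ≤ B + 1)
  have h := sum_inv_pow_vertexCount_le W
    (fun ω => ((r ω, s ω), jumpSet N (stepInfo N (r ω) (s ω) (firstVisit (extend ω))))) S ?_ ?_ hV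
  · refine h.trans ?_
    have hU : U.card = 4 * N * (N + 1) ^ 2 := by
      simp only [U, Finset.card_product, Finset.card_range]
      ring
    have : S.card ≤ (N + 1) ^ 2 * (4 * N * (N + 1) ^ 2 + 1) ^ (B + 1) := by
      simp only [S, Finset.card_product, Finset.card_range]
      rw [← sq]
      gcongr
      rw [← hU]
      exact card_powerset_filter_card_le _ _
    exact_mod_cast this
  · intro ω hω
    have h1 := hr ω hω
    have h2 := hs ω hω
    simp only [S, Finset.mem_product, Finset.mem_range, Finset.mem_filter, Finset.mem_powerset]
    refine ⟨⟨by omega, by omega⟩, ?_, ?_⟩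
    · intro x hx
      obtain ⟨t, ht, rfl⟩ := Finset.mem_image.1 hx
      simp only [Finset.mem_filter, Finset.mem_range] at ht
      exact Finset.mem_product.2 ⟨Finset.mem_range.2 ht.1,
        stepInfo_mem (isPattern_firstVisit _) ht.1⟩
    · refine (card_jumpSet_le _ _).trans ?_
      have := hB ω hω
      omega
  · intro ω hω ω' hω' hc t ht
    simp only [Prod.mk.injEq] at hc
    obtain ⟨⟨e1, e2⟩, e3⟩ := hc
    rw [← e1, ← e2] at e3
    refine eq_of_stepInfo_eq (isPattern_firstVisit _) (isPattern_firstVisit _) (hs ω hω)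
      (h0 ω hω) ?_ (eq_of_jumpSet_eq e3) t ht
    rw [e1]
    exact h0 ω' hω'

/-- Every word belongs to one of at most `(N + 1) ^ (N + 1)` patterns. -/
theorem sum_inv_pow_vertexCount_le_crude {V : Type*} [Fintype V] [DecidableEq V] {N : ℕ}
    (W : Finset (Fin (N + 1) → V)) (hV : 0 < Fintype.card V) :
    ∑ ω ∈ W, ((Fintype.card V : ℝ) ^ vertexCount ω)⁻¹ ≤ (((N + 1) ^ (N + 1) : ℕ) : ℝ) := by
  classical
  have h := sum_inv_pow_vertexCount_le W
    (fun ω (t : Fin (N + 1)) => (⟨firstVisit (extend ω) t, (firstVisit_le _ _).trans_lt t.2⟩ :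
      Fin (N + 1)))
    (Finset.univ : Finset (Fin (N + 1) → Fin (N + 1))) (fun _ _ => Finset.mem_univ _) ?_ hV
  · simpa using h
  · intro ω _ ω' _ hc t ht
    have := congrFun hc ⟨t, by omega⟩
    simpa using this

end Counting

/-! ### Concatenations of self-avoiding walks -/

lemma firstVisit_ne_of_isNew {V : Type*} {w : ℕ → V} {a x : ℕ} (h : IsNew (firstVisit w) a)
    (hx : x ≤ a) : w (a + 1) ≠ w x := by
  intro hw
  have h1 : firstVisit w (a + 1) ≤ x := firstVisit_le_of_eq hw.symm
  rw [h] at h1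
  omega

section Blocks

variable {V : Type*} [DecidableEq V]

/-- The edges visited by the first `N` steps of a word. -/
def edgesOf (N : ℕ) (w : ℕ → V) : Finset (Sym2 V) :=
  (Finset.range N).image (fun t => s(w t, w (t + 1)))

/-- Each of the consecutive blocks of `k` steps of the word is self-avoiding. -/
def BlockSelfAvoiding (k N : ℕ) (w : ℕ → V) : Prop :=
  ∀ b a c, b * k ≤ a → a < c → c ≤ (b + 1) * k → c ≤ N → w a ≠ w c

open Classical in
/-- The times of the excess steps of a word, with respect to its first-visit tree. -/
noncomputable def excessSteps (N : ℕ) (w : ℕ → V) : Finset ℕ :=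
  (Finset.range N).filter (fun t => IsExcess 1 0 (firstVisit w) t)

lemma vertexCount_eq_add_one {N : ℕ} (ω : Fin (N + 1) → V)
    [DecidablePred (IsNew (firstVisit (extend ω)))] :
    vertexCount ω = 1 + ((Finset.range N).filter (IsNew (firstVisit (extend ω)))).card := by
  classical
  rw [vertexCount_eq_card, Fintype.card_subtype]
  have h0 : firstVisit (extend ω) 0 = 0 := Nat.le_zero.1 (firstVisit_le _ _)
  rw [show (Finset.univ.filter (fun t : Fin (N + 1) => firstVisit (extend ω) t = t)).card =
    ((Finset.range (N + 1)).filter (fun t => firstVisit (extend ω) t = t)).card from ?_]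
  · rw [add_comm 1, ← Finset.card_map (s := (Finset.range N).filter _)
      ⟨Nat.succ, Nat.succ_injective⟩, ← Finset.card_insert_of_notMem (a := 0) (by simp)]
    congr 1
    ext t
    rcases t with _ | t
    · simp [h0]
    · simp [IsNew]
  · rw [← Finset.card_map Fin.valEmbedding]
    congr 1
    ext t
    simp only [Finset.mem_map, Finset.mem_filter, Finset.mem_univ, true_and, Finset.mem_range,
      Fin.valEmbedding_apply]
    constructor
    · rintro ⟨a, ha, rfl⟩
      exact ⟨a.2, ha⟩
    · rintro ⟨h1, h2⟩
      exact ⟨⟨t, h1⟩, h2, rfl⟩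

/-- The edges of the first-visit tree are distinct and are not used by excess steps. -/
lemma card_excessEdges_add_vertexCount_le {N : ℕ} (ω : Fin (N + 1) → V) :
    ((excessSteps N (extend ω)).image
      (fun t => s(extend ω t, extend ω (t + 1)))).card + vertexCount ω ≤
      (edgesOf N (extend ω)).card + 1 := by
  classical
  set w := extend ω
  set e : ℕ → Sym2 V := fun t => s(w t, w (t + 1)) with he
  let T := (Finset.range N).filter (IsNew (firstVisit w))
  have hinj : Set.InjOn e T := by
    have key : ∀ t a, t < a → IsNew (firstVisit w) a → e t ≠ e a := by
      intro t a hta ha h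
      simp only [he, Sym2.eq_iff] at h
      rcases h with h | h
      · exact firstVisit_ne_of_isNew ha (by omega : t + 1 ≤ a) h.2.symm
      · exact firstVisit_ne_of_isNew ha (by omega : t ≤ a) h.1.symm
    intro t ht a ha h
    simp only [T, Finset.coe_filter, Set.mem_ofPred_eq] at ht ha
    rcases lt_trichotomy t a with h1 | h1 | h1
    · exact absurd h (key t a h1 ha.2)
    · exact h1
    · exact absurd h.symm (key a t h1 ht.2)
  have hdisj : Disjoint ((excessSteps N w).image e) (T.image e) := by
    rw [Finset.disjoint_left]
    intro x hx hx'
    obtain ⟨t, ht, rfl⟩ := Finset.mem_image.1 hx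
    obtain ⟨a, ha, hae⟩ := Finset.mem_image.1 hx'
    simp only [excessSteps, Finset.mem_filter] at ht
    simp only [T, Finset.mem_filter] at ha
    have hn : firstVisit w (a + 1) = a + 1 := ha.2
    have hpar : parent 1 0 (firstVisit w) (a + 1) = firstVisit w a := by
      simp [parent]
    simp only [he, Sym2.eq_iff] at hae
    rcases hae with ⟨h1, h2⟩ | ⟨h1, h2⟩
    · rw [← firstVisit_eq_iff] at h1 h2
      apply ht.2.2.2
      rw [← h2, hn, hpar, h1]
    · rw [← firstVisit_eq_iff] at h1 h2
      apply ht.2.2.1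
      refine ⟨ht.2.1, ?_⟩
      rw [← h2, hn, hpar, h1]
  have hsub : (excessSteps N w).image e ∪ T.image e ⊆ edgesOf N w := by
    apply Finset.union_subset <;> apply Finset.image_subset_image <;>
      exact Finset.filter_subset _ _
  have h1 := Finset.card_le_card hsub
  rw [Finset.card_union_of_disjoint hdisj, Finset.card_image_of_injOn hinj] at h1
  have h2 : vertexCount ω = 1 + T.card := vertexCount_eq_add_one ω
  omega

/-- A self-avoiding block uses every edge at most once. -/
lemma card_excessSteps_le {k M : ℕ} {w : ℕ → V} (hk : 0 < k)
    (hw : BlockSelfAvoiding k (M * k) w) :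
    (excessSteps (M * k) w).card ≤
      M * ((excessSteps (M * k) w).image (fun t => s(w t, w (t + 1)))).card := by
  classical
  rw [mul_comm M (Finset.card _)]
  nth_rewrite 3 [← Finset.card_range M]
  rw [← Finset.card_product]
  apply Finset.card_le_card_of_injOn (fun t => (s(w t, w (t + 1)), t / k))
  · intro t ht
    simp only [Finset.coe_product, Set.mem_prod, Finset.mem_coe, Finset.mem_range]
    refine ⟨Finset.mem_image_of_mem _ ht, ?_⟩
    simp only [excessSteps, Finset.coe_filter, Set.mem_ofPred_eq, Finset.mem_range] at ht
    exact (Nat.div_lt_iff_lt_mul hk).2 ht.1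
  · have key : ∀ t a, t < a → a < M * k → t / k = a / k →
        s(w t, w (t + 1)) ≠ s(w a, w (a + 1)) := by
      intro t a hta ha hdiv h
      have h1 : (t / k) * k ≤ t := Nat.div_mul_le_self _ _
      have h2 : a + 1 ≤ (t / k + 1) * k := by
        rw [hdiv]
        exact Nat.lt_mul_of_div_lt (Nat.lt_succ_self _) hk
      rw [Sym2.eq_iff] at h
      rcases h with h | h
      · exact hw (t / k) t a h1 hta (by omega) (by omega) h.1
      · exact hw (t / k) t (a + 1) h1 (by omega) (by omega) (by omega) h.1
    intro t ht a ha h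
    simp only [excessSteps, Finset.coe_filter, Set.mem_ofPred_eq, Finset.mem_range] at ht ha
    simp only [Prod.mk.injEq] at h
    rcases lt_trichotomy t a with h1 | h1 | h1
    · exact absurd h.1 (key t a h1 ha.1 h.2)
    · exact h1
    · exact absurd h.1.symm (key a t h1 ht.1 h.2.symm)

/-- Base of the bound on the number of patterns of words of `N` steps. -/
def patternBase (N : ℕ) : ℕ := (N + 1) ^ 2 * (4 * N * (N + 1) ^ 2 + 1)

/-- The weight of the words of `M` self-avoiding blocks with `g` independent cycles. -/
lemma sum_inv_pow_vertexCount_le_of_blocks [Fintype V] {k M g : ℕ} (hk : 0 < k) (hM : 0 < M)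
    (hV : 0 < Fintype.card V) (W : Finset (Fin (M * k + 1) → V))
    (hsaw : ∀ ω ∈ W, BlockSelfAvoiding k (M * k) (extend ω))
    (hg : ∀ ω ∈ W, (edgesOf (M * k) (extend ω)).card + 1 = vertexCount ω + g) :
    ∑ ω ∈ W, ((Fintype.card V : ℝ) ^ vertexCount ω)⁻¹ ≤
      ((patternBase (M * k) ^ (6 * M)) ^ (g + 1) : ℕ) := by
  classical
  have hN : 1 ≤ M * k := Nat.mul_pos hM hk
  refine (sum_inv_pow_vertexCount_le_of_changes (B := 2 + 3 * (M + 2 * (M * g))) W hV ?_).trans ?_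
  · intro ω hω
    set w := extend ω
    have hE : (excessSteps (M * k) w).card ≤ M * g := by
      refine (card_excessSteps_le hk (hsaw ω hω)).trans ?_
      have h1 := card_excessEdges_add_vertexCount_le ω
      have h2 := hg ω hω
      apply Nat.mul_le_mul_left
      have h3 : ((excessSteps (M * k) w).image (fun t => s(w t, w (t + 1)))).card +
        vertexCount ω ≤ (edgesOf (M * k) w).card + 1 := h1
      have h4 : (edgesOf (M * k) w).card + 1 = vertexCount ω + g := h2
      omega
    have h0 : ∀ t < 1, firstVisit w t = t := by
      intro t ht
      obtain rfl : t = 0 := by omega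
      exact Nat.le_zero.1 (firstVisit_le _ _)
    refine ⟨1, hN, 0, one_pos, h0, ?_⟩
    let bad := (Finset.range M).image (fun b => b * k) ∪
      (excessSteps (M * k) w ∪ (excessSteps (M * k) w).image Nat.succ)
    have hbad : bad.card ≤ M + 2 * (M * g) := by
      refine (Finset.card_union_le _ _).trans ?_
      have h1 := Finset.card_image_le (s := Finset.range M) (f := fun b => b * k)
      rw [Finset.card_range] at h1
      have h2 := Finset.card_union_le (excessSteps (M * k) w)
        ((excessSteps (M * k) w).image Nat.succ)
      have h3 := Finset.card_image_le (s := excessSteps (M * k) w) (f := Nat.succ)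
      omega
    refine (card_changes_le (isPattern_firstVisit w) one_pos h0 bad ?_).trans (by omega)
    intro t ht hb
    right
    simp only [bad, Finset.mem_union, Finset.mem_image, Finset.mem_range, not_or, excessSteps,
      Finset.mem_filter] at hb
    obtain ⟨h1, h2, h3⟩ := hb
    refine ⟨by omega, ?_, ?_, ?_⟩
    · intro h
      exact h3 ⟨t, ⟨by omega, h⟩, rfl⟩
    · intro h
      exact h2 ⟨by omega, h⟩
    · rw [Ne, firstVisit_eq_iff]
      have h4 : (t + 1) / k < M := (Nat.div_lt_iff_lt_mul hk).2 ht
      have h5 : (t + 1) / k * k ≤ t + 1 := Nat.div_mul_le_self _ _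
      have h6 : t + 1 < ((t + 1) / k + 1) * k := Nat.lt_mul_of_div_lt (Nat.lt_succ_self _) hk
      have h7 : (t + 1) / k * k ≠ t + 1 := fun h => h1 ⟨_, h4, h⟩
      exact fun h => hsaw ω hω ((t + 1) / k) t (t + 2) (by omega) (by omega) (by omega)
        (by omega) h.symm
  · have h1 : 1 ≤ M * k + 1 := by omega
    have : (M * k + 1) ^ 2 * (4 * (M * k) * (M * k + 1) ^ 2 + 1) ^
        (2 + 3 * (M + 2 * (M * g)) + 1) ≤ (patternBase (M * k) ^ (6 * M)) ^ (g + 1) := by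
      rw [← pow_mul, patternBase]
      set a := (M * k + 1) ^ 2
      set b := 4 * (M * k) * a + 1
      have ha : 1 ≤ a := Nat.one_le_pow _ _ (by omega)
      have hb : 1 ≤ b := by omega
      calc a * b ^ (2 + 3 * (M + 2 * (M * g)) + 1)
          ≤ a ^ (6 * M * (g + 1)) * b ^ (6 * M * (g + 1)) := by
            gcongr
            · exact Nat.le_self_pow (by positivity) _
            · nlinarith
        _ = _ := (mul_pow _ _ _).symm
    exact_mod_cast this

/-- If every edge is covered at least twice, then there are at most half as many edges as steps. -/
lemma card_edgesOf_le {N h : ℕ} (hN : N = 2 * h) {w : ℕ → V}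
    (h2 : ∀ e ∈ edgesOf N w, 2 ≤ ((Finset.range N).filter (fun t => s(w t, w (t + 1)) = e)).card) :
    (edgesOf N w).card ≤ h := by
  have h1 : (edgesOf N w).card * 2 ≤ (Finset.range N).card := by
    rw [Finset.card_eq_sum_card_fiberwise (f := fun t => s(w t, w (t + 1))) (t := edgesOf N w)
      (fun t ht => Finset.mem_image_of_mem _ ht), ← smul_eq_mul]
    exact Finset.card_nsmul_le_sum _ _ _ h2
  rw [Finset.card_range] at h1
  omega

/-- Words of self-avoiding blocks which cover every edge at least twice, weighted by the probability
that their edges are present. -/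
theorem sum_pow_card_edges_le_of_blocks [Fintype V] {k M h : ℕ} (hk : 0 < k) (hM : 0 < M)
    (hN : M * k = 2 * h) {d : ℝ} (hd : 1 ≤ d)
    (hQ : 2 * patternBase (M * k) ^ (6 * M) ≤ Fintype.card V)
    (W : Finset (Fin (M * k + 1) → V))
    (hsaw : ∀ ω ∈ W, BlockSelfAvoiding k (M * k) (extend ω))
    (h2 : ∀ ω ∈ W, ∀ e ∈ edgesOf (M * k) (extend ω), 2 ≤ ((Finset.range (M * k)).filter
      (fun t => s(extend ω t, extend ω (t + 1)) = e)).card) :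
    ∑ ω ∈ W, (d / Fintype.card V) ^ (edgesOf (M * k) (extend ω)).card ≤
      2 * Fintype.card V * (patternBase (M * k) ^ (6 * M) : ℕ) * d ^ h := by
  classical
  set Q := patternBase (M * k) ^ (6 * M)
  have hQ0 : 0 < Q := pow_pos (by unfold patternBase; positivity) _
  have hV : 0 < Fintype.card V := by omega
  have hn : (0 : ℝ) < Fintype.card V := by exact_mod_cast hV
  set n : ℝ := (Fintype.card V : ℝ) with hndef
  let g : (Fin (M * k + 1) → V) → ℕ := fun ω =>
    (edgesOf (M * k) (extend ω)).card + 1 - vertexCount ω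
  have hg : ∀ ω, (edgesOf (M * k) (extend ω)).card + 1 = vertexCount ω + g ω := by
    intro ω
    have := card_excessEdges_add_vertexCount_le ω
    simp only [g]
    omega
  have hE : ∀ ω ∈ W, (edgesOf (M * k) (extend ω)).card ≤ h := fun ω hω =>
    card_edgesOf_le hN (h2 ω hω)
  have hgle : ∀ ω ∈ W, g ω ∈ Finset.range (h + 1) := by
    intro ω hω
    have h3 := hE ω hω
    have h4 := vertexCount_pos ω
    have h5 := hg ω
    simp only [Finset.mem_range]
    omega
  rw [← Finset.sum_fiberwise_of_maps_to hgle]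
  have hterm : ∀ j ∈ Finset.range (h + 1), ∑ ω ∈ W.filter (fun ω => g ω = j),
      (d / n) ^ (edgesOf (M * k) (extend ω)).card ≤ n * Q * d ^ h * ((1 : ℝ) / 2) ^ j := by
    intro j _
    calc _ ≤ ∑ ω ∈ W.filter (fun ω => g ω = j),
          d ^ h * n * (n ^ j)⁻¹ * (n ^ vertexCount ω)⁻¹ := by
          apply Finset.sum_le_sum
          intro ω hω
          rw [Finset.mem_filter] at hω
          have h3 := hg ω
          rw [hω.2] at h3
          have h4 : n ^ (edgesOf (M * k) (extend ω)).card * n = n ^ vertexCount ω * n ^ j := by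
            rw [← pow_succ, h3, pow_add]
          have h5 : (n ^ (edgesOf (M * k) (extend ω)).card)⁻¹ =
              n * (n ^ j)⁻¹ * (n ^ vertexCount ω)⁻¹ := by
            field_simp
            linarith
          rw [div_pow, div_eq_mul_inv, h5]
          have h6 : d ^ (edgesOf (M * k) (extend ω)).card ≤ d ^ h :=
            pow_le_pow_right₀ hd (hE ω hω.1)
          calc _ ≤ d ^ h * (n * (n ^ j)⁻¹ * (n ^ vertexCount ω)⁻¹) := by gcongr
            _ = _ := by ring
      _ = d ^ h * n * (n ^ j)⁻¹ * ∑ ω ∈ W.filter (fun ω => g ω = j),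
          (n ^ vertexCount ω)⁻¹ := by rw [Finset.mul_sum]
      _ ≤ d ^ h * n * (n ^ j)⁻¹ * ((Q ^ (j + 1) : ℕ) : ℝ) := by
          gcongr
          apply sum_inv_pow_vertexCount_le_of_blocks hk hM hV
          · intro ω hω
            exact hsaw ω (Finset.mem_filter.1 hω).1
          · intro ω hω
            rw [hg ω, (Finset.mem_filter.1 hω).2]
      _ = n * Q * d ^ h * (Q / n) ^ j := by
          push_cast
          rw [div_pow, pow_succ]
          ring
      _ ≤ _ := by
          have : (Q : ℝ) / n ≤ 1 / 2 := by
            rw [div_le_div_iff₀ hn two_pos]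
            have : ((2 * Q : ℕ) : ℝ) ≤ (Fintype.card V : ℝ) := by exact_mod_cast hQ
            push_cast at this
            rw [hndef]
            linarith
          gcongr
  refine (Finset.sum_le_sum hterm).trans ?_
  rw [← Finset.mul_sum]
  have hgeo : ∑ j ∈ Finset.range (h + 1), ((1 : ℝ) / 2) ^ j ≤ 2 := by
    exact sum_geometric_two_le _
  calc _ ≤ n * Q * d ^ h * 2 := by gcongr
    _ = _ := by ring

end Blocks

/-! ### Closed words made of two walks that are not self-avoiding -/

section Labels

variable {V : Type*}

/-- The label of a step of a typed word. A step of type `true` runs along an edge and is labelled by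
it; a step of type `false` is a jump between two arbitrary vertices and has a label of its own. -/
def stepLabel (w : ℕ → V) (τ : ℕ → Bool) (t : ℕ) : Sym2 V ⊕ ℕ :=
  if τ t then Sum.inl s(w t, w (t + 1)) else Sum.inr t

lemma edge_eq_of_stepLabel_eq {w : ℕ → V} {τ : ℕ → Bool} {t a : ℕ}
    (h : stepLabel w τ t = stepLabel w τ a) : s(w t, w (t + 1)) = s(w a, w (a + 1)) := by
  unfold stepLabel at h
  split_ifs at h with h1 h2 h2
  · exact Sum.inl.inj h
  · rw [Sum.inr.inj h]

lemma stepLabel_eq_of_not {w : ℕ → V} {τ : ℕ → Bool} {t a : ℕ} (hτ : τ t = false)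
    (h : stepLabel w τ a = stepLabel w τ t) : a = t := by
  unfold stepLabel at h
  simp only [hτ] at h
  split_ifs at h
  all_goals simp_all

/-- A word which visits some vertex twice has a first return. -/
lemma exists_first_return {w : ℕ → V} {a b : ℕ} (h : ∃ x y, a ≤ x ∧ x < y ∧ y ≤ b ∧ w x = w y) :
    ∃ x y, a ≤ x ∧ x < y ∧ y ≤ b ∧ w x = w y ∧
      ∀ t u, a ≤ t → t < u → u < y → w t ≠ w u := by
  classical
  have h' : ∃ y, ∃ x, a ≤ x ∧ x < y ∧ y ≤ b ∧ w x = w y := by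
    obtain ⟨x, y, h⟩ := h
    exact ⟨y, x, h⟩
  obtain ⟨x, h1, h2, h3, h4⟩ := Nat.find_spec h'
  refine ⟨x, Nat.find h', h1, h2, h3, h4, ?_⟩
  intro t u hat htu hu he
  exact Nat.find_min h' hu ⟨t, hat, htu, by omega, he⟩

/-- A step which is not an excess step runs along an edge between a vertex and its parent. -/
lemma parent_or_of_not_isExcess {w : ℕ → V} {r s : ℕ} (hsr : s < r)
    (h0 : ∀ t < r, firstVisit w t = t) {t : ℕ} (h : ¬ IsExcess r s (firstVisit w) t) :
    firstVisit w (t + 1) = parent r s (firstVisit w) (firstVisit w t) ∨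
      firstVisit w t = parent r s (firstVisit w) (firstVisit w (t + 1)) := by
  by_cases n : IsNew (firstVisit w) t
  · have hn : firstVisit w (t + 1) = t + 1 := n
    rcases Nat.lt_or_ge t s with hts | hts
    · left
      rw [hn, h0 t (by omega), parent, if_pos hts]
    · right
      rw [hn, parent, if_neg (by omega), if_neg (by omega), Nat.add_sub_cancel]
  by_cases u : IsUp r s (firstVisit w) t
  · exact Or.inl u.2
  · right
    by_contra hd
    exact h ⟨n, u, hd⟩

/-- A set of vertices and a set of labels with endpoints among them, such that the labels outnumber
the vertices by at least `c`. -/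
structure HasExcess (w : ℕ → V) (τ : ℕ → Bool) (c : ℕ) (VS : Finset V)
    (ES : Finset (Sym2 V ⊕ ℕ)) : Prop where
  card_le : VS.card + c ≤ ES.card
  mem : ∀ t, stepLabel w τ t ∈ ES → w t ∈ VS ∧ w (t + 1) ∈ VS

variable [DecidableEq V] {w : ℕ → V} {τ : ℕ → Bool} {c : ℕ} {VS : Finset V}
  {ES : Finset (Sym2 V ⊕ ℕ)}

lemma HasExcess.insert_step (h : HasExcess w τ c VS ES) {t : ℕ}
    (ht : w t ∈ VS ∨ w (t + 1) ∈ VS) :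
    HasExcess w τ c (insert (w t) (insert (w (t + 1)) VS)) (insert (stepLabel w τ t) ES) := by
  constructor
  · by_cases hl : stepLabel w τ t ∈ ES
    · obtain ⟨h1, h2⟩ := h.mem t hl
      rw [Finset.insert_eq_of_mem hl, Finset.insert_eq_of_mem h2, Finset.insert_eq_of_mem h1]
      exact h.card_le
    · rw [Finset.card_insert_of_notMem hl]
      have h0 := h.card_le
      rcases ht with h1 | h1
      · rw [Finset.insert_eq_of_mem (Finset.mem_insert_of_mem h1)]
        have := Finset.card_insert_le (w (t + 1)) VS
        omega
      · rw [Finset.insert_eq_of_mem h1]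
        have := Finset.card_insert_le (w t) VS
        omega
  · intro a ha
    rcases Finset.mem_insert.1 ha with ha | ha
    · have := edge_eq_of_stepLabel_eq ha
      rw [Sym2.eq_iff] at this
      rcases this with ⟨h1, h2⟩ | ⟨h1, h2⟩ <;> rw [h1, h2] <;> simp
    · have := h.mem a ha
      simp [this.1, this.2]

/-- Walking on from a known vertex does not diminish the excess. -/
lemma HasExcess.forward (h : HasExcess w τ c VS ES) {a : ℕ} (ha : w a ∈ VS) {b : ℕ} (hab : a ≤ b) :
    HasExcess w τ c (VS ∪ (Finset.Icc a b).image w)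
      (ES ∪ (Finset.Ico a b).image (stepLabel w τ)) := by
  induction b, hab using Nat.le_induction with
  | base =>
    simpa [Finset.union_eq_left.2 (Finset.singleton_subset_iff.2 ha)] using h
  | succ b hab ih =>
    have h1 := ih.insert_step (t := b) (Or.inl (Finset.mem_union_right _
      (Finset.mem_image_of_mem _ (Finset.mem_Icc.2 ⟨hab, le_rfl⟩))))
    convert h1 using 1
    · ext x
      simp only [Finset.mem_union, Finset.mem_image, Finset.mem_Icc, Finset.mem_insert]
      constructor
      · rintro (hx | ⟨t, ht, rfl⟩)
        · exact Or.inr (Or.inr (Or.inl hx))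
        · rcases Nat.lt_or_ge b t with h2 | h2
          · obtain rfl : t = b + 1 := by omega
            exact Or.inr (Or.inl rfl)
          · exact Or.inr (Or.inr (Or.inr ⟨t, by omega, rfl⟩))
      · rintro (rfl | rfl | hx | ⟨t, ht, rfl⟩)
        · exact Or.inr ⟨b, by omega, rfl⟩
        · exact Or.inr ⟨b + 1, by omega, rfl⟩
        · exact Or.inl hx
        · exact Or.inr ⟨t, by omega, rfl⟩
    · rw [← Finset.insert_Ico_right_eq_Ico_add_one hab, Finset.image_insert, Finset.union_insert]

/-- Walking backwards from a known vertex does not diminish the excess. -/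
lemma HasExcess.backward (h : HasExcess w τ c VS ES) {b : ℕ} (hb : w b ∈ VS) {a : ℕ} (hab : a ≤ b) :
    HasExcess w τ c (VS ∪ (Finset.Icc a b).image w)
      (ES ∪ (Finset.Ico a b).image (stepLabel w τ)) := by
  induction hab using Nat.decreasingInduction with
  | self =>
    simpa [Finset.union_eq_left.2 (Finset.singleton_subset_iff.2 hb)] using h
  | of_succ a hab ih =>
    have h1 := ih.insert_step (t := a) (Or.inr (Finset.mem_union_right _
      (Finset.mem_image_of_mem _ (Finset.mem_Icc.2 ⟨le_rfl, hab⟩))))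
    convert h1 using 1
    · ext x
      simp only [Finset.mem_union, Finset.mem_image, Finset.mem_Icc, Finset.mem_insert]
      constructor
      · rintro (hx | ⟨t, ht, rfl⟩)
        · exact Or.inr (Or.inr (Or.inl hx))
        · rcases Nat.lt_or_ge a t with h2 | h2
          · exact Or.inr (Or.inr (Or.inr ⟨t, by omega, rfl⟩))
          · obtain rfl : t = a := by omega
            exact Or.inl rfl
      · rintro (rfl | rfl | hx | ⟨t, ht, rfl⟩)
        · exact Or.inr ⟨a, by omega, rfl⟩
        · exact Or.inr ⟨a + 1, by omega, rfl⟩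
        · exact Or.inl hx
        · exact Or.inr ⟨t, by omega, rfl⟩
    · rw [← Finset.insert_Ico_add_one_left_eq_Ico (by omega), Finset.image_insert,
        Finset.union_insert]

/-- The steps of type `true` between the times `a` and `b` join distinct vertices, and two
consecutive ones do not backtrack. -/
structure NonBacktracking (w : ℕ → V) (τ : ℕ → Bool) (a b : ℕ) : Prop where
  ne_succ : ∀ t, a ≤ t → t + 1 ≤ b → τ t = true → w t ≠ w (t + 1)
  ne_succ_succ : ∀ t, a ≤ t → t + 2 ≤ b → τ t = true → τ (t + 1) = true → w t ≠ w (t + 2)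

/-- A walk up to the time of its first return has as many labels as vertices. -/
lemma hasExcess_of_first_return {a y x : ℕ} (hnb : NonBacktracking w τ a y) (hax : a ≤ x)
    (hxy : x < y) (hw : w x = w y)
    (hdist : ∀ t u, a ≤ t → t < u → u < y → w t ≠ w u) :
    HasExcess w τ 0 ((Finset.Icc a y).image w) ((Finset.Ico a y).image (stepLabel w τ)) := by
  constructor
  · have h1 : (Finset.Icc a y).image w ⊆ (Finset.Ico a y).image w := by
      intro v hv
      obtain ⟨t, ht, rfl⟩ := Finset.mem_image.1 hv
      rw [Finset.mem_Icc] at ht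
      rcases ht.2.eq_or_lt with rfl | h
      · rw [← hw]
        exact Finset.mem_image_of_mem _ (Finset.mem_Ico.2 ⟨hax, hxy⟩)
      · exact Finset.mem_image_of_mem _ (Finset.mem_Ico.2 ⟨ht.1, h⟩)
    have h2 : Set.InjOn (stepLabel w τ) (Finset.Ico a y) := by
      have key : ∀ t u, a ≤ t → t < u → u < y → stepLabel w τ t ≠ stepLabel w τ u := by
        intro t u hat htu huy h
        have he := edge_eq_of_stepLabel_eq h
        rw [Sym2.eq_iff] at he
        rcases he with ⟨h1, -⟩ | ⟨h1, h2⟩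
        · exact hdist t u hat htu huy h1
        · have hu : u = t + 1 := by
            by_contra hne
            exact hdist (t + 1) u (by omega) (by omega) huy h2
          subst hu
          have hτ : τ t = true := by
            by_contra hτ
            have := stepLabel_eq_of_not (by simpa using hτ) h.symm
            omega
          have hτ' : τ (t + 1) = true := by
            by_contra hτ'
            have := stepLabel_eq_of_not (by simpa using hτ') h
            omega
          exact hnb.ne_succ_succ t hat (by omega) hτ hτ' h1
      intro t ht u hu h
      simp only [Finset.coe_Ico, Set.mem_Ico] at ht hu
      rcases lt_trichotomy t u with h1 | h1 | h1
      · exact absurd h (key t u ht.1 h1 hu.2)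
      · exact h1
      · exact absurd h.symm (key u t hu.1 h1 ht.2)
    rw [add_zero, Finset.card_image_of_injOn h2]
    exact (Finset.card_le_card h1).trans Finset.card_image_le
  · intro t ht
    obtain ⟨u, hu, h⟩ := Finset.mem_image.1 ht
    rw [Finset.mem_Ico] at hu
    have he := edge_eq_of_stepLabel_eq h
    have m1 : w u ∈ (Finset.Icc a y).image w :=
      Finset.mem_image_of_mem _ (Finset.mem_Icc.2 ⟨by omega, by omega⟩)
    have m2 : w (u + 1) ∈ (Finset.Icc a y).image w :=
      Finset.mem_image_of_mem _ (Finset.mem_Icc.2 ⟨by omega, by omega⟩)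
    rw [Sym2.eq_iff] at he
    rcases he with ⟨h1, h2⟩ | ⟨h1, h2⟩
    · exact ⟨h1 ▸ m1, h2 ▸ m2⟩
    · exact ⟨h2 ▸ m2, h1 ▸ m1⟩

/-- A non-backtracking walk which is not self-avoiding has as many labels as vertices. -/
lemma hasExcess_of_nonBacktracking {a b : ℕ} (hnb : NonBacktracking w τ a b)
    (h : ∃ x y, a ≤ x ∧ x < y ∧ y ≤ b ∧ w x = w y) :
    HasExcess w τ 0 ((Finset.Icc a b).image w) ((Finset.Ico a b).image (stepLabel w τ)) := by
  obtain ⟨x, y, hax, hxy, hyb, hw, hd⟩ := exists_first_return h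
  have h1 : NonBacktracking w τ a y :=
    ⟨fun t h1 h2 => hnb.1 t h1 (by omega), fun t h1 h2 => hnb.2 t h1 (by omega)⟩
  have h2 := (hasExcess_of_first_return h1 hax hxy hw hd).forward (a := y)
    (Finset.mem_image_of_mem _ (Finset.mem_Icc.2 ⟨by omega, le_rfl⟩)) hyb
  rwa [← Finset.image_union, ← Finset.image_union,
    Finset.Ico_union_Ico_eq_Ico (by omega) hyb,
    show Finset.Icc a y ∪ Finset.Icc y b = Finset.Icc a b from ?_] at h2
  ext t
  simp only [Finset.mem_union, Finset.mem_Icc]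
  omega

/-- A closed typed word of `2 * k` steps whose two halves are non-backtracking and not
self-avoiding. -/
structure IsReturningPair (k : ℕ) (w : ℕ → V) (τ : ℕ → Bool) : Prop where
  closed : w 0 = w (2 * k)
  left : NonBacktracking w τ 0 k
  right : NonBacktracking w τ k (2 * k)
  left_return : ∃ x y, 0 ≤ x ∧ x < y ∧ y ≤ k ∧ w x = w y
  right_return : ∃ x y, k ≤ x ∧ x < y ∧ y ≤ 2 * k ∧ w x = w y

/-- If a label occurs once, then without it the labels are still as many as the vertices,
since one of the two halves avoids it. -/
lemma IsReturningPair.card_add_one_le_of_unique {k : ℕ} (h : IsReturningPair k w τ) {t₀ : ℕ}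
    (ht₀ : t₀ < 2 * k) (hu : ∀ t < 2 * k, t ≠ t₀ → stepLabel w τ t ≠ stepLabel w τ t₀) :
    ((Finset.range (2 * k + 1)).image w).card + 1 ≤
      ((Finset.range (2 * k)).image (stepLabel w τ)).card := by
  have key : ∃ (VS : Finset V) (ES : Finset (Sym2 V ⊕ ℕ)), HasExcess w τ 0 VS ES ∧
      (∀ t ≤ 2 * k, w t ∈ VS) ∧ (∀ l ∈ ES, ∃ t < 2 * k, t ≠ t₀ ∧ stepLabel w τ t = l) := by
    rcases Nat.lt_or_ge t₀ k with hk | hk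
    · have h1 := hasExcess_of_nonBacktracking h.right h.right_return
      have h2 := h1.forward (a := 0) (by
        rw [h.closed]
        exact Finset.mem_image_of_mem _ (Finset.mem_Icc.2 ⟨by omega, le_rfl⟩)) (Nat.zero_le t₀)
      have h3 := h2.backward (b := k) (Finset.mem_union_left _
        (Finset.mem_image_of_mem _ (Finset.mem_Icc.2 ⟨le_rfl, by omega⟩)))
        (show t₀ + 1 ≤ k by omega)
      refine ⟨_, _, h3, ?_, ?_⟩
      · intro t ht
        simp only [Finset.mem_union, Finset.mem_image, Finset.mem_Icc]
        rcases Nat.lt_or_ge t₀ t with h4 | h4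
        · rcases Nat.lt_or_ge t k with h5 | h5
          · exact Or.inr ⟨t, by omega, rfl⟩
          · exact Or.inl (Or.inl ⟨t, by omega, rfl⟩)
        · exact Or.inl (Or.inr ⟨t, by omega, rfl⟩)
      · intro l hl
        simp only [Finset.mem_union, Finset.mem_image, Finset.mem_Ico] at hl
        rcases hl with (⟨t, ht, rfl⟩ | ⟨t, ht, rfl⟩) | ⟨t, ht, rfl⟩ <;>
          exact ⟨t, by omega, by omega, rfl⟩
    · have h1 := hasExcess_of_nonBacktracking h.left h.left_return
      have h2 := h1.forward (a := k) (Finset.mem_image_of_mem _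
        (Finset.mem_Icc.2 ⟨by omega, le_rfl⟩)) hk
      have h3 := h2.backward (b := 2 * k) (Finset.mem_union_left _ (by
        rw [← h.closed]
        exact Finset.mem_image_of_mem _ (Finset.mem_Icc.2 ⟨le_rfl, by omega⟩)))
        (show t₀ + 1 ≤ 2 * k by omega)
      refine ⟨_, _, h3, ?_, ?_⟩
      · intro t ht
        simp only [Finset.mem_union, Finset.mem_image, Finset.mem_Icc]
        rcases Nat.lt_or_ge t₀ t with h4 | h4
        · exact Or.inr ⟨t, by omega, rfl⟩
        · rcases Nat.lt_or_ge t k with h5 | h5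
          · exact Or.inl (Or.inl ⟨t, by omega, rfl⟩)
          · exact Or.inl (Or.inr ⟨t, by omega, rfl⟩)
      · intro l hl
        simp only [Finset.mem_union, Finset.mem_image, Finset.mem_Ico] at hl
        rcases hl with (⟨t, ht, rfl⟩ | ⟨t, ht, rfl⟩) | ⟨t, ht, rfl⟩ <;>
          exact ⟨t, by omega, by omega, rfl⟩
  obtain ⟨VS, ES, hE, hV, hL⟩ := key
  have h1 : ((Finset.range (2 * k + 1)).image w).card ≤ VS.card := by
    apply Finset.card_le_card
    intro v hv
    obtain ⟨t, ht, rfl⟩ := Finset.mem_image.1 hv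
    exact hV t (by rw [Finset.mem_range] at ht; omega)
  have h2 : stepLabel w τ t₀ ∉ ES := by
    intro hm
    obtain ⟨t, ht, hne, he⟩ := hL _ hm
    exact hu t ht hne he
  have h3 : (insert (stepLabel w τ t₀) ES).card ≤
      ((Finset.range (2 * k)).image (stepLabel w τ)).card := by
    apply Finset.card_le_card
    intro l hl
    rcases Finset.mem_insert.1 hl with rfl | hl
    · exact Finset.mem_image_of_mem _ (Finset.mem_range.2 ht₀)
    · obtain ⟨t, ht, -, rfl⟩ := hL l hl
      exact Finset.mem_image_of_mem _ (Finset.mem_range.2 ht)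
  rw [Finset.card_insert_of_notMem h2] at h3
  have := hE.card_le
  omega

lemma IsReturningPair.card_le {k : ℕ} (h : IsReturningPair k w τ) :
    ((Finset.range (2 * k + 1)).image w).card ≤
      ((Finset.range (2 * k)).image (stepLabel w τ)).card := by
  have h1 := hasExcess_of_nonBacktracking h.left h.left_return
  have h2 := (h1.forward (a := k) (Finset.mem_image_of_mem _
    (Finset.mem_Icc.2 ⟨by omega, le_rfl⟩)) (show k ≤ 2 * k by omega)).card_le
  rw [← Finset.image_union, ← Finset.image_union, add_zero] at h2
  refine (Finset.card_le_card ?_).trans (h2.trans (Finset.card_le_card ?_))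
  · apply Finset.image_subset_image
    intro t ht
    simp only [Finset.mem_union, Finset.mem_Icc, Finset.mem_range] at *
    omega
  · apply Finset.image_subset_image
    intro t ht
    simp only [Finset.mem_union, Finset.mem_Ico, Finset.mem_range] at *
    omega

/-- If there are not more labels than vertices, then every label occurs at least twice. -/
lemma IsReturningPair.exists_ne_of_card_le {k : ℕ} (h : IsReturningPair k w τ)
    (hle : ((Finset.range (2 * k)).image (stepLabel w τ)).card ≤
      ((Finset.range (2 * k + 1)).image w).card) {t₀ : ℕ} (ht₀ : t₀ < 2 * k) :
    ∃ t < 2 * k, t ≠ t₀ ∧ stepLabel w τ t = stepLabel w τ t₀ := by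
  by_contra hn
  push Not at hn
  have := h.card_add_one_le_of_unique ht₀ hn
  omega

lemma IsReturningPair.eq_true_of_card_le {k : ℕ} (h : IsReturningPair k w τ)
    (hle : ((Finset.range (2 * k)).image (stepLabel w τ)).card ≤
      ((Finset.range (2 * k + 1)).image w).card) {t₀ : ℕ} (ht₀ : t₀ < 2 * k) : τ t₀ = true := by
  obtain ⟨t, -, hne, he⟩ := h.exists_ne_of_card_le hle ht₀
  by_contra hτ
  exact hne (stepLabel_eq_of_not (by simpa using hτ) he)

lemma IsReturningPair.card_label_le_of_card_le {k : ℕ} (h : IsReturningPair k w τ)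
    (hle : ((Finset.range (2 * k)).image (stepLabel w τ)).card ≤
      ((Finset.range (2 * k + 1)).image w).card) :
    ((Finset.range (2 * k)).image (stepLabel w τ)).card ≤ k := by
  have h1 : ((Finset.range (2 * k)).image (stepLabel w τ)).card * 2 ≤
      (Finset.range (2 * k)).card := by
    rw [Finset.card_eq_sum_card_fiberwise (s := Finset.range (2 * k)) (f := stepLabel w τ)
      (t := (Finset.range (2 * k)).image (stepLabel w τ))
      (fun t ht => Finset.mem_image_of_mem _ ht), ← smul_eq_mul]
    apply Finset.card_nsmul_le_sum
    intro l hl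
    obtain ⟨t₀, ht₀, rfl⟩ := Finset.mem_image.1 hl
    obtain ⟨t, ht, hne, he⟩ := h.exists_ne_of_card_le hle (Finset.mem_range.1 ht₀)
    have : ({t, t₀} : Finset ℕ) ⊆
        (Finset.range (2 * k)).filter (fun u => stepLabel w τ u = stepLabel w τ t₀) := by
      intro u hu
      simp only [Finset.mem_insert, Finset.mem_singleton] at hu
      rcases hu with rfl | rfl
      · exact Finset.mem_filter.2 ⟨Finset.mem_range.2 ht, he⟩
      · exact Finset.mem_filter.2 ⟨ht₀, rfl⟩
    exact (Finset.card_pair hne).symm.le.trans (Finset.card_le_card this)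
  rw [Finset.card_range] at h1
  omega

/-- If there are not more labels than vertices, then no step after the first return is an excess
step: the word explores a graph with a single cycle. -/
lemma IsReturningPair.not_isExcess {k r s : ℕ} (h : IsReturningPair k w τ)
    (hle : ((Finset.range (2 * k)).image (stepLabel w τ)).card ≤
      ((Finset.range (2 * k + 1)).image w).card)
    (hsr : s < r) (hrk : r ≤ k) (hret : w s = w r)
    (hdist : ∀ t u, 0 ≤ t → t < u → u < r → w t ≠ w u) :
    ∀ t < 2 * k, ¬ IsExcess r s (firstVisit w) t := by
  have h0 : ∀ t < r, firstVisit w t = t := by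
    intro t ht
    rcases (firstVisit_le w t).eq_or_lt with h1 | h1
    · exact h1
    · exact absurd (apply_firstVisit w t) (hdist _ _ (Nat.zero_le _) h1 ht)
  by_contra hcon
  push Not at hcon
  classical
  obtain ⟨ht, hex⟩ := Nat.find_spec hcon
  have hmin : ∀ a < Nat.find hcon, ¬ IsExcess r s (firstVisit w) a := by
    intro a ha hae
    exact Nat.find_min hcon ha ⟨by omega, hae⟩
  set t₀ := Nat.find hcon
  have hr : firstVisit w r = s := by
    rw [← h0 s hsr, firstVisit_eq_iff, hret]
  have hrt : r ≤ t₀ := by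
    by_contra hlt
    rcases Nat.lt_or_ge (t₀ + 1) r with h1 | h1
    · exact hex.1 (h0 _ h1)
    · have h2 : t₀ + 1 = r := by omega
      apply hex.2.2
      rw [h2, hr, h0 t₀ (by omega), parent, if_neg (lt_irrefl _), if_pos rfl]
      omega
  have hnb : NonBacktracking w τ 0 r :=
    ⟨fun t h1 h2 => h.left.1 t h1 (by omega), fun t h1 h2 => h.left.2 t h1 (by omega)⟩
  have h1 := (hasExcess_of_first_return hnb (Nat.zero_le s) hsr hret hdist).forward (a := r)
    (Finset.mem_image_of_mem _ (Finset.mem_Icc.2 ⟨by omega, le_rfl⟩)) hrt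
  have hV : (Finset.Icc 0 r).image w ∪ (Finset.Icc r t₀).image w = (Finset.Icc 0 t₀).image w := by
    rw [← Finset.image_union]
    congr 1
    ext t
    simp only [Finset.mem_union, Finset.mem_Icc]
    omega
  rw [hV, ← Finset.image_union, Finset.Ico_union_Ico_eq_Ico (by omega) hrt] at h1
  have hnew : stepLabel w τ t₀ ∉ (Finset.Ico 0 t₀).image (stepLabel w τ) := by
    intro hm
    obtain ⟨a, ha, hae⟩ := Finset.mem_image.1 hm
    rw [Finset.mem_Ico] at ha
    have he := edge_eq_of_stepLabel_eq hae
    have hp := parent_or_of_not_isExcess hsr h0 (hmin a ha.2)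
    have hup : ¬ firstVisit w (t₀ + 1) = parent r s (firstVisit w) (firstVisit w t₀) :=
      fun hh => hex.2.1 ⟨hex.1, hh⟩
    rw [Sym2.eq_iff] at he
    rcases he with ⟨e1, e2⟩ | ⟨e1, e2⟩ <;> rw [← firstVisit_eq_iff] at e1 e2 <;>
      rw [e1, e2] at hp
    · exact hp.elim hup hex.2.2
    · exact hp.elim hex.2.2 hup
  have h2 : HasExcess w τ 1 ((Finset.Icc 0 (t₀ + 1)).image w)
      ((Finset.Ico 0 (t₀ + 1)).image (stepLabel w τ)) := by
    have h3 := h1.insert_step (t := t₀) (Or.inl (Finset.mem_image_of_mem _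
      (Finset.mem_Icc.2 ⟨Nat.zero_le _, le_rfl⟩)))
    have e1 : (Finset.Icc 0 (t₀ + 1)).image w =
        insert (w t₀) (insert (w (t₀ + 1)) ((Finset.Icc 0 t₀).image w)) := by
      rw [← Finset.insert_Icc_right_eq_Icc_add_one (Nat.zero_le _), Finset.image_insert,
        Finset.insert_comm, Finset.insert_eq_of_mem (a := w t₀)]
      exact Finset.mem_image_of_mem _ (Finset.mem_Icc.2 ⟨Nat.zero_le _, le_rfl⟩)
    have e2 : (Finset.Ico 0 (t₀ + 1)).image (stepLabel w τ) =
        insert (stepLabel w τ t₀) ((Finset.Ico 0 t₀).image (stepLabel w τ)) := by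
      rw [← Finset.insert_Ico_right_eq_Ico_add_one (Nat.zero_le _), Finset.image_insert]
    have e3 : (Finset.Icc 0 (t₀ + 1)).image w = (Finset.Icc 0 t₀).image w := by
      rw [e1]
      have hfv : firstVisit w (t₀ + 1) ≤ t₀ := by
        have := firstVisit_le w (t₀ + 1)
        rcases this.eq_or_lt with h4 | h4
        · exact absurd h4 hex.1
        · omega
      rw [Finset.insert_eq_of_mem (a := w (t₀ + 1)), Finset.insert_eq_of_mem (a := w t₀)]
      · exact Finset.mem_image_of_mem _ (Finset.mem_Icc.2 ⟨Nat.zero_le _, le_rfl⟩)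
      · rw [← apply_firstVisit w (t₀ + 1)]
        exact Finset.mem_image_of_mem _ (Finset.mem_Icc.2 ⟨Nat.zero_le _, hfv⟩)
    constructor
    · rw [e3, e2, Finset.card_insert_of_notMem hnew]
      have := h1.card_le
      omega
    · rw [e1, e2]
      exact h3.mem
  have h3 := (h2.forward (a := t₀ + 1) (Finset.mem_image_of_mem _
    (Finset.mem_Icc.2 ⟨Nat.zero_le _, le_rfl⟩)) (show t₀ + 1 ≤ 2 * k by omega)).card_le
  rw [← Finset.image_union, ← Finset.image_union,
    Finset.Ico_union_Ico_eq_Ico (Nat.zero_le _) (show t₀ + 1 ≤ 2 * k by omega)] at h3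
  have h4 : ((Finset.range (2 * k + 1)).image w).card ≤
      ((Finset.Icc 0 (t₀ + 1) ∪ Finset.Icc (t₀ + 1) (2 * k)).image w).card := by
    apply Finset.card_le_card
    apply Finset.image_subset_image
    intro t ht
    simp only [Finset.mem_union, Finset.mem_Icc, Finset.mem_range] at *
    omega
  rw [Finset.range_eq_Ico] at h4 hle
  rw [Finset.range_eq_Ico] at hle
  omega

end Labels

section PairCount

variable {V : Type*} [DecidableEq V]

/-- The types of the steps of a word of `N` steps, continued by `false`. -/
def extendType {N : ℕ} (τ : Fin N → Bool) (t : ℕ) : Bool :=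
  if h : t < N then τ ⟨t, h⟩ else false

/-- The number of distinct labels of a typed word. -/
def labelCount {N : ℕ} (x : (Fin (N + 1) → V) × (Fin N → Bool)) : ℕ :=
  ((Finset.range N).image (stepLabel (extend x.1) (extendType x.2))).card

lemma vertexCount_eq_card_image {N : ℕ} (ω : Fin (N + 1) → V) :
    vertexCount ω = ((Finset.range (N + 1)).image (extend ω)).card := by
  unfold vertexCount
  congr 1
  ext v
  simp only [Finset.mem_image, Finset.mem_univ, true_and, Finset.mem_range]
  constructor
  · rintro ⟨t, rfl⟩
    exact ⟨t, t.2, extend_of_le ω (by have := t.2; omega)⟩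
  · rintro ⟨t, ht, rfl⟩
    exact ⟨⟨t, ht⟩, (extend_of_le ω (by omega)).symm⟩

variable [Fintype V]

/-- A word with a single cycle is a sequence of boundedly many runs of steps upwards, downwards or
to new vertices, so that such words have polynomially many patterns. -/
lemma sum_inv_pow_vertexCount_le_of_unicyclic {k : ℕ} (hV : 0 < Fintype.card V)
    (W : Finset (Fin (2 * k + 1) → V))
    (hW : ∀ ω ∈ W, ∃ τ : Fin (2 * k) → Bool, IsReturningPair k (extend ω) (extendType τ) ∧
      labelCount (ω, τ) ≤ vertexCount ω) :
    ∑ ω ∈ W, ((Fintype.card V : ℝ) ^ vertexCount ω)⁻¹ ≤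
      (((2 * k + 1) ^ 2 * (4 * (2 * k) * (2 * k + 1) ^ 2 + 1) ^ 9 : ℕ) : ℝ) := by
  classical
  refine sum_inv_pow_vertexCount_le_of_changes (B := 8) W hV ?_
  intro ω hω
  obtain ⟨τ, hp, hle⟩ := hW ω hω
  rw [vertexCount_eq_card_image] at hle
  simp only [labelCount] at hle
  set w := extend ω
  obtain ⟨s, r, -, hsr, hrk, hret, hdist⟩ := exists_first_return hp.left_return
  have h0 : ∀ t < r, firstVisit w t = t := by
    intro t ht
    rcases (firstVisit_le w t).eq_or_lt with h1 | h1
    · exact h1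
    · exact absurd (apply_firstVisit w t) (hdist _ _ (Nat.zero_le _) h1 ht)
  have hex := hp.not_isExcess hle hsr hrk hret hdist
  refine ⟨r, by omega, s, hsr, h0, ?_⟩
  refine (card_changes_le (isPattern_firstVisit w) hsr h0 {k, r - 1} ?_).trans ?_
  · intro t ht hb
    simp only [Finset.mem_insert, Finset.mem_singleton, not_or] at hb
    by_cases htr : t + 2 < r
    · exact Or.inl htr
    right
    refine ⟨by omega, hex t (by omega), hex (t + 1) ht, ?_⟩
    rw [Ne, firstVisit_eq_iff]
    have t1 := hp.eq_true_of_card_le hle (t₀ := t) (by omega)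
    have t2 := hp.eq_true_of_card_le hle (t₀ := t + 1) ht
    rcases Nat.lt_or_ge t k with h1 | h1
    · exact (hp.left.ne_succ_succ t (Nat.zero_le _) (by omega) t1 t2).symm
    · exact (hp.right.ne_succ_succ t h1 (by omega) t1 t2).symm
  · have := Finset.card_le_two (a := k) (b := r - 1)
    omega

/-- The closed words made of two walks that are not self-avoiding, weighted by the probability that
their edges are present and by the factors of their jumps. -/
theorem sum_pow_labelCount_le {k : ℕ} (hV : 0 < Fintype.card V) {d : ℝ} (hd : 1 ≤ d)
    (W : Finset ((Fin (2 * k + 1) → V) × (Fin (2 * k) → Bool)))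
    (hW : ∀ x ∈ W, IsReturningPair k (extend x.1) (extendType x.2)) :
    ∑ x ∈ W, (d / Fintype.card V) ^ labelCount x ≤
      d ^ k * ((2 * k + 1) ^ 2 * (4 * (2 * k) * (2 * k + 1) ^ 2 + 1) ^ 9 : ℕ) +
      d ^ (2 * k) * (2 ^ (2 * k) * (2 * k + 1) ^ (2 * k + 1) : ℕ) / Fintype.card V := by
  classical
  have hn : (0 : ℝ) < Fintype.card V := by exact_mod_cast hV
  have hn1 : (1 : ℝ) ≤ Fintype.card V := by exact_mod_cast hV
  set n : ℝ := (Fintype.card V : ℝ) with hndef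
  rw [← Finset.sum_filter_add_sum_filter_not W (fun x => labelCount x ≤ vertexCount x.1)]
  apply add_le_add
  · set W₁ := W.filter (fun x => labelCount x ≤ vertexCount x.1)
    have hW₁ : ∀ x ∈ W₁, IsReturningPair k (extend x.1) (extendType x.2) ∧
        labelCount x ≤ vertexCount x.1 := fun x hx =>
      ⟨hW x (Finset.mem_filter.1 hx).1, (Finset.mem_filter.1 hx).2⟩
    have hinj : Set.InjOn Prod.fst (W₁ : Set ((Fin (2 * k + 1) → V) × (Fin (2 * k) → Bool))) := by
      have key : ∀ x ∈ W₁, ∀ t, x.2 t = true := by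
        intro x hx t
        have h := hW₁ x hx
        have hle := h.2
        rw [vertexCount_eq_card_image] at hle
        have := h.1.eq_true_of_card_le hle t.2
        simpa [extendType] using this
      intro x hx y hy hxy
      refine Prod.ext hxy (funext fun t => ?_)
      rw [key x hx, key y hy]
    calc ∑ x ∈ W₁, (d / n) ^ labelCount x
        ≤ ∑ x ∈ W₁, d ^ k * (n ^ vertexCount x.1)⁻¹ := by
          apply Finset.sum_le_sum
          intro x hx
          obtain ⟨h1, h2⟩ := hW₁ x hx
          have h3 := h2
          rw [vertexCount_eq_card_image] at h3
          rw [div_pow, div_eq_mul_inv]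
          have h4 : labelCount x ≤ k := h1.card_label_le_of_card_le h3
          have h5 : vertexCount x.1 ≤ labelCount x := by
            rw [vertexCount_eq_card_image]
            exact h1.card_le
          gcongr
      _ = d ^ k * ∑ ω ∈ W₁.image Prod.fst, (n ^ vertexCount ω)⁻¹ := by
          rw [Finset.sum_image hinj, Finset.mul_sum]
      _ ≤ _ := by
          gcongr
          apply sum_inv_pow_vertexCount_le_of_unicyclic hV
          intro ω hω
          obtain ⟨x, hx, rfl⟩ := Finset.mem_image.1 hω
          exact ⟨x.2, hW₁ x hx⟩
  · calc ∑ x ∈ W.filter (fun x => ¬ labelCount x ≤ vertexCount x.1), (d / n) ^ labelCount x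
        ≤ ∑ x ∈ W.filter (fun x => ¬ labelCount x ≤ vertexCount x.1),
          d ^ (2 * k) * n⁻¹ * (n ^ vertexCount x.1)⁻¹ := by
          apply Finset.sum_le_sum
          intro x hx
          have h1 := (Finset.mem_filter.1 hx).2
          have h2 : labelCount x ≤ 2 * k := by
            refine Finset.card_image_le.trans ?_
            rw [Finset.card_range]
          rw [div_pow, div_eq_mul_inv, mul_assoc, ← mul_inv, ← pow_succ']
          have h3 : vertexCount x.1 + 1 ≤ labelCount x := by omega
          gcongr
      _ ≤ ∑ x : (Fin (2 * k + 1) → V) × (Fin (2 * k) → Bool),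
          d ^ (2 * k) * n⁻¹ * (n ^ vertexCount x.1)⁻¹ := by
          apply Finset.sum_le_sum_of_subset_of_nonneg (Finset.subset_univ _)
          intro x _ _
          positivity
      _ = d ^ (2 * k) * n⁻¹ * (2 ^ (2 * k) * ∑ ω : Fin (2 * k + 1) → V,
          (n ^ vertexCount ω)⁻¹) := by
          rw [← Finset.mul_sum, Fintype.sum_prod_type]
          simp only [Finset.sum_const, Finset.card_univ, Fintype.card_fun, Fintype.card_bool,
            Fintype.card_fin, nsmul_eq_mul]
          rw [← Finset.mul_sum]
          push_cast
          rfl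
      _ ≤ d ^ (2 * k) * n⁻¹ * (2 ^ (2 * k) * (((2 * k + 1) ^ (2 * k + 1) : ℕ) : ℝ)) := by
          gcongr
          exact sum_inv_pow_vertexCount_le_crude Finset.univ hV
      _ = _ := by
          push_cast
          rw [div_eq_mul_inv]
          ring

end PairCount

/-! ### Non-backtracking sums and the deformed Laplacian -/

section NonBacktrackingSums

variable {V : Type*} [Fintype V] [DecidableEq V]

/-- The sum of the weights of the typed words of `k` steps from `i` to `j`: a step along an edge has
weight `A`, a jump has weight `-p`, and two consecutive steps along edges do not backtrack. The
second argument is a vertex to which the first step must not run along an edge. -/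
def nbSumAvoiding (A : Matrix V V ℝ) (p : ℝ) : ℕ → Option V → V → V → ℝ
  | 0, _, i, j => if i = j then 1 else 0
  | k + 1, f, i, j => ∑ l, ((if f = some l then 0 else A i l) * nbSumAvoiding A p k (some i) l j -
      p * nbSumAvoiding A p k none l j)

/-- The matrix of the non-backtracking sums of `k` steps. -/
def nbSum (A : Matrix V V ℝ) (p : ℝ) (k : ℕ) : Matrix V V ℝ :=
  Matrix.of fun i j => nbSumAvoiding A p k none i j

/-- The part of the non-backtracking sums of `k + 1` steps which begins with a step along an edge. -/
def nbSumEdge (A : Matrix V V ℝ) (p : ℝ) (k : ℕ) : Matrix V V ℝ :=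
  Matrix.of fun i j => ∑ l, A i l * nbSumAvoiding A p k (some i) l j

variable {A : Matrix V V ℝ} {p : ℝ}

lemma nbSumAvoiding_some (k : ℕ) (f i j : V) : nbSumAvoiding A p (k + 1) (some f) i j =
    nbSum A p (k + 1) i j - A i f * nbSumAvoiding A p k (some i) f j := by
  simp only [nbSum, nbSumAvoiding, Matrix.of_apply]
  rw [eq_sub_iff_add_eq, ← Finset.sum_erase_add _ _ (Finset.mem_univ f),
    ← Finset.sum_erase_add (s := Finset.univ) (a := f) (h := Finset.mem_univ f) (f := fun l =>
      (if (none : Option V) = some l then 0 else A i l) * nbSumAvoiding A p k (some i) l j -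
      p * nbSumAvoiding A p k none l j)]
  rw [Finset.sum_congr rfl (g := fun l =>
      (if (none : Option V) = some l then 0 else A i l) * nbSumAvoiding A p k (some i) l j -
      p * nbSumAvoiding A p k none l j)]
  · simp
    ring
  · intro l hl
    have hne : l ≠ f := Finset.ne_of_mem_erase hl
    simp [hne.symm]

lemma nbSum_zero : nbSum A p 0 = 1 := by
  ext i j
  simp [nbSum, nbSumAvoiding, Matrix.one_apply]

lemma nbSum_succ (k : ℕ) : nbSum A p (k + 1) =
    nbSumEdge A p k - (p • Matrix.of fun _ _ => (1 : ℝ)) * nbSum A p k := by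
  ext i j
  simp [nbSum, nbSumEdge, nbSumAvoiding, Matrix.mul_apply, Finset.sum_sub_distrib]

lemma nbSumEdge_zero : nbSumEdge A p 0 = A := by
  ext i j
  simp [nbSumEdge, nbSumAvoiding]

lemma diagonal_mulVec_one_mul (A B : Matrix V V ℝ) (i j : V) :
    (Matrix.diagonal (A.mulVec 1) * B) i j = ∑ l, A i l * B i j := by
  rw [Matrix.diagonal_mul, Matrix.mulVec, dotProduct, Finset.sum_mul]
  simp

/-- Among the words of two steps that begin along an edge, those which run back along it are removed;
there are as many of them as the degree of the starting vertex. -/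
lemma nbSumEdge_one (hs : A.IsSymm) (h01 : ∀ i j, A i j * A i j = A i j) :
    nbSumEdge A p 1 = A * nbSum A p 1 - Matrix.diagonal (A.mulVec 1) := by
  ext i j
  rw [← mul_one (Matrix.diagonal (A.mulVec 1)), Matrix.sub_apply, diagonal_mulVec_one_mul,
    Matrix.mul_apply, ← Finset.sum_sub_distrib]
  simp only [nbSumEdge, Matrix.of_apply]
  apply Finset.sum_congr rfl
  intro l _
  rw [nbSumAvoiding_some, hs.apply i l, nbSumAvoiding, Matrix.one_apply]
  linear_combination -(if i = j then (1 : ℝ) else 0) * h01 i l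

/-- From all continuations of a first step along an edge, those whose second step runs back along it
are removed. Removing all words of `k + 1` steps from the starting vertex removes too much, namely
also the words that run along the same edge a third time, which the last term restores. -/
lemma nbSumEdge_succ_succ (hs : A.IsSymm) (h01 : ∀ i j, A i j * A i j = A i j) (k : ℕ) :
    nbSumEdge A p (k + 2) =
      A * nbSum A p (k + 2) - Matrix.diagonal (A.mulVec 1) * nbSum A p (k + 1) +
        nbSumEdge A p k := by
  ext i j
  rw [Matrix.add_apply, Matrix.sub_apply, diagonal_mulVec_one_mul, Matrix.mul_apply,
    ← Finset.sum_sub_distrib]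
  simp only [nbSumEdge, Matrix.of_apply]
  rw [← Finset.sum_add_distrib]
  apply Finset.sum_congr rfl
  intro l _
  rw [nbSumAvoiding_some, nbSumAvoiding_some, hs.apply i l]
  linear_combination (-(nbSum A p (k + 1) i j) + A i l * nbSumAvoiding A p k (some i) l j +
    nbSumAvoiding A p k (some i) l j) * h01 i l

/-- The deformed Laplacian of the graph, with a correction by the matrix of all `p`. -/
def deformedLaplacian (A : Matrix V V ℝ) (p t : ℝ) : Matrix V V ℝ :=
  (1 - t ^ 2) • (1 : Matrix V V ℝ) + t ^ 2 • Matrix.diagonal (A.mulVec 1) - t • A +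
    (t * (1 - t ^ 2)) • (p • Matrix.of fun _ _ => (1 : ℝ))

/-- What remains when the deformed Laplacian is multiplied by the generating function of the
non-backtracking sums, cut off after `k + 1` steps. -/
def laplacianTail (A : Matrix V V ℝ) (p t : ℝ) (k : ℕ) : Matrix V V ℝ :=
  -(t ^ (k + 2) • nbSum A p (k + 2)) +
    t ^ (k + 3) • ((Matrix.diagonal (A.mulVec 1) - 1) * nbSum A p (k + 1) -
      (p • Matrix.of fun _ _ => (1 : ℝ)) * nbSum A p k) -
    t ^ (k + 4) • ((p • Matrix.of fun _ _ => (1 : ℝ)) * nbSum A p (k + 1))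

/-- The non-backtracking sums invert the deformed Laplacian. -/
theorem deformedLaplacian_mul_sum (hs : A.IsSymm) (h01 : ∀ i j, A i j * A i j = A i j) (t : ℝ)
    (k : ℕ) :
    deformedLaplacian A p t * ∑ l ∈ Finset.range (k + 2), t ^ l • nbSum A p l =
      (1 - t ^ 2) • (1 : Matrix V V ℝ) + laplacianTail A p t k := by
  induction k with
  | zero =>
    have h1 : nbSum A p 1 = A - p • Matrix.of fun _ _ => (1 : ℝ) := by
      rw [nbSum_succ, nbSumEdge_zero, nbSum_zero, mul_one]
    have h2 := nbSum_succ (A := A) (p := p) 1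
    rw [nbSumEdge_one hs h01] at h2
    simp only [laplacianTail, zero_add, h2, Finset.sum_range_succ,
      Finset.sum_range_zero, nbSum_zero, deformedLaplacian]
    generalize Matrix.diagonal (A.mulVec 1) = D
    generalize (p • Matrix.of fun _ _ => (1 : ℝ) : Matrix V V ℝ) = P at *
    rw [h1]
    simp only [mul_add, add_mul, sub_mul, mul_sub, smul_mul_assoc, mul_smul_comm, one_mul, mul_one,
      smul_sub, smul_add, smul_smul, pow_zero, one_smul, pow_one]
    module
  | succ k ih =>
    rw [Finset.sum_range_succ, mul_add, ih]
    have h3 := nbSum_succ (A := A) (p := p) (k + 2)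
    have h1 := nbSum_succ (A := A) (p := p) k
    rw [nbSumEdge_succ_succ hs h01, eq_add_of_sub_eq h1.symm] at h3
    simp only [laplacianTail, deformedLaplacian, h3, show k + 1 + 2 = k + 2 + 1 from rfl,
      show k + 1 + 1 = k + 2 from rfl]
    generalize Matrix.diagonal (A.mulVec 1) = D
    generalize (p • Matrix.of fun _ _ => (1 : ℝ) : Matrix V V ℝ) = P at *
    simp only [add_mul, sub_mul, mul_sub, smul_mul_assoc, mul_smul_comm, one_mul, mul_one,
      smul_sub, smul_add, smul_smul]
    module

end NonBacktrackingSums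

/-! ### Operator norms and positivity -/

section Norms

variable {V : Type*} [Fintype V] [DecidableEq V]

/-- The operator norm is at most the Frobenius norm. -/
lemma norm_sq_le_sum_sq (M : Matrix V V ℝ) : ‖M‖ ^ 2 ≤ ∑ i, ∑ j, M i j ^ 2 := by
  have h0 : 0 ≤ ∑ i, ∑ j, M i j ^ 2 :=
    Finset.sum_nonneg fun i _ => Finset.sum_nonneg fun j _ => sq_nonneg _
  have h : ‖M‖ ≤ Real.sqrt (∑ i, ∑ j, M i j ^ 2) := by
    rw [Matrix.cstar_norm_def]
    apply ContinuousLinearMap.opNorm_le_bound _ (Real.sqrt_nonneg _)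
    intro x
    rw [EuclideanSpace.norm_eq, EuclideanSpace.norm_eq, ← Real.sqrt_mul h0]
    apply Real.sqrt_le_sqrt
    rw [Finset.sum_mul]
    apply Finset.sum_le_sum
    intro i _
    simp only [Matrix.ofLp_toEuclideanCLM, Matrix.mulVec, dotProduct, Real.norm_eq_abs, sq_abs]
    exact Finset.sum_mul_sq_le_sq_mul_sq _ _ _
  calc ‖M‖ ^ 2 ≤ Real.sqrt (∑ i, ∑ j, M i j ^ 2) ^ 2 := by gcongr
    _ = _ := Real.sq_sqrt h0

lemma norm_pow_le_of_isSelfAdjoint {E : Type*} [NormedRing E] [StarRing E] [CStarRing E] {x : E}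
    (hx : IsSelfAdjoint x) (m : ℕ) (hm : 0 < m) : ‖x‖ ^ m ≤ ‖x ^ m‖ := by
  rcases (norm_nonneg x).eq_or_lt with h0 | h0
  · rw [← h0, zero_pow hm.ne']
    positivity
  have h1 := hx.norm_pow_two_pow m
  have h2 : m < 2 ^ m := Nat.lt_two_pow_self
  have h3 : ‖x ^ 2 ^ m‖ ≤ ‖x ^ m‖ * ‖x‖ ^ (2 ^ m - m) := by
    rw [← Nat.add_sub_cancel' h2.le, pow_add, Nat.add_sub_cancel_left]
    exact (norm_mul_le _ _).trans (by gcongr; exact norm_pow_le' _ (by omega))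
  rw [h1] at h3
  have h4 : ‖x‖ ^ 2 ^ m = ‖x‖ ^ m * ‖x‖ ^ (2 ^ m - m) := by
    rw [← pow_add, Nat.add_sub_cancel' h2.le]
  rw [h4] at h3
  exact le_of_mul_le_mul_right h3 (by positivity)

/-- The trace method bound, for even powers of a symmetric matrix. -/
lemma norm_pow_le_trace {Z : Matrix V V ℝ} (hZ : Z.IsSymm) (m : ℕ) (hm : 0 < m) :
    ‖Z‖ ^ (2 * m) ≤ (Z ^ (2 * m)).trace := by
  have hsa : IsSelfAdjoint Z := by
    rw [isSelfAdjoint_iff, Matrix.star_eq_conjTranspose,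
      Matrix.conjTranspose_eq_transpose_of_trivial]
    exact hZ
  have hs : (Z ^ m).IsSymm := hZ.pow m
  calc ‖Z‖ ^ (2 * m) = (‖Z‖ ^ m) ^ 2 := by rw [mul_comm, pow_mul]
    _ ≤ ‖Z ^ m‖ ^ 2 := by
      gcongr
      exact norm_pow_le_of_isSelfAdjoint hsa m hm
    _ ≤ ∑ i, ∑ j, (Z ^ m) i j ^ 2 := norm_sq_le_sum_sq _
    _ = (Z ^ (2 * m)).trace := by
      rw [two_mul, pow_add, Matrix.trace]
      apply Finset.sum_congr rfl
      intro i _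
      rw [Matrix.diag_apply, Matrix.mul_apply]
      apply Finset.sum_congr rfl
      intro j _
      rw [hs.apply i j, sq]

/-- A continuous family of symmetric matrices which starts positive definite stays so as long as it
stays invertible. -/
theorem posDef_of_det_ne_zero {M : ℝ → Matrix V V ℝ} (hM : Continuous M)
    (hs : ∀ t, (M t).IsSymm) {u : ℝ} (hu : 0 ≤ u) (h0 : (M 0).PosDef)
    (hdet : ∀ t ∈ Set.Icc 0 u, (M t).det ≠ 0) : (M u).PosDef := by
  have hH : ∀ t, (M t).IsHermitian := fun t => by
    rw [Matrix.IsHermitian, Matrix.conjTranspose_eq_transpose_of_trivial]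
    exact hs t
  let q : ℝ × EuclideanSpace ℝ V → ℝ := fun z => z.2.ofLp ⬝ᵥ (M z.1).mulVec z.2.ofLp
  have hq : Continuous q := by
    have h1 : Continuous fun z : ℝ × EuclideanSpace ℝ V => z.2.ofLp := by fun_prop
    exact h1.dotProduct ((hM.comp continuous_fst).matrix_mulVec h1)
  by_contra hcon
  let C := (Set.Icc 0 u ×ˢ Metric.sphere (0 : EuclideanSpace ℝ V) 1) ∩ q ⁻¹' Set.Iic 0
  have hC : IsCompact C :=
    (isCompact_Icc.prod (isCompact_sphere _ _)).inter_right (isClosed_Iic.preimage hq)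
  have mem_of : ∀ t ∈ Set.Icc 0 u, ¬ (M t).PosDef → ∃ x, (t, x) ∈ C := by
    intro t ht hn
    have : ∃ y : V → ℝ, y ≠ 0 ∧ y ⬝ᵥ (M t).mulVec y ≤ 0 := by
      by_contra hno
      push Not at hno
      apply hn
      apply Matrix.PosDef.of_dotProduct_mulVec_pos (hH t)
      intro x hx
      simpa using hno x hx
    obtain ⟨y, hy, hle⟩ := this
    have hy' : WithLp.toLp 2 y ≠ (0 : EuclideanSpace ℝ V) := by
      intro h
      exact hy (by simpa using congrArg WithLp.ofLp h)
    refine ⟨‖WithLp.toLp 2 y‖⁻¹ • WithLp.toLp 2 y, ⟨ht, ?_⟩, ?_⟩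
    · rw [mem_sphere_zero_iff_norm, norm_smul, norm_inv, norm_norm, inv_mul_cancel₀]
      exact norm_ne_zero_iff.2 hy'
    · simp only [q, Set.mem_preimage, Set.mem_Iic, WithLp.ofLp_smul, Matrix.mulVec_smul,
        dotProduct_smul, smul_dotProduct, smul_eq_mul]
      have : 0 ≤ ‖WithLp.toLp 2 y‖⁻¹ := by positivity
      exact mul_nonpos_of_nonneg_of_nonpos this (mul_nonpos_of_nonneg_of_nonpos this hle)
  have hne : C.Nonempty := by
    obtain ⟨x, hx⟩ := mem_of u ⟨hu, le_rfl⟩ hcon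
    exact ⟨_, hx⟩
  -- at the first time at which the form is not positive definite it is positive semidefinite
  obtain ⟨⟨t, x⟩, hmem, hmin⟩ := hC.exists_isMinOn hne continuous_fst.continuousOn
  obtain ⟨⟨ht, hx⟩, hle⟩ := hmem
  have hx0 : x.ofLp ≠ 0 := by
    intro h
    have : x = 0 := by ext i; exact congrFun h i
    rw [mem_sphere_zero_iff_norm, this, norm_zero] at hx
    exact zero_ne_one hx
  have ht0 : t ≠ 0 := by
    rintro rfl
    have := h0.dotProduct_mulVec_pos hx0
    simp only [star_trivial] at this
    exact absurd hle (not_le.2 this)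
  have htpos : 0 < t := lt_of_le_of_ne ht.1 ht0.symm
  have hpsd : (M t).PosSemidef := by
    apply Matrix.PosSemidef.of_dotProduct_mulVec_nonneg (hH t)
    intro y
    rw [star_trivial]
    have hc : Continuous fun a => y ⬝ᵥ (M a).mulVec y :=
      continuous_const.dotProduct (hM.matrix_mulVec continuous_const)
    have hmemcl : t ∈ closure (Set.Ico 0 t) := by
      rw [closure_Ico ht0.symm]
      exact ⟨ht.1, le_rfl⟩
    refine closure_minimal (s := Set.Ico 0 t) (t := {a | 0 ≤ y ⬝ᵥ (M a).mulVec y}) ?_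
      (isClosed_le continuous_const hc) hmemcl
    intro a ha
    have hpd : (M a).PosDef := by
      by_contra hn
      obtain ⟨z, hz⟩ := mem_of a ⟨ha.1, ha.2.le.trans ht.2⟩ hn
      exact absurd (hmin hz) (not_le.2 ha.2)
    have := hpd.posSemidef.dotProduct_mulVec_nonneg y
    simpa using this
  have hzero : star x.ofLp ⬝ᵥ (M t).mulVec x.ofLp = 0 := by
    apply le_antisymm
    · simpa using hle
    · exact hpsd.dotProduct_mulVec_nonneg _
  rw [hpsd.dotProduct_mulVec_zero_iff] at hzero
  exact hdet t ht (Matrix.exists_mulVec_eq_zero_iff.1 ⟨x.ofLp, hx0, hzero⟩)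

end Norms

section Deterministic

variable {V : Type*} [Fintype V] [DecidableEq V]

lemma norm_smul_ones_le {p : ℝ} (hp : 0 ≤ p) :
    ‖(p • Matrix.of fun _ _ => (1 : ℝ) : Matrix V V ℝ)‖ ≤ p * Fintype.card V := by
  refine abs_le_of_sq_le_sq' ?_ (by positivity) |>.2
  refine (norm_sq_le_sum_sq _).trans ?_
  simp
  apply le_of_eq
  ring

/-- If the non-backtracking sums of three consecutive lengths are small, then the deformed Laplacian
is positive definite. -/
theorem posDef_deformedLaplacian {A : Matrix V V ℝ} (hs : A.IsSymm)
    (h01 : ∀ i j, A i j * A i j = A i j) {p d u Δ ε : ℝ} (hp : 0 ≤ p)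
    (hpd : p * Fintype.card V ≤ d) (hu0 : 0 ≤ u) (hu1 : u < 1) (hΔ : 1 ≤ Δ)
    (hdeg : ∀ i, A.mulVec 1 i ≤ Δ) (k : ℕ)
    (hY : ∀ l, k ≤ l → l ≤ k + 2 → u ^ l * ‖nbSum A p l‖ ≤ ε)
    (hε : ε * (1 + Δ + 2 * d) < 1 - u ^ 2) :
    (deformedLaplacian A p u).PosDef := by
  have hsymm : ∀ t, (deformedLaplacian A p t).IsSymm := by
    intro t
    unfold deformedLaplacian
    refine ((((Matrix.isSymm_one.smul _).add ((Matrix.isSymm_diagonal _).smul _)).sub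
      (hs.smul _)).add (Matrix.IsSymm.smul (Matrix.IsSymm.smul ?_ _) _))
    exact Matrix.IsSymm.ext fun _ _ => rfl
  apply posDef_of_det_ne_zero (M := deformedLaplacian A p) ?_ hsymm hu0
  · simp only [deformedLaplacian]
    simp only [ne_eq, OfNat.ofNat_ne_zero, not_false_eq_true, zero_pow, sub_zero, one_smul,
      zero_smul, add_zero, zero_mul]
    exact Matrix.PosDef.one
  · intro t ht
    obtain ⟨ht0, htu⟩ := ht
    have hP := norm_smul_ones_le (V := V) hp
    -- the degrees are nonnegative and `1 ≤ Δ`, so that subtracting one does no harm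
    have hD : ‖(Matrix.diagonal (A.mulVec 1) - 1 : Matrix V V ℝ)‖ ≤ Δ := by
      rw [← Matrix.diagonal_one, Matrix.diagonal_sub, Matrix.l2_opNorm_diagonal]
      rw [pi_norm_le_iff_of_nonneg (by linarith)]
      intro i
      have h0 : 0 ≤ A.mulVec 1 i := by
        rw [Matrix.mulVec, dotProduct]
        apply Finset.sum_nonneg
        intro j _
        rw [← h01, Pi.one_apply, mul_one]
        exact mul_self_nonneg _
      have h1 := hdeg i
      rw [Real.norm_eq_abs, abs_le]
      constructor <;> linarith
    have hYt : ∀ l, k ≤ l → l ≤ k + 2 → ∀ m, l ≤ m → t ^ m * ‖nbSum A p l‖ ≤ ε := by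
      intro l h1 h2 m hm
      refine le_trans ?_ (hY l h1 h2)
      have : t ^ m ≤ u ^ l := by
        calc t ^ m ≤ t ^ l := pow_le_pow_of_le_one ht0 (by linarith) hm
          _ ≤ u ^ l := by gcongr
      gcongr
    have htail : ‖laplacianTail A p t k‖ < 1 - t ^ 2 := by
      have hε0 : 0 ≤ ε := le_trans (by positivity) (hY k le_rfl (by omega))
      have b1 : ‖t ^ (k + 2) • nbSum A p (k + 2)‖ ≤ ε := by
        rw [norm_smul, Real.norm_eq_abs, abs_of_nonneg (by positivity)]
        exact hYt _ (by omega) (by omega) _ le_rfl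
      have b2 : ‖t ^ (k + 3) • ((Matrix.diagonal (A.mulVec 1) - 1) * nbSum A p (k + 1) -
          (p • Matrix.of fun _ _ => (1 : ℝ)) * nbSum A p k)‖ ≤ Δ * ε + d * ε := by
        rw [norm_smul, Real.norm_eq_abs, abs_of_nonneg (by positivity)]
        calc _ ≤ t ^ (k + 3) * (Δ * ‖nbSum A p (k + 1)‖ + d * ‖nbSum A p k‖) := by
              gcongr
              refine (norm_sub_le _ _).trans (add_le_add ?_ ?_)
              · exact (norm_mul_le _ _).trans (by gcongr)
              · exact (norm_mul_le _ _).trans (by gcongr; exact hP.trans hpd)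
          _ = Δ * (t ^ (k + 3) * ‖nbSum A p (k + 1)‖) + d * (t ^ (k + 3) * ‖nbSum A p k‖) := by
              ring
          _ ≤ Δ * ε + d * ε := by
              have hd : 0 ≤ d := le_trans (by positivity) hpd
              gcongr
              · exact hYt _ (by omega) (by omega) _ (by omega)
              · exact hYt _ (by omega) (by omega) _ (by omega)
      have b3 : ‖t ^ (k + 4) • ((p • Matrix.of fun _ _ => (1 : ℝ)) * nbSum A p (k + 1))‖ ≤
          d * ε := by
        rw [norm_smul, Real.norm_eq_abs, abs_of_nonneg (by positivity)]
        calc _ ≤ t ^ (k + 4) * (d * ‖nbSum A p (k + 1)‖) := by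
              gcongr
              exact (norm_mul_le _ _).trans (by gcongr; exact hP.trans hpd)
          _ = d * (t ^ (k + 4) * ‖nbSum A p (k + 1)‖) := by ring
          _ ≤ d * ε := by
              have hd : 0 ≤ d := le_trans (by positivity) hpd
              gcongr
              exact hYt _ (by omega) (by omega) _ (by omega)
      have b0 : ‖laplacianTail A p t k‖ ≤ ε + (Δ * ε + d * ε) + d * ε := by
        unfold laplacianTail
        refine (norm_sub_le _ _).trans (add_le_add ((norm_add_le _ _).trans (add_le_add ?_ b2)) b3)
        rwa [norm_neg]
      have : t ^ 2 ≤ u ^ 2 := by gcongr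
      nlinarith
    have hpos : 0 < 1 - t ^ 2 := by
      have : t ^ 2 ≤ u ^ 2 := by gcongr
      nlinarith
    -- a Neumann series inverts the right-hand side of `deformedLaplacian_mul_sum`
    have hunit : IsUnit ((1 - t ^ 2) • (1 : Matrix V V ℝ) + laplacianTail A p t k) := by
      have h1 : ‖-((1 - t ^ 2)⁻¹ • laplacianTail A p t k)‖ < 1 := by
        rw [norm_neg, norm_smul, norm_inv, Real.norm_eq_abs, abs_of_pos hpos,
          inv_mul_lt_iff₀ hpos, mul_one]
        exact htail
      have : CompleteSpace (Matrix V V ℝ) := FiniteDimensional.complete ℝ _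
      have h2 := isUnit_one_sub_of_norm_lt_one h1
      have h3 : (1 - t ^ 2) • (1 : Matrix V V ℝ) + laplacianTail A p t k =
          (1 - t ^ 2) • (1 - -((1 - t ^ 2)⁻¹ • laplacianTail A p t k)) := by
        rw [sub_neg_eq_add, smul_add, smul_smul, mul_inv_cancel₀ hpos.ne', one_smul]
      rw [h3]
      exact h2.smul (Units.mk0 _ hpos.ne')
    rw [← deformedLaplacian_mul_sum hs h01, Matrix.isUnit_iff_isUnit_det, Matrix.det_mul] at hunit
    exact (isUnit_of_mul_isUnit_left hunit).ne_zero
  · unfold deformedLaplacian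
    fun_prop

end Deterministic

/-! ### Sums over typed words -/

section TypedSums

variable {V : Type*}

/-- The weight of the first `k` steps of a typed word. -/
def wordWeight (A : Matrix V V ℝ) (p : ℝ) (k : ℕ) (w : ℕ → V) (τ : ℕ → Bool) : ℝ :=
  ∏ t ∈ Finset.range k, if τ t then A (w t) (w (t + 1)) else -p

/-- Two consecutive steps along edges do not backtrack. -/
def NoBacktrack (k : ℕ) (w : ℕ → V) (τ : ℕ → Bool) : Prop :=
  ∀ t, t + 2 ≤ k → τ t = true → τ (t + 1) = true → w t ≠ w (t + 2)

/-- The first `k` steps of the word are self-avoiding. -/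
def SelfAvoiding (k : ℕ) (w : ℕ → V) : Prop := ∀ a c, a < c → c ≤ k → w a ≠ w c

variable {A : Matrix V V ℝ} {p : ℝ}

lemma extend_cons_zero {k : ℕ} (i : V) (w : Fin (k + 1) → V) :
    extend (N := k + 1) (Fin.cons i w : Fin (k + 2) → V) 0 = i := by
  simp [extend]

lemma extend_cons_succ {k : ℕ} (i : V) (w : Fin (k + 1) → V) (t : ℕ) :
    extend (N := k + 1) (Fin.cons i w : Fin (k + 2) → V) (t + 1) = extend w t := by
  unfold extend
  have : (⟨min (t + 1) (k + 1), by omega⟩ : Fin (k + 2)) = Fin.succ ⟨min t k, by omega⟩ := by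
    ext
    simp
  rw [this, Fin.cons_succ]

lemma extendType_cons_zero {k : ℕ} (b : Bool) (τ : Fin k → Bool) :
    extendType (N := k + 1) (Fin.cons b τ : Fin (k + 1) → Bool) 0 = b := by
  simp [extendType]

lemma extendType_cons_succ {k : ℕ} (b : Bool) (τ : Fin k → Bool) (t : ℕ) :
    extendType (N := k + 1) (Fin.cons b τ : Fin (k + 1) → Bool) (t + 1) = extendType τ t := by
  unfold extendType
  by_cases h : t < k
  · rw [dif_pos h, dif_pos (by omega)]
    exact Fin.cons_succ (α := fun _ => Bool) b τ ⟨t, h⟩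
  · rw [dif_neg h, dif_neg (by omega)]

lemma noBacktrack_cons {k : ℕ} (f : Option V) (i : V) (w : Fin (k + 1) → V) (b : Bool)
    (τ : Fin k → Bool) :
    (NoBacktrack (k + 1) (extend (N := k + 1) (Fin.cons i w : Fin (k + 2) → V))
        (extendType (N := k + 1) (Fin.cons b τ : Fin (k + 1) → Bool)) ∧
      (0 < k + 1 → extendType (N := k + 1) (Fin.cons b τ : Fin (k + 1) → Bool) 0 = true →
        f ≠ some (extend (N := k + 1) (Fin.cons i w : Fin (k + 2) → V) 1))) ↔
    (NoBacktrack k (extend w) (extendType τ) ∧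
      (0 < k → extendType τ 0 = true → (if b then some i else none) ≠ some (extend w 1))) ∧
      (b = true → f ≠ some (extend w 0)) := by
  have e1 : extend (N := k + 1) (Fin.cons i w : Fin (k + 2) → V) 1 = extend w 0 :=
    extend_cons_succ i w 0
  rw [extendType_cons_zero, e1]
  constructor
  · rintro ⟨h1, h2⟩
    refine ⟨⟨?_, ?_⟩, h2 (by omega)⟩
    · intro t ht a b
      have := h1 (t + 1) (by omega)
      rw [extendType_cons_succ, extendType_cons_succ, extend_cons_succ, extend_cons_succ] at this
      exact this a b
    · intro hk h0
      cases b
      · simp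
      · have := h1 0 (by omega)
        rw [extendType_cons_zero, extendType_cons_succ, extend_cons_zero, extend_cons_succ] at this
        simpa using this rfl h0
  · rintro ⟨⟨h1, h2⟩, h3⟩
    refine ⟨?_, fun _ => h3⟩
    intro t ht
    rcases t with _ | t
    · rw [extendType_cons_zero, extendType_cons_succ, extend_cons_zero, extend_cons_succ]
      intro hb h0
      have := h2 (by omega) h0
      rw [hb] at this
      simpa using this
    · rw [extendType_cons_succ, extendType_cons_succ, extend_cons_succ, extend_cons_succ]
      exact h1 t (by omega)

lemma wordWeight_cons {k : ℕ} (i : V) (w : Fin (k + 1) → V) (b : Bool) (τ : Fin k → Bool) :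
    wordWeight A p (k + 1) (extend (N := k + 1) (Fin.cons i w : Fin (k + 2) → V))
      (extendType (N := k + 1) (Fin.cons b τ : Fin (k + 1) → Bool)) =
    (if b then A i (extend w 0) else -p) * wordWeight A p k (extend w) (extendType τ) := by
  unfold wordWeight
  rw [Finset.prod_range_succ', mul_comm]
  simp only [extendType_cons_succ, extend_cons_succ, extendType_cons_zero, extend_cons_zero]

variable [Fintype V] [DecidableEq V]

open Classical in
/-- The sum of the weights of the typed words of `k` steps from `i` to `j` with a given property. -/
noncomputable def typedSum (A : Matrix V V ℝ) (p : ℝ) (k : ℕ) (P : (ℕ → V) → (ℕ → Bool) → Prop) :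
    Matrix V V ℝ :=
  Matrix.of fun i j => ∑ x : (Fin (k + 1) → V) × (Fin k → Bool),
    if extend x.1 0 = i ∧ extend x.1 k = j ∧ P (extend x.1) (extendType x.2) then
      wordWeight A p k (extend x.1) (extendType x.2) else 0

open Classical in
/-- The recursively defined non-backtracking sums are sums over typed words. -/
lemma nbSumAvoiding_eq_sum (k : ℕ) (f : Option V) (i j : V) : nbSumAvoiding A p k f i j =
    ∑ x : (Fin (k + 1) → V) × (Fin k → Bool),
      if extend x.1 0 = i ∧ extend x.1 k = j ∧ (NoBacktrack k (extend x.1) (extendType x.2) ∧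
        (0 < k → extendType x.2 0 = true → f ≠ some (extend x.1 1))) then
      wordWeight A p k (extend x.1) (extendType x.2) else 0 := by
  induction k generalizing f i with
  | zero =>
    simp only [nbSumAvoiding, wordWeight, Finset.range_zero, Finset.prod_empty]
    rw [Fintype.sum_prod_type]
    simp only [lt_irrefl, IsEmpty.forall_iff, and_true, NoBacktrack]
    rw [Finset.sum_congr rfl (g := fun w : Fin 1 → V => if w 0 = i ∧ w 0 = j then (1 : ℝ) else 0)]
    · rw [Fintype.sum_equiv (Equiv.funUnique (Fin 1) V) _
        (fun v => if v = i ∧ v = j then (1 : ℝ) else 0) (fun w => by simp)]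
      by_cases hij : i = j
      · subst hij
        simp
      · rw [if_neg hij, Finset.sum_eq_zero]
        intro v _
        rw [if_neg]
        rintro ⟨rfl, rfl⟩
        exact hij rfl
    · intro w _
      simp [extend]
  | succ k ih =>
    have e : ∑ x : (Fin (k + 2) → V) × (Fin (k + 1) → Bool),
        (if extend (N := k + 1) x.1 0 = i ∧ extend (N := k + 1) x.1 (k + 1) = j ∧
          (NoBacktrack (k + 1) (extend (N := k + 1) x.1) (extendType x.2) ∧
          (0 < k + 1 → extendType x.2 0 = true → f ≠ some (extend (N := k + 1) x.1 1))) then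
          wordWeight A p (k + 1) (extend (N := k + 1) x.1) (extendType x.2) else 0) =
        ∑ y : (V × (Fin (k + 1) → V)) × (Bool × (Fin k → Bool)),
          (if y.1.1 = i ∧ extend y.1.2 k = j ∧ ((NoBacktrack k (extend y.1.2) (extendType y.2.2) ∧
            (0 < k → extendType y.2.2 0 = true →
              (if y.2.1 then some y.1.1 else none) ≠ some (extend y.1.2 1))) ∧
            (y.2.1 = true → f ≠ some (extend y.1.2 0))) then
          (if y.2.1 then A y.1.1 (extend y.1.2 0) else -p) *
            wordWeight A p k (extend y.1.2) (extendType y.2.2) else 0) := by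
      symm
      apply Fintype.sum_equiv ((Fin.consEquiv (fun _ : Fin (k + 2) => V)).prodCongr
        (Fin.consEquiv (fun _ : Fin (k + 1) => Bool)))
      rintro ⟨⟨i', w⟩, ⟨b, τ⟩⟩
      have c1 : Fin.consEquiv (fun _ : Fin (k + 2) => V) (i', w) = Fin.cons i' w := rfl
      have c2 : Fin.consEquiv (fun _ : Fin (k + 1) => Bool) (b, τ) = Fin.cons b τ := rfl
      simp only [Equiv.prodCongr_apply, Prod.map_apply, c1, c2]
      rw [extend_cons_zero, extend_cons_succ, wordWeight_cons]
      exact if_congr (and_congr Iff.rfl (and_congr Iff.rfl (noBacktrack_cons f i' w b τ).symm))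
        rfl rfl
    rw [e, Fintype.sum_prod_type, Fintype.sum_prod_type, Finset.sum_eq_single i]
    · simp only [nbSumAvoiding, ih, Finset.mul_sum, ← Finset.sum_sub_distrib]
      rw [Finset.sum_comm, Fintype.sum_prod_type]
      apply Finset.sum_congr rfl
      intro w _
      rw [Fintype.sum_prod_type, Fintype.sum_bool, ← Finset.sum_add_distrib]
      apply Finset.sum_congr rfl
      intro τ _
      rw [Finset.sum_eq_single (extend w 0)]
      · by_cases hf : f = some (extend w 0)
        · simp [hf, neg_ite]
        · simp [hf, sub_eq_add_neg, neg_ite]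
      · intro l _ hl
        simp [hl.symm]
      · simp
    · intro b _ hb
      apply Finset.sum_eq_zero
      intro w _
      apply Finset.sum_eq_zero
      intro y _
      simp [hb]
    · simp

/-- The non-backtracking sum splits into the words which are self-avoiding and those which are
not. -/
theorem nbSum_eq_add (k : ℕ) : nbSum A p k = typedSum A p k (fun w _ => SelfAvoiding k w) +
    typedSum A p k (fun w τ => NoBacktrack k w τ ∧ ¬ SelfAvoiding k w) := by
  classical
  ext i j
  rw [Matrix.add_apply]
  simp only [nbSum, typedSum, Matrix.of_apply]
  rw [nbSumAvoiding_eq_sum, ← Finset.sum_add_distrib]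
  apply Finset.sum_congr rfl
  rintro ⟨w, τ⟩ _
  by_cases h : SelfAvoiding k (extend w)
  · have : NoBacktrack k (extend w) (extendType τ) := fun t ht _ _ => h t (t + 2) (by omega) ht
    simp [h, this]
  · simp [h]

/-- The weights of the words of all types add up to the weight of the centred matrix. -/
theorem typedSum_eq_sum_prod (k : ℕ) (P : (ℕ → V) → Prop) [DecidablePred P] (i j : V) :
    typedSum A p k (fun w _ => P w) i j = ∑ w : Fin (k + 1) → V,
      if extend w 0 = i ∧ extend w k = j ∧ P (extend w) then
        ∏ t ∈ Finset.range k, (A (extend w t) (extend w (t + 1)) - p) else 0 := by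
  classical
  simp only [typedSum, Matrix.of_apply]
  rw [Fintype.sum_prod_type]
  apply Finset.sum_congr rfl
  intro w _
  by_cases h : extend w 0 = i ∧ extend w k = j ∧ P (extend w)
  · simp only [if_pos h]
    have h1 : ∏ t ∈ Finset.range k, (A (extend w t) (extend w (t + 1)) - p) =
        ∏ t : Fin k, ∑ b : Bool, (if b then A (extend w t) (extend w (t + 1)) else -p) := by
      rw [Finset.prod_range]
      apply Finset.prod_congr rfl
      intro t _
      simp [sub_eq_add_neg]
    rw [h1, Finset.prod_univ_sum, Fintype.piFinset_univ]
    apply Finset.sum_congr rfl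
    intro τ _
    rw [wordWeight, Finset.prod_range]
    apply Finset.prod_congr rfl
    intro t _
    simp [extendType]
  · simp only [if_neg h, Finset.sum_const_zero]

end TypedSums

section Concatenation

lemma extend_min {V : Type*} {N : ℕ} (ω : Fin (N + 1) → V) (t : ℕ) :
    extend ω (min t N) = extend ω t := by
  simp [extend]

variable {V : Type*} [Fintype V] [DecidableEq V] {A : Matrix V V ℝ} {p : ℝ}

lemma typedSum_congr {k : ℕ} {P Q : (ℕ → V) → (ℕ → Bool) → Prop}
    (h : ∀ (ω : Fin (k + 1) → V) (τ : Fin k → Bool),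
      P (extend ω) (extendType τ) ↔ Q (extend ω) (extendType τ)) :
    typedSum A p k P = typedSum A p k Q := by
  classical
  ext i j
  simp only [typedSum, Matrix.of_apply, h]

/-- Products of sums over words are sums over concatenated words. -/
theorem typedSum_mul (a b : ℕ) (P Q : (ℕ → V) → (ℕ → Bool) → Prop) :
    typedSum A p a P * typedSum A p b Q = typedSum A p (a + b) (fun w τ =>
      P (fun t => w (min t a)) (fun t => if t < a then τ t else false) ∧
      Q (fun t => w (a + t)) (fun t => τ (a + t))) := by
  classical
  ext i j
  rw [Matrix.mul_apply]
  simp only [typedSum, Matrix.of_apply, Finset.sum_mul_sum]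
  rw [Finset.sum_comm]
  simp only [Finset.sum_comm (s := (Finset.univ : Finset V))]
  rw [← Fintype.sum_prod_type']
  have e1 : ∀ z : ((Fin (a + 1) → V) × (Fin a → Bool)) × ((Fin (b + 1) → V) × (Fin b → Bool)),
      ∑ l, (if extend z.1.1 0 = i ∧ extend z.1.1 a = l ∧ P (extend z.1.1) (extendType z.1.2) then
          wordWeight A p a (extend z.1.1) (extendType z.1.2) else 0) *
        (if extend z.2.1 0 = l ∧ extend z.2.1 b = j ∧ Q (extend z.2.1) (extendType z.2.2) then
          wordWeight A p b (extend z.2.1) (extendType z.2.2) else 0) =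
      if extend z.1.1 a = extend z.2.1 0 then
        (if extend z.1.1 0 = i ∧ extend z.2.1 b = j ∧ P (extend z.1.1) (extendType z.1.2) ∧
            Q (extend z.2.1) (extendType z.2.2) then
          wordWeight A p a (extend z.1.1) (extendType z.1.2) *
          wordWeight A p b (extend z.2.1) (extendType z.2.2) else 0) else 0 := by
    intro z
    rw [Finset.sum_eq_single (extend z.1.1 a)]
    · by_cases h : extend z.1.1 a = extend z.2.1 0
      · rw [if_pos h]
        by_cases h1 : extend z.1.1 0 = i <;> by_cases h2 : extend z.2.1 b = j <;>
          by_cases h3 : P (extend z.1.1) (extendType z.1.2) <;>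
          by_cases h4 : Q (extend z.2.1) (extendType z.2.2) <;> simp [h1, h2, h3, h4, h]
      · rw [if_neg h, if_neg (c := extend z.2.1 0 = extend z.1.1 a ∧ _), mul_zero]
        rintro ⟨h1, -⟩
        exact h h1.symm
    · intro l _ hl
      rw [if_neg, zero_mul]
      rintro ⟨-, h1, -⟩
      exact hl h1.symm
    · simp
  rw [Finset.sum_congr rfl (fun z _ => e1 z), ← Finset.sum_filter]
  symm
  have r1 : ∀ ω : Fin (a + b + 1) → V,
      extend (fun t : Fin (a + 1) => extend ω t) = fun t => extend ω (min t a) := by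
    intro ω
    rfl
  have r2 : ∀ ω : Fin (a + b + 1) → V,
      extend (fun t : Fin (b + 1) => extend ω (a + t)) = fun t => extend ω (a + t) := by
    intro ω
    funext t
    change extend ω (a + min t b) = extend ω (a + t)
    rw [← extend_min ω (a + t), Nat.add_min_add_left]
  have r3 : ∀ τ : Fin (a + b) → Bool,
      extendType (fun t : Fin a => extendType τ t) =
        fun t => if t < a then extendType τ t else false := by
    intro τ
    rfl
  have r4 : ∀ τ : Fin (a + b) → Bool,
      extendType (fun t : Fin b => extendType τ (a + t)) = fun t => extendType τ (a + t) := by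
    intro τ
    funext t
    unfold extendType
    by_cases h : t < b
    · simp [h]
    · simp [h]
  refine Finset.sum_nbij'
    (fun z => (((fun t : Fin (a + 1) => extend z.1 t), fun t : Fin a => extendType z.2 t),
      ((fun t : Fin (b + 1) => extend z.1 (a + t)), fun t : Fin b => extendType z.2 (a + t))))
    (fun y => ((fun t : Fin (a + b + 1) => if (t : ℕ) ≤ a then extend y.1.1 t
        else extend y.2.1 (t - a)),
      fun t : Fin (a + b) => if (t : ℕ) < a then extendType y.1.2 t
        else extendType y.2.2 (t - a))) ?_ ?_ ?_ ?_ ?_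
  · intro z _
    rw [Finset.mem_filter]
    refine ⟨Finset.mem_univ _, ?_⟩
    rw [r1, r2]
    simp
  · intro y _
    exact Finset.mem_univ _
  · rintro ⟨ω, τ⟩ _
    refine Prod.ext (funext fun t => ?_) (funext fun t => ?_)
    · simp only [r1, r2]
      split_ifs with h
      · rw [min_eq_left h, extend_of_le ω (by omega)]
      · rw [Nat.add_sub_cancel' (Nat.le_of_not_le h), extend_of_le ω (by have := t.2; omega)]
    · simp only [r3, r4]
      split_ifs with h
      · simp only [extendType, t.2, dite_true]
      · rw [Nat.add_sub_cancel' (Nat.le_of_not_lt h)]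
        simp only [extendType, t.2, dite_true]
  · rintro ⟨⟨ω, τ⟩, ⟨ω', τ'⟩⟩ hy
    rw [Finset.mem_filter] at hy
    have hm : extend ω a = extend ω' 0 := hy.2
    refine Prod.ext (Prod.ext (funext fun t => ?_) (funext fun t => ?_))
      (Prod.ext (funext fun t => ?_) (funext fun t => ?_))
    · have := t.2
      simp only
      rw [extend_of_le _ (by omega)]
      simp only
      rw [if_pos (by omega), extend_of_le _ (by omega)]
    · have := t.2
      simp only [extendType]
      rw [dif_pos (by omega), if_pos (by omega), dif_pos (by omega)]
    · have := t.2
      simp only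
      rw [extend_of_le _ (by omega)]
      simp only
      split_ifs with h
      · have ht : (t : ℕ) = 0 := by omega
        rw [ht, add_zero, hm, extend_of_le _ (by omega)]
        congr 1
        ext
        simp [ht]
      · rw [Nat.add_sub_cancel_left, extend_of_le _ (by omega)]
    · have := t.2
      simp only [extendType]
      rw [dif_pos (by omega), if_neg (by omega), dif_pos (by omega)]
      simp
  · intro z _
    simp only [r1, r2, r3, r4]
    have hw : wordWeight A p (a + b) (extend z.1) (extendType z.2) =
        wordWeight A p a (fun t => extend z.1 (min t a))
          (fun t => if t < a then extendType z.2 t else false) *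
        wordWeight A p b (fun t => extend z.1 (a + t)) (fun t => extendType z.2 (a + t)) := by
      unfold wordWeight
      rw [Finset.prod_range_add]
      congr 1
      apply Finset.prod_congr rfl
      intro t ht
      rw [Finset.mem_range] at ht
      simp only
      rw [min_eq_left (by omega), min_eq_left (by omega), if_pos ht]
    simp only [hw, Nat.zero_min]

/-- Sums over words with a property invariant under reversal are symmetric. -/
theorem typedSum_isSymm (hs : A.IsSymm) {k : ℕ} {P : (ℕ → V) → (ℕ → Bool) → Prop}
    (hP : ∀ w τ, P w τ → P (fun t => w (k - t)) (fun t => if t < k then τ (k - 1 - t) else false)) :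
    (typedSum A p k P).IsSymm := by
  classical
  apply Matrix.IsSymm.ext
  intro i j
  simp only [typedSum, Matrix.of_apply]
  have r1 : ∀ ω : Fin (k + 1) → V, extend (fun t => ω (Fin.rev t)) = fun t => extend ω (k - t) := by
    intro ω
    funext t
    refine congrArg ω (Fin.ext ?_)
    simp only [Fin.val_rev]
    omega
  have r2 : ∀ τ : Fin k → Bool, extendType (fun t => τ (Fin.rev t)) =
      fun t => if t < k then extendType τ (k - 1 - t) else false := by
    intro τ
    funext t
    unfold extendType
    by_cases h : t < k
    · rw [dif_pos h, if_pos h, dif_pos (by omega)]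
      refine congrArg τ (Fin.ext ?_)
      simp only [Fin.val_rev]
      omega
    · rw [dif_neg h, if_neg h]
  have hiff : ∀ (ω : Fin (k + 1) → V) (τ : Fin k → Bool),
      P (extend ω) (extendType τ) ↔ P (fun t => extend ω (k - t))
        (fun t => if t < k then extendType τ (k - 1 - t) else false) := by
    intro ω τ
    refine ⟨hP _ _, fun h => ?_⟩
    convert hP _ _ h using 1
    · funext t
      rw [← extend_min]
      congr 1
      omega
    · funext t
      split_ifs with h1 h2
      · congr 1
        omega
      · omega
      · simp [extendType, h1]
  apply Fintype.sum_equiv (Equiv.prodCongr (Equiv.arrowCongr Fin.revPerm (Equiv.refl V))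
    (Equiv.arrowCongr Fin.revPerm (Equiv.refl Bool)))
  rintro ⟨ω, τ⟩
  have c1 : (Equiv.arrowCongr Fin.revPerm (Equiv.refl V)) ω = fun t => ω (Fin.rev t) := rfl
  have c2 : (Equiv.arrowCongr Fin.revPerm (Equiv.refl Bool)) τ = fun t => τ (Fin.rev t) := rfl
  simp only [Equiv.prodCongr_apply, Prod.map_apply, c1, c2, r1, r2]
  have hw : wordWeight A p k (fun t => extend ω (k - t))
      (fun t => if t < k then extendType τ (k - 1 - t) else false) =
      wordWeight A p k (extend ω) (extendType τ) := by
    unfold wordWeight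
    rw [← Finset.prod_range_reflect]
    apply Finset.prod_congr rfl
    intro t ht
    rw [Finset.mem_range] at ht
    beta_reduce
    rw [if_pos (show k - 1 - t < k by omega), show k - 1 - (k - 1 - t) = t by omega,
      show k - (k - 1 - t) = t + 1 by omega, show k - (k - 1 - t + 1) = t by omega, hs.apply]
  rw [hw]
  refine if_congr ?_ rfl rfl
  rw [hiff]
  simp only [Nat.sub_zero, Nat.sub_self]
  tauto

lemma typedSum_selfAvoiding_isSymm (hs : A.IsSymm) (k : ℕ) :
    (typedSum A p k (fun w _ => SelfAvoiding k w)).IsSymm := by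
  apply typedSum_isSymm hs
  intro w _ h a c hac hc
  exact (h (k - c) (k - a) (by omega) (by omega)).symm

lemma typedSum_returning_isSymm (hs : A.IsSymm) (k : ℕ) :
    (typedSum A p k (fun w τ => NoBacktrack k w τ ∧ ¬ SelfAvoiding k w)).IsSymm := by
  apply typedSum_isSymm hs
  rintro w τ ⟨h1, h2⟩
  constructor
  · intro t ht a b
    beta_reduce at a b ⊢
    rw [if_pos (by omega)] at a b
    have := h1 (k - 2 - t) (by omega)
    rw [show k - 1 - (t + 1) = k - 2 - t by omega] at b
    rw [show k - 2 - t + 1 = k - 1 - t by omega, show k - 2 - t + 2 = k - t by omega] at this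
    rw [show k - (t + 2) = k - 2 - t by omega]
    exact (this b a).symm
  · intro h
    apply h2
    intro a c hac hc
    have := h (k - c) (k - a) (by omega) (by omega)
    beta_reduce at this
    rw [show k - (k - c) = c by omega, show k - (k - a) = a by omega] at this
    exact this.symm

/-- Powers of the self-avoiding sum are sums over words of self-avoiding blocks. -/
lemma typedSum_selfAvoiding_pow (k M : ℕ) :
    typedSum A p k (fun w _ => SelfAvoiding k w) ^ M =
      typedSum A p (M * k) (fun w _ => BlockSelfAvoiding k (M * k) w) := by
  induction M with
  | zero =>
    classical
    rw [pow_zero, Nat.zero_mul]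
    ext i j
    rw [typedSum_eq_sum_prod, Fintype.sum_equiv (Equiv.funUnique (Fin 1) V) _
      (fun v => if v = i ∧ v = j then (1 : ℝ) else 0), Matrix.one_apply]
    · by_cases hij : i = j
      · subst hij
        simp
      · rw [if_neg hij, Finset.sum_eq_zero]
        intro v _
        rw [if_neg]
        rintro ⟨rfl, rfl⟩
        exact hij rfl
    · intro w
      have : BlockSelfAvoiding k 0 (extend w) := by
        intro b a c _ h1 _ h2
        omega
      simp [this, extend]
  | succ M ih =>
    rw [pow_succ, ih, typedSum_mul, Nat.succ_mul]
    apply typedSum_congr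
    intro ω _
    constructor
    · rintro ⟨h1, h2⟩ b a c hba hac hcb hc
      rcases Nat.lt_trichotomy b M with hb | rfl | hb
      · have h3 : (b + 1) * k ≤ M * k := Nat.mul_le_mul_right _ hb
        have := h1 b a c hba hac hcb (by omega)
        beta_reduce at this
        rwa [min_eq_left (by omega), min_eq_left (by omega)] at this
      · rw [Nat.succ_mul] at hcb
        have := h2 (a - b * k) (c - b * k) (by omega) (by omega)
        beta_reduce at this
        rwa [Nat.add_sub_cancel' hba, Nat.add_sub_cancel' (by omega)] at this
      · have h3 : (M + 1) * k ≤ b * k := Nat.mul_le_mul_right _ hb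
        rw [Nat.succ_mul] at h3
        omega
    · intro h
      constructor
      · intro b a c hba hac hcb hc
        beta_reduce
        rw [min_eq_left (by omega), min_eq_left (by omega)]
        exact h b a c hba hac hcb (by omega)
      · intro a c hac hc
        exact h M (M * k + a) (M * k + c) (by omega) (by omega) (by rw [Nat.succ_mul]; omega)
          (by omega)

open Classical in
/-- The trace of a power of the self-avoiding sum. -/
theorem trace_selfAvoiding_pow (k M : ℕ) :
    (typedSum A p k (fun w _ => SelfAvoiding k w) ^ M).trace = ∑ ω : Fin (M * k + 1) → V,
      if extend ω 0 = extend ω (M * k) ∧ BlockSelfAvoiding k (M * k) (extend ω) then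
        ∏ t ∈ Finset.range (M * k), (A (extend ω t) (extend ω (t + 1)) - p) else 0 := by
  rw [typedSum_selfAvoiding_pow, Matrix.trace]
  simp only [Matrix.diag_apply, typedSum_eq_sum_prod]
  rw [Finset.sum_comm]
  apply Finset.sum_congr rfl
  intro ω _
  rw [Finset.sum_eq_single (extend ω 0)]
  · refine if_congr ?_ rfl rfl
    constructor
    · rintro ⟨-, h1, h2⟩
      exact ⟨h1.symm, h2⟩
    · rintro ⟨h1, h2⟩
      exact ⟨rfl, h1.symm, h2⟩
  · intro i _ hi
    rw [if_neg]
    rintro ⟨h, -⟩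
    exact hi h.symm
  · simp

open Classical in
/-- The Frobenius norm of the sum over the words that are not self-avoiding. -/
theorem sum_sq_returning (hs : A.IsSymm) (h0 : ∀ i, A i i = 0) (k : ℕ) :
    ∑ i, ∑ j, typedSum A p k (fun w τ => NoBacktrack k w τ ∧ ¬ SelfAvoiding k w) i j ^ 2 =
      ∑ x : (Fin (2 * k + 1) → V) × (Fin (2 * k) → Bool),
        if IsReturningPair k (extend x.1) (extendType x.2) then
          wordWeight A p (2 * k) (extend x.1) (extendType x.2) else 0 := by
  set R := typedSum A p k (fun w τ => NoBacktrack k w τ ∧ ¬ SelfAvoiding k w) with hR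
  have e1 : ∑ i, ∑ j, R i j ^ 2 = (R * R).trace := by
    rw [Matrix.trace]
    apply Finset.sum_congr rfl
    intro i _
    rw [Matrix.diag_apply, Matrix.mul_apply]
    apply Finset.sum_congr rfl
    intro j _
    rw [(show R j i = R i j from (typedSum_returning_isSymm hs k).apply i j), sq]
  rw [e1, hR, typedSum_mul, ← two_mul, Matrix.trace]
  simp only [Matrix.diag_apply, typedSum, Matrix.of_apply]
  rw [Finset.sum_comm]
  apply Finset.sum_congr rfl
  rintro ⟨ω, τ⟩ _
  simp only
  set w := extend ω
  set σ := extendType τ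
  by_cases hloop : ∀ t < 2 * k, σ t = true → w t ≠ w (t + 1)
  · rw [Finset.sum_eq_single (w 0)]
    · refine if_congr ?_ rfl rfl
      constructor
      · rintro ⟨-, h1, ⟨h2, h3⟩, h4, h5⟩
        simp only [SelfAvoiding, not_forall, not_not] at h3 h5
        obtain ⟨a, c, hac, hc, he⟩ := h3
        obtain ⟨a', c', hac', hc', he'⟩ := h5
        refine ⟨h1.symm, ⟨fun t _ ht => hloop t (by omega), ?_⟩,
          ⟨fun t _ ht => hloop t (by omega), ?_⟩, ⟨a, c, by omega, hac, hc, ?_⟩,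
          ⟨k + a', k + c', by omega, by omega, by omega, he'⟩⟩
        · intro t _ ht s1 s2
          have := h2 t (by omega)
          beta_reduce at this
          rw [if_pos (by omega), if_pos (by omega), min_eq_left (by omega),
            min_eq_left (by omega)] at this
          exact this s1 s2
        · intro t htk ht s1 s2
          have := h4 (t - k) (by omega)
          beta_reduce at this
          rw [show k + (t - k) = t by omega, show k + (t - k + 1) = t + 1 by omega,
            show k + (t - k + 2) = t + 2 by omega] at this
          exact this s1 s2
        · rwa [min_eq_left (by omega), min_eq_left (by omega)] at he
      · rintro ⟨h1, h2, h3, ⟨a, c, -, hac, hc, he⟩, ⟨a', c', hka, hac', hc', he'⟩⟩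
        refine ⟨rfl, h1.symm, ⟨?_, ?_⟩, ?_, ?_⟩
        · intro t ht
          beta_reduce
          rw [if_pos (by omega), if_pos (by omega), min_eq_left (by omega),
            min_eq_left (by omega)]
          exact h2.ne_succ_succ t (by omega) ht
        · intro hsa
          have := hsa a c hac hc
          beta_reduce at this
          rw [min_eq_left (by omega), min_eq_left (by omega)] at this
          exact this he
        · intro t ht
          exact h3.ne_succ_succ (k + t) (by omega) (by omega)
        · intro hsa
          have := hsa (a' - k) (c' - k) (by omega) (by omega)
          beta_reduce at this
          rw [Nat.add_sub_cancel' hka, Nat.add_sub_cancel' (by omega)] at this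
          exact this he'
    · intro i _ hi
      rw [if_neg]
      rintro ⟨h, -⟩
      exact hi h.symm
    · simp
  · -- words with a step along a loop have weight zero
    push Not at hloop
    obtain ⟨t, ht, hσ, hw⟩ := hloop
    have hz : wordWeight A p (2 * k) w σ = 0 := by
      apply Finset.prod_eq_zero (Finset.mem_range.2 ht)
      rw [if_pos hσ, ← hw, h0]
    simp [hz]

end Concatenation

/-! ### Expectations of products of edge indicators -/

section RandomGraph

open MeasureTheory unitInterval

instance {V : Type*} [Countable V] : MeasurableSingletonClass (SimpleGraph V) where
  measurableSet_singleton G := by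
    have h : ({G} : Set (SimpleGraph V)) = SimpleGraph.edgeSet ⁻¹' {G.edgeSet} := by
      ext H
      simp
    rw [h]
    exact SimpleGraph.measurable_edgeSet (measurableSet_singleton _)

variable {V : Type*} [Fintype V] [DecidableEq V]

open Classical in
lemma measureReal_binomialRandom_singleton (q : I) (G : SimpleGraph V) :
    (SimpleGraph.binomialRandom V q).real {G} = (q : ℝ) ^ G.edgeFinset.card *
      (1 - (q : ℝ)) ^ (({e : Sym2 V | ¬ e.IsDiag} : Finset (Sym2 V)) \ G.edgeFinset).card := by
  have h1 : G.edgeSet.ncard = G.edgeFinset.card := by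
    rw [← SimpleGraph.coe_edgeFinset, Set.ncard_coe_finset]
  have h2 : ({e : Sym2 V | ¬ e.IsDiag} : Finset (Sym2 V)).card = (Nat.card V).choose 2 := by
    rw [Nat.card_eq_fintype_card, ← Sym2.card_subtype_not_diag, Fintype.card_subtype]
  have h3 : G.edgeFinset ⊆ ({e : Sym2 V | ¬ e.IsDiag} : Finset (Sym2 V)) := by
    intro e he
    rw [SimpleGraph.mem_edgeFinset] at he
    simpa using G.not_isDiag_of_mem_edgeSet he
  rw [Finset.card_sdiff_of_subset h3, h2, measureReal_def, SimpleGraph.binomialRandom_singleton, h1]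
  simp

open Classical in
/-- Distinct pairs of vertices are edges independently of each other. -/
theorem integral_prod_edges (q : I) (S : Finset (Sym2 V)) (hS : ∀ e ∈ S, ¬ e.IsDiag)
    (a b : Sym2 V → ℝ) :
    ∫ G, ∏ e ∈ S, (if e ∈ G.edgeSet then a e else b e) ∂(SimpleGraph.binomialRandom V q) =
      ∏ e ∈ S, ((q : ℝ) * a e + (1 - q) * b e) := by
  set E : Finset (Sym2 V) := {e : Sym2 V | ¬ e.IsDiag} with hE
  have key : ∀ a b : Sym2 V → ℝ,
      ∫ G, ∏ e ∈ E, (if e ∈ G.edgeSet then a e else b e) ∂(SimpleGraph.binomialRandom V q) =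
        ∏ e ∈ E, ((q : ℝ) * a e + (1 - q) * b e) := by
    intro a b
    rw [integral_fintype .of_finite, Finset.prod_add]
    refine Finset.sum_bij' (fun G _ => G.edgeFinset)
      (fun T _ => SimpleGraph.fromEdgeSet (T : Set (Sym2 V))) ?_ ?_ ?_ ?_ ?_
    · intro G _
      rw [Finset.mem_powerset]
      intro e he
      rw [SimpleGraph.mem_edgeFinset] at he
      simpa [hE] using G.not_isDiag_of_mem_edgeSet he
    · intro T _
      exact Finset.mem_univ _
    · intro G _
      simp
    · intro T hT
      rw [Finset.mem_powerset] at hT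
      ext e
      simp only [SimpleGraph.edgeFinset, Set.mem_toFinset, SimpleGraph.edgeSet_fromEdgeSet,
        Set.mem_sdiff, Finset.mem_coe]
      constructor
      · exact fun h => h.1
      · intro h
        refine ⟨h, ?_⟩
        have := hT h
        simpa [hE] using this
    · intro G _
      have h3 : G.edgeFinset ⊆ E := by
        intro e he
        rw [SimpleGraph.mem_edgeFinset] at he
        simpa [hE] using G.not_isDiag_of_mem_edgeSet he
      rw [measureReal_binomialRandom_singleton, Finset.prod_mul_distrib, Finset.prod_mul_distrib,
        Finset.prod_const, Finset.prod_const, smul_eq_mul, ← Finset.prod_sdiff h3]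
      have e1 : ∏ e ∈ E \ G.edgeFinset, (if e ∈ G.edgeSet then a e else b e) =
          ∏ e ∈ E \ G.edgeFinset, b e := by
        apply Finset.prod_congr rfl
        intro e he
        rw [Finset.mem_sdiff, SimpleGraph.mem_edgeFinset] at he
        rw [if_neg he.2]
      have e2 : ∏ e ∈ G.edgeFinset, (if e ∈ G.edgeSet then a e else b e) =
          ∏ e ∈ G.edgeFinset, a e := by
        apply Finset.prod_congr rfl
        intro e he
        rw [if_pos (SimpleGraph.mem_edgeFinset.1 he)]
      rw [e1, e2]
      ring
  have hSE : S ⊆ E := fun e he => by simpa [hE] using hS e he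
  have := key (fun e => if e ∈ S then a e else 1) (fun e => if e ∈ S then b e else 1)
  rw [← Finset.prod_subset hSE] at this
  · rw [Finset.prod_congr rfl (fun e he => by rw [if_pos he, if_pos he])] at this
    rw [← this]
    congr 1
    funext G
    rw [← Finset.prod_subset hSE]
    · exact Finset.prod_congr rfl (fun e he => by rw [if_pos he, if_pos he])
    · intro e _ he
      simp [he]
  · intro e _ he
    simp [he]

open Classical in
/-- The product of the centred indicators of a sequence of pairs has mean zero unless each pair is
repeated, and then its mean is at most the probability that all the pairs are edges. -/
lemma integral_prod_sub_le (q : I) (e : ℕ → Sym2 V) (N : ℕ) (he : ∀ t < N, ¬ (e t).IsDiag) :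
    ∫ G, ∏ t ∈ Finset.range N, ((if e t ∈ G.edgeSet then (1 : ℝ) else 0) - q)
        ∂(SimpleGraph.binomialRandom V q) ≤
      if ∀ x ∈ (Finset.range N).image e, 2 ≤ ((Finset.range N).filter (fun t => e t = x)).card then
        (q : ℝ) ^ ((Finset.range N).image e).card else 0 := by
  have hq0 := q.2.1
  have hq1 := q.2.2
  have h1 : ∀ G : SimpleGraph V,
      ∏ t ∈ Finset.range N, ((if e t ∈ G.edgeSet then (1 : ℝ) else 0) - q) =
      ∏ x ∈ (Finset.range N).image e, (if x ∈ G.edgeSet then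
        (1 - (q : ℝ)) ^ ((Finset.range N).filter (fun t => e t = x)).card else
        (-(q : ℝ)) ^ ((Finset.range N).filter (fun t => e t = x)).card) := by
    intro G
    rw [Finset.prod_comp (fun x => (if x ∈ G.edgeSet then (1 : ℝ) else 0) - q) e]
    apply Finset.prod_congr rfl
    intro x _
    split_ifs <;> simp
  simp only [h1]
  rw [integral_prod_edges]
  · split_ifs with h2
    · refine (le_abs_self _).trans ?_
      rw [Finset.abs_prod, ← Finset.prod_const]
      apply Finset.prod_le_prod
      · intro x _
        exact abs_nonneg _
      · intro x hx
        obtain ⟨c, hc⟩ := Nat.exists_eq_add_of_le (h2 x hx)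
        rw [hc]
        have b1 : |(1 - (q : ℝ)) ^ (2 + c)| ≤ 1 - q := by
          rw [abs_pow, abs_of_nonneg (by linarith)]
          exact pow_le_of_le_one (by linarith) (by linarith) (by omega)
        have b2 : |(-(q : ℝ)) ^ (2 + c)| ≤ q ^ 2 := by
          rw [abs_pow, abs_neg, abs_of_nonneg hq0]
          exact pow_le_pow_of_le_one hq0 hq1 (by omega)
        calc |(q : ℝ) * (1 - q) ^ (2 + c) + (1 - q) * (-q) ^ (2 + c)|
            ≤ |(q : ℝ) * (1 - q) ^ (2 + c)| + |(1 - (q : ℝ)) * (-q) ^ (2 + c)| := abs_add_le _ _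
          _ = q * |(1 - (q : ℝ)) ^ (2 + c)| + (1 - q) * |(-(q : ℝ)) ^ (2 + c)| := by
            rw [abs_mul, abs_mul, abs_of_nonneg hq0, abs_of_nonneg (a := 1 - (q : ℝ)) (by linarith)]
          _ ≤ q * (1 - q) + (1 - q) * q ^ 2 := by gcongr
          _ ≤ q := by nlinarith [mul_nonneg hq0 hq0, mul_nonneg (mul_nonneg hq0 hq0) hq0]
    · push Not at h2
      obtain ⟨x, hx, hlt⟩ := h2
      apply le_of_eq
      apply Finset.prod_eq_zero hx
      -- a pair which occurs once contributes the mean of a centred indicator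
      have : ((Finset.range N).filter (fun t => e t = x)).card = 1 := by
        have : 0 < ((Finset.range N).filter (fun t => e t = x)).card := by
          rw [Finset.card_pos]
          obtain ⟨t, ht, rfl⟩ := Finset.mem_image.1 hx
          exact ⟨t, Finset.mem_filter.2 ⟨ht, rfl⟩⟩
        omega
      rw [this]
      ring
  · intro x hx
    obtain ⟨t, ht, rfl⟩ := Finset.mem_image.1 hx
    exact he t (Finset.mem_range.1 ht)

open Classical in
lemma integral_prod_indicator (q : I) (e : ℕ → Sym2 V) (T : Finset ℕ)
    (he : ∀ t ∈ T, ¬ (e t).IsDiag) :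
    ∫ G, ∏ t ∈ T, (if e t ∈ G.edgeSet then (1 : ℝ) else 0) ∂(SimpleGraph.binomialRandom V q) =
      (q : ℝ) ^ (T.image e).card := by
  have h1 : ∀ G : SimpleGraph V, ∏ t ∈ T, (if e t ∈ G.edgeSet then (1 : ℝ) else 0) =
      ∏ x ∈ T.image e, (if x ∈ G.edgeSet then (1 : ℝ) else 0) := by
    intro G
    rw [Finset.prod_comp (fun x => if x ∈ G.edgeSet then (1 : ℝ) else 0) e]
    apply Finset.prod_congr rfl
    intro x hx
    have h0 : (T.filter (fun t => e t = x)).card ≠ 0 := by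
      obtain ⟨t, ht, rfl⟩ := Finset.mem_image.1 hx
      exact Finset.card_ne_zero_of_mem (Finset.mem_filter.2 ⟨ht, rfl⟩)
    split_ifs <;> simp [h0]
  simp only [h1]
  rw [integral_prod_edges]
  · simp
  · intro x hx
    obtain ⟨t, ht, rfl⟩ := Finset.mem_image.1 hx
    exact he t ht

end RandomGraph

/-! ### Moments of the non-backtracking sums and of the degrees -/

section Moments

open MeasureTheory unitInterval

variable {n : ℕ}

open Classical in
lemma adjacency_apply (G : SimpleGraph (Fin n)) (i j : Fin n) :
    adjacency G i j = if s(i, j) ∈ G.edgeSet then 1 else 0 := by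
  simp [adjacency, SimpleGraph.adjMatrix_apply]

lemma adjacency_isSymm (G : SimpleGraph (Fin n)) : (adjacency G).IsSymm := by
  classical
  exact Matrix.IsSymm.ext fun i j => by rw [adjacency_apply, adjacency_apply, Sym2.eq_swap]

lemma adjacency_mul_self (G : SimpleGraph (Fin n)) (i j : Fin n) :
    adjacency G i j * adjacency G i j = adjacency G i j := by
  rw [adjacency_apply]
  split_ifs <;> simp

lemma adjacency_self (G : SimpleGraph (Fin n)) (i : Fin n) : adjacency G i i = 0 := by
  simp [adjacency_apply]

/-- The self-avoiding part of the non-backtracking sum, by the trace method. -/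
theorem integral_trace_selfAvoiding_le (q : I) {k m : ℕ} (hk : 0 < k) (hm : 0 < m) {d : ℝ}
    (hd : 1 ≤ d) (hq : (q : ℝ) = d / n)
    (hQ : 2 * patternBase (2 * m * k) ^ (6 * (2 * m)) ≤ n) :
    ∫ G, (typedSum (adjacency G) q k (fun w _ => SelfAvoiding k w) ^ (2 * m)).trace
        ∂(SimpleGraph.binomialRandom (Fin n) q) ≤
      2 * n * (patternBase (2 * m * k) ^ (6 * (2 * m)) : ℕ) * d ^ (m * k) := by
  classical
  simp only [trace_selfAvoiding_pow]
  rw [integral_finsetSum _ (fun _ _ => .of_finite)]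
  set W : Finset (Fin (2 * m * k + 1) → Fin n) := Finset.univ.filter fun ω =>
    BlockSelfAvoiding k (2 * m * k) (extend ω) ∧
    ∀ e ∈ edgesOf (2 * m * k) (extend ω), 2 ≤ ((Finset.range (2 * m * k)).filter
      (fun t => s(extend ω t, extend ω (t + 1)) = e)).card with hW
  have key := sum_pow_card_edges_le_of_blocks (V := Fin n) (k := k) (M := 2 * m) (h := m * k) hk
    (by omega) (by ring) hd (by simpa using hQ) W (fun ω hω => (Finset.mem_filter.1 hω).2.1)
    (fun ω hω => (Finset.mem_filter.1 hω).2.2)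
  rw [Fintype.card_fin] at key
  refine le_trans ?_ key
  rw [hW, Finset.sum_filter]
  apply Finset.sum_le_sum
  intro ω _
  have hq0 : (0 : ℝ) ≤ d / n := hq ▸ q.2.1
  by_cases hb : extend ω 0 = extend ω (2 * m * k) ∧ BlockSelfAvoiding k (2 * m * k) (extend ω)
  · simp only [if_pos hb, adjacency_apply]
    refine (integral_prod_sub_le q (fun t => s(extend ω t, extend ω (t + 1))) (2 * m * k)
      ?_).trans ?_
    · intro t ht
      rw [Sym2.mk_isDiag_iff]
      -- the step from `t` to `t + 1` lies in the block number `t / k`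
      have h1 := Nat.div_add_mod t k
      have h2 := Nat.mod_lt t hk
      rw [mul_comm] at h1
      exact hb.2 (t / k) t (t + 1) (by omega) (by omega) (by rw [add_mul]; omega) (by omega)
    · rw [← hq]
      change (if ∀ x ∈ edgesOf (2 * m * k) (extend ω), 2 ≤ ((Finset.range (2 * m * k)).filter
        (fun t => s(extend ω t, extend ω (t + 1)) = x)).card then
        (q : ℝ) ^ (edgesOf (2 * m * k) (extend ω)).card else 0) ≤ _
      by_cases h2 : ∀ e ∈ edgesOf (2 * m * k) (extend ω), 2 ≤ ((Finset.range (2 * m * k)).filter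
          (fun t => s(extend ω t, extend ω (t + 1)) = e)).card
      · rw [if_pos h2, if_pos ⟨hb.2, h2⟩]
      · rw [if_neg h2, if_neg (fun h => h2 h.2)]
  · simp only [if_neg hb, integral_zero]
    split_ifs <;> positivity

/-- A typed word without loops has mean weight at most `q` to the power of the number of its labels:
each distinct edge is present with probability `q`, and each jump has a factor `-q`. -/
lemma integral_wordWeight_le (q : I) {N : ℕ} (x : (Fin (N + 1) → Fin n) × (Fin N → Bool))
    (hx : ∀ t < N, extendType x.2 t = true → extend x.1 t ≠ extend x.1 (t + 1)) :
    ∫ G, wordWeight (adjacency G) q N (extend x.1) (extendType x.2)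
        ∂(SimpleGraph.binomialRandom (Fin n) q) ≤ (q : ℝ) ^ labelCount x := by
  classical
  have hq0 := q.2.1
  have hq1 := q.2.2
  set w := extend x.1
  set τ := extendType x.2
  set T := (Finset.range N).filter (fun t => τ t = true)
  set F := (Finset.range N).filter (fun t => ¬ τ t = true)
  have h1 : ∀ G : SimpleGraph (Fin n), wordWeight (adjacency G) q N w τ =
      (∏ t ∈ T, (if s(w t, w (t + 1)) ∈ G.edgeSet then (1 : ℝ) else 0)) * (-(q : ℝ)) ^ F.card := by
    intro G
    rw [wordWeight, Finset.prod_ite, Finset.prod_const]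
    simp only [adjacency_apply]
    rfl
  simp only [h1]
  rw [integral_mul_const, integral_prod_indicator]
  · refine (le_abs_self _).trans ?_
    rw [abs_mul, abs_pow, abs_pow, abs_neg, abs_of_nonneg hq0, ← pow_add]
    apply pow_le_pow_of_le_one hq0 hq1
    have h2 : (Finset.range N).image (stepLabel w τ) ⊆
        (T.image (fun t => s(w t, w (t + 1)))).image Sum.inl ∪ F.image Sum.inr := by
      intro l hl
      obtain ⟨t, ht, rfl⟩ := Finset.mem_image.1 hl
      rw [Finset.mem_union]
      unfold stepLabel
      split_ifs with h
      · exact Or.inl (Finset.mem_image_of_mem _ (Finset.mem_image_of_mem _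
          (Finset.mem_filter.2 ⟨ht, h⟩)))
      · exact Or.inr (Finset.mem_image_of_mem _ (Finset.mem_filter.2 ⟨ht, h⟩))
    exact (Finset.card_le_card h2).trans ((Finset.card_union_le _ _).trans
      (add_le_add Finset.card_image_le Finset.card_image_le))
  · intro t ht
    rw [Sym2.mk_isDiag_iff]
    have := Finset.mem_filter.1 ht
    exact hx t (Finset.mem_range.1 this.1) this.2

/-- The returning part of the non-backtracking sum, by the second moment of its Frobenius norm. -/
theorem integral_sum_sq_returning_le (q : I) (hn : 0 < n) (k : ℕ) {d : ℝ} (hd : 1 ≤ d)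
    (hq : (q : ℝ) = d / n) :
    ∫ G, ∑ i, ∑ j, typedSum (adjacency G) q k
        (fun w τ => NoBacktrack k w τ ∧ ¬ SelfAvoiding k w) i j ^ 2
        ∂(SimpleGraph.binomialRandom (Fin n) q) ≤
      d ^ k * ((2 * k + 1) ^ 2 * (4 * (2 * k) * (2 * k + 1) ^ 2 + 1) ^ 9 : ℕ) +
      d ^ (2 * k) * (2 ^ (2 * k) * (2 * k + 1) ^ (2 * k + 1) : ℕ) / n := by
  classical
  simp only [fun G : SimpleGraph (Fin n) => sum_sq_returning (p := q) (adjacency_isSymm G)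
    (adjacency_self G) k]
  rw [integral_finsetSum _ (fun _ _ => .of_finite)]
  have key := sum_pow_labelCount_le (V := Fin n) (k := k) (by simpa using hn) hd
    (Finset.univ.filter fun x => IsReturningPair k (extend x.1) (extendType x.2))
    (fun x hx => (Finset.mem_filter.1 hx).2)
  rw [Fintype.card_fin] at key
  refine le_trans ?_ key
  rw [Finset.sum_filter]
  apply Finset.sum_le_sum
  intro x _
  split_ifs with h
  · rw [← hq]
    apply integral_wordWeight_le
    intro t ht hτ
    rcases Nat.lt_or_ge t k with h1 | h1
    · exact h.left.ne_succ t (Nat.zero_le _) (by omega) hτ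
    · exact h.right.ne_succ t h1 (by omega) hτ
  · simp

/-- A degree is a sum of independent indicators, so `2 ^ degree` has mean `(1 + q) ^ (n - 1)`. -/
lemma integral_two_rpow_degree_le (q : I) (i : Fin n) :
    ∫ G, (2 : ℝ) ^ ((adjacency G).mulVec 1 i) ∂(SimpleGraph.binomialRandom (Fin n) q) ≤
      Real.exp (q * n) := by
  classical
  have hq0 := q.2.1
  have h1 : ∀ G : SimpleGraph (Fin n), (2 : ℝ) ^ ((adjacency G).mulVec 1 i) =
      ∏ e ∈ (Finset.univ.erase i).image (fun j => s(i, j)),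
        (if e ∈ G.edgeSet then (2 : ℝ) else 1) := by
    intro G
    rw [Finset.prod_image (by
      intro a _ b _ hab
      exact Sym2.congr_right.1 hab), Matrix.mulVec, dotProduct,
      Real.rpow_sum_of_pos (by norm_num : (0 : ℝ) < 2),
      ← Finset.mul_prod_erase _ _ (Finset.mem_univ i), adjacency_self]
    simp only [Real.rpow_zero, one_mul, Pi.one_apply, mul_one, adjacency_apply]
    apply Finset.prod_congr rfl
    intro j _
    split_ifs <;> simp
  simp only [h1]
  rw [integral_prod_edges]
  · rw [Finset.prod_const]
    calc ((q : ℝ) * 2 + (1 - q) * 1) ^ ((Finset.univ.erase i).image (fun j => s(i, j))).card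
        ≤ ((q : ℝ) + 1) ^ n := by
          rw [show (q : ℝ) * 2 + (1 - q) * 1 = q + 1 by ring]
          apply pow_le_pow_right₀ (by linarith)
          refine Finset.card_image_le.trans ((Finset.card_le_univ _).trans ?_)
          simp
      _ ≤ Real.exp q ^ n := by
          gcongr
          exact Real.add_one_le_exp _
      _ = Real.exp (q * n) := by rw [← Real.exp_nat_mul, mul_comm]
  · intro e he
    obtain ⟨j, hj, rfl⟩ := Finset.mem_image.1 he
    rw [Sym2.mk_isDiag_iff]
    exact (Finset.ne_of_mem_erase hj).symm

end Moments

/-! ### Probability bounds -/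

section Probability

open MeasureTheory unitInterval

variable {n : ℕ} {d u η : ℝ}

lemma measureReal_le_div_of_integral_le {q : I} {f : SimpleGraph (Fin n) → ℝ} (hf : ∀ G, 0 ≤ f G)
    {c B : ℝ} (hc : 0 < c) (hB : ∫ G, f G ∂(SimpleGraph.binomialRandom (Fin n) q) ≤ B) :
    (SimpleGraph.binomialRandom (Fin n) q).real {G | c ≤ f G} ≤ B / c := by
  rw [le_div_iff₀ hc, mul_comm]
  exact (mul_meas_ge_le_integral_of_nonneg (.of_forall hf) .of_finite c).trans hB

/-- Markov's inequality for the trace method. The threshold `(η / u) ^ k` lies between the typical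
size `d ^ (k / 2)` of the norm and the admissible size `u ^ (-k)`; since `η ^ 2 = u * √d`, it is their
geometric mean. -/
lemma measureReal_norm_selfAvoiding_gt_le {q : I} (hq : (q : ℝ) = d / n) (hd : 1 ≤ d) (hu : 0 < u)
    (hη : 0 < η) (hηd : η ^ 4 = d * u ^ 2) {k m : ℕ} (hk : 0 < k) (hm : 0 < m)
    (hQ : 2 * patternBase (2 * m * k) ^ (6 * (2 * m)) ≤ n) :
    (SimpleGraph.binomialRandom (Fin n) q).real
      {G | (η / u) ^ k < ‖typedSum (adjacency G) q k (fun w _ => SelfAvoiding k w)‖} ≤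
      2 * n * (patternBase (2 * m * k) ^ (6 * (2 * m)) : ℕ) * η ^ (2 * m * k) := by
  have htr : ∀ G : SimpleGraph (Fin n),
      ‖typedSum (adjacency G) q k (fun w _ => SelfAvoiding k w)‖ ^ (2 * m) ≤
      (typedSum (adjacency G) q k (fun w _ => SelfAvoiding k w) ^ (2 * m)).trace := fun G =>
    norm_pow_le_trace (typedSum_selfAvoiding_isSymm (adjacency_isSymm G) k) m hm
  have hc : 0 < ((η / u) ^ k) ^ (2 * m) := by positivity
  have h := measureReal_le_div_of_integral_le
    (fun G => (pow_nonneg (norm_nonneg _) _).trans (htr G)) hc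
    (integral_trace_selfAvoiding_le q hk hm hd hq hQ)
  refine (measureReal_mono ?_).trans (h.trans (le_of_eq ?_))
  · intro G hG
    rw [Set.mem_ofPred_eq] at hG ⊢
    exact (pow_le_pow_left₀ (by positivity) hG.le _).trans (htr G)
  · rw [div_eq_iff hc.ne']
    have e1 : ((η / u) ^ k) ^ (2 * m) = η ^ (2 * m * k) / (u ^ 2) ^ (m * k) := by
      rw [← pow_mul, div_pow, ← pow_mul]
      congr 2 <;> ring
    have e2 : η ^ (2 * m * k) * η ^ (2 * m * k) = d ^ (m * k) * (u ^ 2) ^ (m * k) := by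
      rw [← mul_pow d, ← hηd, ← pow_mul, ← pow_add]
      congr 1
      ring
    have e3 : η ^ (2 * m * k) * (η ^ (2 * m * k) / (u ^ 2) ^ (m * k)) = d ^ (m * k) := by
      rw [← mul_div_assoc, e2, mul_div_assoc, div_self (by positivity), mul_one]
    rw [e1, mul_assoc _ (η ^ (2 * m * k)), e3]

lemma measureReal_norm_returning_gt_le {q : I} (hn : 0 < n) (hq : (q : ℝ) = d / n) (hd : 1 ≤ d)
    (hu : 0 < u) (hη : 0 < η) (hηd : η ^ 4 = d * u ^ 2) (k : ℕ) :
    (SimpleGraph.binomialRandom (Fin n) q).real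
      {G | (η / u) ^ k < ‖typedSum (adjacency G) q k
        (fun w τ => NoBacktrack k w τ ∧ ¬ SelfAvoiding k w)‖} ≤
      η ^ (2 * k) * ((2 * k + 1) ^ 2 * (4 * (2 * k) * (2 * k + 1) ^ 2 + 1) ^ 9 : ℕ) +
      d ^ k * η ^ (2 * k) * (2 ^ (2 * k) * (2 * k + 1) ^ (2 * k + 1) : ℕ) / n := by
  have hc : 0 < ((η / u) ^ k) ^ 2 := by positivity
  have h := measureReal_le_div_of_integral_le
    (fun G => Finset.sum_nonneg fun i _ => Finset.sum_nonneg fun j _ => sq_nonneg _) hc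
    (integral_sum_sq_returning_le q hn k hd hq)
  refine (measureReal_mono ?_).trans (h.trans (le_of_eq ?_))
  · intro G hG
    rw [Set.mem_ofPred_eq] at hG ⊢
    exact (pow_le_pow_left₀ (by positivity) hG.le _).trans (norm_sq_le_sum_sq _)
  · rw [div_eq_iff hc.ne']
    have e1 : ((η / u) ^ k) ^ 2 = η ^ (2 * k) / (u ^ 2) ^ k := by
      rw [← pow_mul, div_pow, ← pow_mul]
      congr 2 <;> ring
    have e2 : η ^ (2 * k) * η ^ (2 * k) = d ^ k * (u ^ 2) ^ k := by
      rw [← mul_pow d, ← hηd, ← pow_mul, ← pow_add]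
      congr 1
      ring
    have e3 : η ^ (2 * k) * (η ^ (2 * k) / (u ^ 2) ^ k) = d ^ k := by
      rw [← mul_div_assoc, e2, mul_div_assoc, div_self (by positivity), mul_one]
    rw [e1]
    generalize (((2 * k + 1) ^ 2 * (4 * (2 * k) * (2 * k + 1) ^ 2 + 1) ^ 9 : ℕ) : ℝ) = a
    generalize ((2 ^ (2 * k) * (2 * k + 1) ^ (2 * k + 1) : ℕ) : ℝ) = b
    have e4 : d ^ (2 * k) = d ^ k * d ^ k := by rw [two_mul, pow_add]
    linear_combination (-(a + d ^ k * b / n)) * e3 + b / n * e4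

/-- A union bound over the vertices, with Markov's inequality for `2` to the power of the degree. -/
lemma measureReal_degree_gt_le {q : I} (hn : 0 < n) (hq : (q : ℝ) = d / n) (L : ℕ) :
    (SimpleGraph.binomialRandom (Fin n) q).real
      {G | ∃ i, (L : ℝ) < (adjacency G).mulVec 1 i} ≤ n * Real.exp d / 2 ^ L := by
  have h : ∀ i : Fin n, (SimpleGraph.binomialRandom (Fin n) q).real
      {G | (L : ℝ) < (adjacency G).mulVec 1 i} ≤ Real.exp d / 2 ^ L := by
    intro i
    have h1 := integral_two_rpow_degree_le q i
    rw [hq, div_mul_cancel₀ _ (by positivity)] at h1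
    refine (measureReal_mono ?_).trans (measureReal_le_div_of_integral_le
      (fun G => by positivity) (by positivity) h1)
    intro G hG
    rw [Set.mem_ofPred_eq] at hG ⊢
    rw [← Real.rpow_natCast]
    exact Real.rpow_le_rpow_of_exponent_le (by norm_num) hG.le
  have h2 : {G : SimpleGraph (Fin n) | ∃ i, (L : ℝ) < (adjacency G).mulVec 1 i} =
      ⋃ i, {G | (L : ℝ) < (adjacency G).mulVec 1 i} := by
    ext G
    simp
  rw [h2]
  refine (measureReal_iUnion_fintype_le _).trans ((Finset.sum_le_sum fun i _ => h i).trans ?_)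
  simp [mul_div_assoc]

/-- An upper bound for the probability that the deformed Laplacian is not positive definite: unless a
degree exceeds `L`, or the self-avoiding or the returning part of `nbSum` has norm above `(η / u) ^ k`
for one of the three lengths `k = K + i`, it is. -/
theorem measureReal_not_posDef_le {q : I} (hn : 0 < n) (hq : (q : ℝ) = d / n) (hd : 1 ≤ d)
    (hu : 0 < u) (hu1 : u < 1) (hη : 0 < η) (hη1 : η ≤ 1) (hηd : η ^ 4 = d * u ^ 2) {K m L : ℕ}
    (hK : 0 < K) (hm : 0 < m) (hL : 0 < L)
    (hQ : ∀ i < 3, 2 * patternBase (2 * m * (K + i)) ^ (6 * (2 * m)) ≤ n)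
    (hε : 2 * η ^ K * (1 + L + 2 * d) < 1 - u ^ 2) :
    (SimpleGraph.binomialRandom (Fin n) q).real
      {G | ¬ (deformedLaplacian (adjacency G) q u).PosDef} ≤
      n * Real.exp d / 2 ^ L + ∑ i ∈ Finset.range 3,
        (2 * n * (patternBase (2 * m * (K + i)) ^ (6 * (2 * m)) : ℕ) * η ^ (2 * m * (K + i)) +
        (η ^ (2 * (K + i)) * ((2 * (K + i) + 1) ^ 2 *
          (4 * (2 * (K + i)) * (2 * (K + i) + 1) ^ 2 + 1) ^ 9 : ℕ) +
        d ^ (K + i) * η ^ (2 * (K + i)) *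
          (2 ^ (2 * (K + i)) * (2 * (K + i) + 1) ^ (2 * (K + i) + 1) : ℕ) / n)) := by
  set μ := SimpleGraph.binomialRandom (Fin n) q
  set Z : ℕ → Set (SimpleGraph (Fin n)) := fun k =>
    {G | (η / u) ^ k < ‖typedSum (adjacency G) q k (fun w _ => SelfAvoiding k w)‖}
  set R : ℕ → Set (SimpleGraph (Fin n)) := fun k =>
    {G | (η / u) ^ k < ‖typedSum (adjacency G) q k
      (fun w τ => NoBacktrack k w τ ∧ ¬ SelfAvoiding k w)‖}
  set D : Set (SimpleGraph (Fin n)) := {G | ∃ i, (L : ℝ) < (adjacency G).mulVec 1 i}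
  have hsub : {G | ¬ (deformedLaplacian (adjacency G) q u).PosDef} ⊆
      D ∪ ⋃ i ∈ Finset.range 3, (Z (K + i) ∪ R (K + i)) := by
    intro G hG
    by_contra hc
    simp only [Set.mem_union, Set.mem_iUnion, not_or, not_exists] at hc
    obtain ⟨hD, hc⟩ := hc
    apply hG
    refine posDef_deformedLaplacian (d := d) (Δ := L) (ε := 2 * η ^ K) (adjacency_isSymm G)
      (adjacency_mul_self G) q.2.1 ?_ hu.le hu1 (by exact_mod_cast hL) ?_ K ?_ hε
    · rw [hq, Fintype.card_fin, div_mul_cancel₀ _ (by positivity)]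
    · intro i
      by_contra hi
      exact hD ⟨i, not_le.1 hi⟩
    · intro l h1 h2
      obtain ⟨i, rfl⟩ := Nat.exists_eq_add_of_le h1
      obtain ⟨hZ, hR⟩ := hc i (Finset.mem_range.2 (by omega))
      have hZ' : ‖typedSum (adjacency G) q (K + i) (fun w _ => SelfAvoiding (K + i) w)‖ ≤
          (η / u) ^ (K + i) := not_lt.1 hZ
      have hR' : ‖typedSum (adjacency G) q (K + i)
          (fun w τ => NoBacktrack (K + i) w τ ∧ ¬ SelfAvoiding (K + i) w)‖ ≤
          (η / u) ^ (K + i) := not_lt.1 hR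
      rw [nbSum_eq_add]
      calc u ^ (K + i) * ‖_ + _‖ ≤ u ^ (K + i) * ((η / u) ^ (K + i) + (η / u) ^ (K + i)) := by
            gcongr
            exact (norm_add_le _ _).trans (add_le_add hZ' hR')
        _ = 2 * η ^ (K + i) := by
            rw [div_pow, ← two_mul, mul_left_comm, mul_div_cancel₀ _ (by positivity)]
        _ ≤ 2 * η ^ K := by
            gcongr 2 * ?_
            exact pow_le_pow_of_le_one hη.le hη1 (by omega)
  refine (measureReal_mono hsub).trans ((measureReal_union_le _ _).trans (add_le_add
    (measureReal_degree_gt_le hn hq L) ((measureReal_biUnion_finset_le _ _).trans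
    (Finset.sum_le_sum fun i hi => (measureReal_union_le _ _).trans (add_le_add ?_ ?_)))))
  · exact measureReal_norm_selfAvoiding_gt_le hq hd hu hη hηd (by omega) hm
      (hQ i (Finset.mem_range.1 hi))
  · exact measureReal_norm_returning_gt_le hn hq hd hu hη hηd _

end Probability

/-! ### The length of the words as a function of the number of vertices -/

section Asymptotics

lemma eventually_mul_pow_le_exp (C : ℝ) (k : ℕ) {b : ℝ} (hb : 0 < b) :
    ∀ᶠ s : ℕ in atTop, C * (s : ℝ) ^ k ≤ Real.exp (b * s) := by
  have h := ((isLittleO_pow_exp_pos_mul_atTop k hb).const_mul_left C).bound one_pos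
  filter_upwards [tendsto_natCast_atTop_atTop.eventually h] with s hs
  rw [one_mul, Real.norm_eq_abs, Real.norm_eq_abs, Real.abs_exp] at hs
  exact (le_abs_self _).trans hs

/-- The number of patterns in the trace method is `exp (O(s ^ 2 * log s))`. -/
lemma eventually_patternBase_pow_le {i : ℕ} (hi : i < 3) :
    ∀ᶠ s : ℕ in atTop, ((patternBase (2 * s ^ 2 * (s ^ 3 + i)) ^ (6 * (2 * s ^ 2)) : ℕ) : ℝ) ≤
      Real.exp ((s : ℝ) ^ 3) := by
  filter_upwards [eventually_mul_pow_le_exp (4 * 7 ^ 5) 25 (b := 1 / 12) (by norm_num),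
    eventually_ge_atTop 1] with s hs h1
  have hN : 2 * s ^ 2 * (s ^ 3 + i) + 1 ≤ 7 * s ^ 5 := by
    have h2 : 1 ≤ s ^ 3 := Nat.one_le_pow _ _ h1
    have h3 : 1 ≤ s ^ 5 := Nat.one_le_pow _ _ h1
    calc 2 * s ^ 2 * (s ^ 3 + i) + 1 ≤ 2 * s ^ 2 * (s ^ 3 + 2 * s ^ 3) + s ^ 5 := by
          gcongr
          omega
      _ = 7 * s ^ 5 := by ring
  have hP : patternBase (2 * s ^ 2 * (s ^ 3 + i)) ≤ 4 * 7 ^ 5 * s ^ 25 := by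
    set N := 2 * s ^ 2 * (s ^ 3 + i)
    calc patternBase N = (N + 1) ^ 2 * (4 * N * (N + 1) ^ 2 + 1) := rfl
      _ ≤ (N + 1) ^ 2 * (4 * N * (N + 1) ^ 2 + 4 * (N + 1) ^ 2) := by
          gcongr
          nlinarith [Nat.zero_le N]
      _ = 4 * (N + 1) ^ 5 := by ring
      _ ≤ 4 * (7 * s ^ 5) ^ 5 := by gcongr
      _ = 4 * 7 ^ 5 * s ^ 25 := by ring
  have hP' : (patternBase (2 * s ^ 2 * (s ^ 3 + i)) : ℝ) ≤ Real.exp (1 / 12 * s) :=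
    le_trans (by exact_mod_cast hP) hs
  rw [Nat.cast_pow]
  calc (patternBase (2 * s ^ 2 * (s ^ 3 + i)) : ℝ) ^ (6 * (2 * s ^ 2))
      ≤ Real.exp (1 / 12 * s) ^ (6 * (2 * s ^ 2)) := by gcongr
    _ = Real.exp ((s : ℝ) ^ 3) := by
        rw [← Real.exp_nat_mul]
        congr 1
        push_cast
        ring

/-- The integer part of the fourth root of `log n`. The words considered have about
`rootLog n ^ 3` steps, and the trace method uses the power `2 * rootLog n ^ 2`. -/
noncomputable def rootLog (n : ℕ) : ℕ := ⌊Real.log n ^ (1 / 4 : ℝ)⌋₊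

lemma tendsto_rootLog : Tendsto rootLog atTop atTop :=
  tendsto_nat_floor_atTop.comp ((tendsto_rpow_atTop (by norm_num)).comp
    (Real.tendsto_log_atTop.comp tendsto_natCast_atTop_atTop))

lemma exp_rootLog_pow_le {n : ℕ} (hn : 0 < n) : Real.exp ((rootLog n : ℝ) ^ 4) ≤ n := by
  have h0 : 0 ≤ Real.log n := Real.log_natCast_nonneg n
  have h1 : (rootLog n : ℝ) ≤ Real.log n ^ (1 / 4 : ℝ) := Nat.floor_le (by positivity)
  rw [← Real.le_log_iff_exp_le (by positivity)]
  calc (rootLog n : ℝ) ^ 4 ≤ (Real.log n ^ (1 / 4 : ℝ)) ^ 4 := by gcongr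
    _ = Real.log n := by
      rw [← Real.rpow_natCast, ← Real.rpow_mul h0]
      norm_num

lemma le_exp_rootLog_add_one_pow {n : ℕ} (hn : 0 < n) :
    (n : ℝ) ≤ Real.exp (((rootLog n : ℝ) + 1) ^ 4) := by
  have h0 : 0 ≤ Real.log n := Real.log_natCast_nonneg n
  have h1 : Real.log n ^ (1 / 4 : ℝ) ≤ (rootLog n : ℝ) + 1 := (Nat.lt_floor_add_one _).le
  rw [← Real.log_le_iff_le_exp (by positivity)]
  calc Real.log n = (Real.log n ^ (1 / 4 : ℝ)) ^ 4 := by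
        rw [← Real.rpow_natCast, ← Real.rpow_mul h0]
        norm_num
    _ ≤ ((rootLog n : ℝ) + 1) ^ 4 := by gcongr

lemma tendsto_exp_neg_rootLog : Tendsto (fun n => Real.exp (-(rootLog n : ℝ))) atTop (𝓝 0) :=
  Real.tendsto_exp_neg_atTop_nhds_zero.comp (tendsto_natCast_atTop_atTop.comp tendsto_rootLog)

variable {η d : ℝ}

lemma tendsto_selfAvoiding_bound (hη : 0 < η) (hη1 : η < 1) {i : ℕ} (hi : i < 3) :
    Tendsto (fun n : ℕ => 2 * (n : ℝ) * (patternBase (2 * rootLog n ^ 2 * (rootLog n ^ 3 + i)) ^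
      (6 * (2 * rootLog n ^ 2)) : ℕ) * η ^ (2 * rootLog n ^ 2 * (rootLog n ^ 3 + i)))
      atTop (𝓝 0) := by
  -- the exponent `(s + 1) ^ 4 + s ^ 3 - 2 * c * s ^ 5` is at most `-s` as soon as `9 ≤ s * c`
  obtain ⟨c, hc, rfl⟩ : ∃ c, 0 < c ∧ Real.exp (-c) = η :=
    ⟨-Real.log η, by linarith [Real.log_neg hη hη1], by rw [neg_neg, Real.exp_log hη]⟩
  refine squeeze_zero' (.of_forall fun n => by positivity) ?_
    (by simpa using tendsto_exp_neg_rootLog.const_mul 2)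
  filter_upwards [tendsto_rootLog.eventually (eventually_patternBase_pow_le hi),
    eventually_gt_atTop 0, tendsto_rootLog.eventually (eventually_ge_atTop 1),
    tendsto_rootLog.eventually (tendsto_natCast_atTop_atTop.eventually_ge_atTop (9 / c))]
    with n hQ hn h1 h9
  have hn' := le_exp_rootLog_add_one_pow hn
  set s := rootLog n
  have h1' : (1 : ℝ) ≤ s := by exact_mod_cast h1
  rw [div_le_iff₀ hc] at h9
  calc 2 * (n : ℝ) * (patternBase (2 * s ^ 2 * (s ^ 3 + i)) ^ (6 * (2 * s ^ 2)) : ℕ) *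
        Real.exp (-c) ^ (2 * s ^ 2 * (s ^ 3 + i))
      ≤ 2 * Real.exp (((s : ℝ) + 1) ^ 4) * Real.exp ((s : ℝ) ^ 3) *
        Real.exp (-c) ^ (2 * s ^ 2 * s ^ 3) := by
        gcongr 2 * ?_ * ?_ * ?_
        exact pow_le_pow_of_le_one (Real.exp_pos _).le hη1.le (by gcongr; omega)
    _ = 2 * Real.exp (((s : ℝ) + 1) ^ 4 + (s : ℝ) ^ 3 - 2 * (s * c) * (s : ℝ) ^ 4) := by
        rw [← Real.exp_nat_mul, mul_assoc, mul_assoc, ← Real.exp_add, ← Real.exp_add]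
        congr 2
        push_cast
        ring
    _ ≤ 2 * Real.exp (-(s : ℝ)) := by
        gcongr
        have e1 : ((s : ℝ) + 1) ^ 4 ≤ (2 * s) ^ 4 := by gcongr; linarith
        have e2 : (s : ℝ) ^ 3 ≤ s ^ 4 := pow_le_pow_right₀ h1' (by norm_num)
        have e3 : (s : ℝ) ≤ s ^ 4 := le_self_pow₀ h1' (by norm_num)
        have e4 : 9 * (s : ℝ) ^ 4 ≤ (s * c) * s ^ 4 := by gcongr
        nlinarith

lemma tendsto_unicyclic_bound (hη : 0 < η) (hη1 : η < 1) :
    Tendsto (fun k : ℕ => η ^ (2 * k) *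
      ((2 * k + 1) ^ 2 * (4 * (2 * k) * (2 * k + 1) ^ 2 + 1) ^ 9 : ℕ)) atTop (𝓝 0) := by
  have h := (tendsto_pow_const_mul_const_pow_of_lt_one 29 (r := η ^ 2) (by positivity)
    (by nlinarith)).const_mul (3 ^ 2 * 135 ^ 9)
  rw [mul_zero] at h
  refine squeeze_zero' (.of_forall fun k => by positivity) ?_ h
  filter_upwards [eventually_ge_atTop 1] with k hk
  have h1 : 2 * k + 1 ≤ 3 * k := by omega
  have h2 : 4 * (2 * k) * (2 * k + 1) ^ 2 + 1 ≤ 135 * k ^ 3 := by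
    have h3 : 1 ≤ k ^ 3 := Nat.one_le_pow _ _ hk
    calc 4 * (2 * k) * (2 * k + 1) ^ 2 + 1 ≤ 4 * (2 * k) * (3 * k) ^ 2 + k ^ 3 := by gcongr
      _ = 73 * k ^ 3 := by ring
      _ ≤ 135 * k ^ 3 := by gcongr; norm_num
  have h4 : (2 * k + 1) ^ 2 * (4 * (2 * k) * (2 * k + 1) ^ 2 + 1) ^ 9 ≤
      3 ^ 2 * 135 ^ 9 * k ^ 29 := by
    calc _ ≤ (3 * k) ^ 2 * (135 * k ^ 3) ^ 9 := by gcongr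
      _ = 3 ^ 2 * 135 ^ 9 * k ^ 29 := by ring
  have h5 : (((2 * k + 1) ^ 2 * (4 * (2 * k) * (2 * k + 1) ^ 2 + 1) ^ 9 : ℕ) : ℝ) ≤
      3 ^ 2 * 135 ^ 9 * (k : ℝ) ^ 29 := by exact_mod_cast h4
  calc η ^ (2 * k) * ((2 * k + 1) ^ 2 * (4 * (2 * k) * (2 * k + 1) ^ 2 + 1) ^ 9 : ℕ)
      ≤ η ^ (2 * k) * (3 ^ 2 * 135 ^ 9 * (k : ℝ) ^ 29) :=
        mul_le_mul_of_nonneg_left h5 (by positivity)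
    _ = 3 ^ 2 * 135 ^ 9 * ((k : ℝ) ^ 29 * (η ^ 2) ^ k) := by
        rw [pow_mul]
        ring

lemma tendsto_excess_bound (hη : 0 < η) (hη1 : η < 1) (hd : 1 ≤ d) {i : ℕ} (hi : i < 3) :
    Tendsto (fun n : ℕ => d ^ (rootLog n ^ 3 + i) * η ^ (2 * (rootLog n ^ 3 + i)) *
      (2 ^ (2 * (rootLog n ^ 3 + i)) * (2 * (rootLog n ^ 3 + i) + 1) ^
        (2 * (rootLog n ^ 3 + i) + 1) : ℕ) / n) atTop (𝓝 0) := by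
  refine squeeze_zero' (.of_forall fun n => by positivity) ?_ tendsto_exp_neg_rootLog
  filter_upwards [tendsto_rootLog.eventually (eventually_mul_pow_le_exp (d ^ 3 * 14 ^ 7) 21
    (b := 1 / 2) (by norm_num)), eventually_gt_atTop 0,
    tendsto_rootLog.eventually (eventually_ge_atTop 2)] with n hs hn h2
  have hn' := exp_rootLog_pow_le hn
  set s := rootLog n
  have h2' : (2 : ℝ) ≤ s := by exact_mod_cast h2
  have h3 : 1 ≤ s ^ 3 := Nat.one_le_pow _ _ (by omega)
  set k := s ^ 3 + i
  have hk : k ≤ 3 * s ^ 3 := by omega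
  -- the numerator is of the form `(C * s ^ 21) ^ (s ^ 3)`, which `exp (s ^ 4)` dominates
  have e1 : 2 ^ (2 * k) * (2 * k + 1) ^ (2 * k + 1) ≤ (14 * s ^ 3) ^ (7 * s ^ 3) := by
    calc 2 ^ (2 * k) * (2 * k + 1) ^ (2 * k + 1) ≤ 2 ^ (2 * k + 1) * (2 * k + 1) ^ (2 * k + 1) := by
          gcongr <;> omega
      _ = (2 * (2 * k + 1)) ^ (2 * k + 1) := by rw [mul_pow]
      _ ≤ (14 * s ^ 3) ^ (2 * k + 1) := Nat.pow_le_pow_left (by omega) _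
      _ ≤ (14 * s ^ 3) ^ (7 * s ^ 3) := Nat.pow_le_pow_right (by omega) (by omega)
  have e1' : ((2 ^ (2 * k) * (2 * k + 1) ^ (2 * k + 1) : ℕ) : ℝ) ≤
      (14 * (s : ℝ) ^ 3) ^ (7 * s ^ 3) := by exact_mod_cast e1
  rw [div_le_iff₀ (by positivity)]
  calc d ^ k * η ^ (2 * k) * (2 ^ (2 * k) * (2 * k + 1) ^ (2 * k + 1) : ℕ)
      ≤ d ^ (3 * s ^ 3) * 1 * (14 * (s : ℝ) ^ 3) ^ (7 * s ^ 3) := by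
        gcongr
        exact pow_le_one₀ hη.le hη1.le
    _ = (d ^ 3 * 14 ^ 7 * (s : ℝ) ^ 21) ^ (s ^ 3) := by
        rw [mul_one, pow_mul, pow_mul, ← mul_pow]
        congr 1
        ring
    _ ≤ Real.exp (1 / 2 * s) ^ (s ^ 3) := by gcongr
    _ = Real.exp (1 / 2 * (s : ℝ) ^ 4) := by
        rw [← Real.exp_nat_mul]
        congr 1
        push_cast
        ring
    _ ≤ Real.exp (-(s : ℝ) + (s : ℝ) ^ 4) := by
        gcongr
        have e3 : (2 : ℝ) ^ 3 ≤ s ^ 3 := by gcongr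
        nlinarith
    _ = Real.exp (-(s : ℝ)) * Real.exp ((s : ℝ) ^ 4) := Real.exp_add _ _
    _ ≤ Real.exp (-(s : ℝ)) * n := by gcongr

lemma tendsto_degree_bound (d : ℝ) :
    Tendsto (fun n : ℕ => n * Real.exp d / 2 ^ (4 * (rootLog n + 1) ^ 4)) atTop (𝓝 0) := by
  refine squeeze_zero' (.of_forall fun n => by positivity) ?_
    (tendsto_const_div_atTop_nhds_zero_nat (Real.exp d))
  filter_upwards [eventually_gt_atTop 0] with n hn
  have hn' := le_exp_rootLog_add_one_pow hn
  set s := rootLog n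
  have h4 : Real.exp 2 ≤ 2 ^ 4 := by
    have := Real.exp_one_lt_d9
    calc Real.exp 2 = Real.exp 1 ^ 2 := by rw [← Real.exp_nat_mul]; norm_num
      _ ≤ 4 ^ 2 := by gcongr; linarith
      _ = 2 ^ 4 := by norm_num
  have h5 : (n : ℝ) * n ≤ 2 ^ (4 * (s + 1) ^ 4) := by
    calc (n : ℝ) * n ≤ Real.exp (((s : ℝ) + 1) ^ 4) * Real.exp (((s : ℝ) + 1) ^ 4) := by gcongr
      _ = Real.exp 2 ^ ((s + 1) ^ 4) := by
        rw [← Real.exp_add, ← Real.exp_nat_mul]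
        congr 1
        push_cast
        ring
      _ ≤ (2 ^ 4) ^ ((s + 1) ^ 4) := by gcongr
      _ = 2 ^ (4 * (s + 1) ^ 4) := by rw [← pow_mul]
  rw [div_le_div_iff₀ (by positivity) (by positivity)]
  calc n * Real.exp d * n = Real.exp d * (n * n) := by ring
    _ ≤ _ := by gcongr

/-- The smallness condition of `posDef_deformedLaplacian` for words of `s ^ 3` steps and degrees up to
`4 * (s + 1) ^ 4`. -/
lemma eventually_tail_lt (hη : 0 < η) (hη1 : η < 1) (hd : 0 ≤ d) {r : ℝ} (hr : 0 < r) :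
    ∀ᶠ s : ℕ in atTop, 2 * η ^ (s ^ 3) * (1 + (4 * (s + 1) ^ 4 : ℕ) + 2 * d) < r := by
  have h := (tendsto_pow_const_mul_const_pow_of_lt_one 4 hη.le hη1).const_mul
    (2 * (1 + 4 * 2 ^ 4 + 2 * d))
  rw [mul_zero] at h
  filter_upwards [h.eventually (gt_mem_nhds hr), eventually_ge_atTop 1] with s hs h1
  refine lt_of_le_of_lt ?_ hs
  have h1' : (1 : ℝ) ≤ s := by exact_mod_cast h1
  have e1 : η ^ (s ^ 3) ≤ η ^ s :=
    pow_le_pow_of_le_one hη.le hη1.le (Nat.le_self_pow (by norm_num) s)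
  have e2 : (1 : ℝ) ≤ (s : ℝ) ^ 4 := one_le_pow₀ h1'
  have e3 : 1 + ((4 * (s + 1) ^ 4 : ℕ) : ℝ) + 2 * d ≤ (1 + 4 * 2 ^ 4 + 2 * d) * (s : ℝ) ^ 4 := by
    push_cast
    have : ((s : ℝ) + 1) ^ 4 ≤ (2 * s) ^ 4 := by gcongr; linarith
    nlinarith [mul_le_mul_of_nonneg_left e2 hd]
  calc 2 * η ^ (s ^ 3) * (1 + (4 * (s + 1) ^ 4 : ℕ) + 2 * d)
      ≤ 2 * η ^ s * ((1 + 4 * 2 ^ 4 + 2 * d) * (s : ℝ) ^ 4) := by gcongr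
    _ = _ := by ring

end Asymptotics

/-! ### The spectral bound -/

section Main

/-- The matrix in question is `u⁻¹` times the deformed Laplacian plus `δ / u`. -/
lemma posDef_of_deformedLaplacian {n : ℕ} {G : SimpleGraph (Fin n)} {d δ u : ℝ} (hδ : 0 < δ)
    (hu : 0 < u) (h : (deformedLaplacian (adjacency G) (d / n) u).PosDef) :
    (((1 + δ - u ^ 2) / u) • (1 : Matrix (Fin n) (Fin n) ℝ) + u • degreeMatrix G - adjacency G +
      ((1 - u ^ 2) * d / (n : ℝ)) • onesMatrix n).PosDef := by
  have h1 : ((1 + δ - u ^ 2) / u) • (1 : Matrix (Fin n) (Fin n) ℝ) + u • degreeMatrix G -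
      adjacency G + ((1 - u ^ 2) * d / (n : ℝ)) • onesMatrix n =
      u⁻¹ • deformedLaplacian (adjacency G) (d / n) u +
        (δ / u) • (1 : Matrix (Fin n) (Fin n) ℝ) := by
    have h2 : onesMatrix n = Matrix.of fun _ _ => (1 : ℝ) := by
      ext i j
      simp [onesMatrix, Matrix.vecMulVec_apply]
    rw [h2, deformedLaplacian, degreeMatrix]
    ext i j
    simp only [Matrix.add_apply, Matrix.sub_apply, Matrix.smul_apply, smul_eq_mul,
      Matrix.of_apply]
    field_simp
    ring
  rw [h1]
  exact (h.smul (inv_pos.2 hu)).add (Matrix.PosDef.one.smul (div_pos hδ hu))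

end Main

theorem theorem5 (d δ u : ℝ) (hd : 1 < d) (hδ₀ : 0 < δ) (hδ₁ : δ < 1 / Real.sqrt d)
    (hu : u = 1 / Real.sqrt d - δ) :
    Tendsto
      (fun n : ℕ => erdosRenyi n d
        {G : SimpleGraph (Fin n) |
          (((1 + δ - u ^ 2) / u) • (1 : Matrix (Fin n) (Fin n) ℝ)
            + u • degreeMatrix G - adjacency G
            + ((1 - u ^ 2) * d / (n : ℝ)) • onesMatrix n).PosDef})
      atTop (𝓝 1) := by
  have hsd : 1 < Real.sqrt d := Real.lt_sqrt_of_sq_lt (by simpa using hd)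
  have hu0 : 0 < u := by linarith
  have hus : u < 1 / Real.sqrt d := by linarith
  have hu1 : u < 1 := hus.trans ((div_lt_one (by linarith)).2 hsd)
  -- the parameter `η` is a square root of `u √d`, which is less than one
  obtain ⟨η, hη, hη1, hηd⟩ : ∃ η : ℝ, 0 < η ∧ η < 1 ∧ η ^ 4 = d * u ^ 2 := by
    have h1 : u * Real.sqrt d < 1 := by
      rwa [lt_div_iff₀ (by linarith)] at hus
    refine ⟨Real.sqrt (u * Real.sqrt d), by positivity, ?_, ?_⟩
    · rw [Real.sqrt_lt' one_pos]
      simpa using h1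
    · rw [show 4 = 2 * 2 from rfl, pow_mul, Real.sq_sqrt (by positivity), mul_pow,
        Real.sq_sqrt (by linarith), mul_comm]
  have hr : 0 < 1 - u ^ 2 := by nlinarith
  have hK : Tendsto (fun n => rootLog n ^ 3) atTop atTop :=
    (tendsto_pow_atTop (by norm_num)).comp tendsto_rootLog
  have hlim := (tendsto_degree_bound d).add (tendsto_finsetSum (Finset.range 3) fun i hi =>
    (tendsto_selfAvoiding_bound hη hη1 (Finset.mem_range.1 hi)).add
    (((tendsto_unicyclic_bound hη hη1).comp ((tendsto_add_atTop_nat i).comp hK)).add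
    (tendsto_excess_bound hη hη1 hd.le (Finset.mem_range.1 hi))))
  simp only [add_zero, Finset.sum_const_zero, Function.comp_apply] at hlim
  replace hlim := hlim.const_sub 1
  rw [sub_zero] at hlim
  have hreal : Tendsto (fun n : ℕ => (erdosRenyi n d).real
      {G : SimpleGraph (Fin n) | (((1 + δ - u ^ 2) / u) • (1 : Matrix (Fin n) (Fin n) ℝ)
        + u • degreeMatrix G - adjacency G
        + ((1 - u ^ 2) * d / (n : ℝ)) • onesMatrix n).PosDef}) atTop (𝓝 1) := by
    refine tendsto_of_tendsto_of_tendsto_of_le_of_le' hlim tendsto_const_nhds ?_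
      (.of_forall fun n => ?_)
    · filter_upwards [eventually_gt_atTop 0, eventually_ge_atTop ⌈d⌉₊,
        tendsto_rootLog.eventually (eventually_tail_lt hη hη1 (by linarith : 0 ≤ d) hr),
        tendsto_rootLog.eventually ((Filter.eventually_all_finset (Finset.range 3)).2
          fun i hi => eventually_patternBase_pow_le (Finset.mem_range.1 hi)),
        tendsto_rootLog.eventually (eventually_ge_atTop 2)] with n hn hdn htail hQ h2
      have hdn' : d ≤ n := Nat.ceil_le.1 hdn
      have hn' : (0 : ℝ) < n := by exact_mod_cast hn
      have hq : ((Set.projIcc (0 : ℝ) 1 zero_le_one (d / n) : Set.Icc (0 : ℝ) 1) : ℝ) = d / n := by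
        rw [Set.projIcc_of_mem zero_le_one ⟨by positivity, (div_le_one hn').2 hdn'⟩]
      have key := measureReal_not_posDef_le hn hq hd.le hu0 hu1 hη hη1.le hηd
        (K := rootLog n ^ 3) (m := rootLog n ^ 2) (L := 4 * (rootLog n + 1) ^ 4)
        (by positivity) (by positivity) (by positivity) ?_ htail
      · rw [hq] at key
        refine (sub_le_sub_left key 1).trans ?_
        rw [← MeasureTheory.probReal_compl_eq_one_sub (Set.toFinite _).measurableSet]
        refine MeasureTheory.measureReal_mono (μ := erdosRenyi n d) ?_ ?_
        · intro G hG
          exact posDef_of_deformedLaplacian hδ₀ hu0 (not_not.1 hG)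
        · unfold erdosRenyi
          exact MeasureTheory.measure_ne_top _ _
      · intro i hi
        have h1 := hQ i (Finset.mem_range.2 hi)
        have h2' : (2 : ℝ) ≤ rootLog n := by exact_mod_cast h2
        have h3 : 2 * ((patternBase (2 * rootLog n ^ 2 * (rootLog n ^ 3 + i)) ^
            (6 * (2 * rootLog n ^ 2)) : ℕ) : ℝ) ≤ n := by
          calc _ ≤ Real.exp 1 * Real.exp ((rootLog n : ℝ) ^ 3) := by
                gcongr
                linarith [Real.add_one_le_exp 1]
            _ = Real.exp (1 + (rootLog n : ℝ) ^ 3) := (Real.exp_add _ _).symm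
            _ ≤ Real.exp ((rootLog n : ℝ) ^ 4) := by
                gcongr
                have : (1 : ℝ) ≤ (rootLog n : ℝ) ^ 3 := one_le_pow₀ (by linarith)
                nlinarith
            _ ≤ n := exp_rootLog_pow_le hn
        exact_mod_cast h3
    · unfold erdosRenyi
      exact MeasureTheory.measureReal_le_one
  have h := ENNReal.tendsto_ofReal hreal
  rw [ENNReal.ofReal_one] at h
  refine h.congr fun n => ?_
  unfold erdosRenyi
  exact MeasureTheory.ofReal_measureReal
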